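/- **Notation.** Let $q$ be a prime power, $\gamma$ a generator of $\mathbb F_q^*$, $N=q-1=nm$ and $0\le k<N$. The folded Reed–Solomon code $\mathrm{RS}^{(m)}_{\mathbb F_q,\gamma,k}$ is the set of words $(f(\gamma),f(\gamma^2),\dots,f(\gamma^{N}))$, $f\in\mathbb F_q[X]$, $\deg f\le k$, cut into $n$ consecutive blocks of length $m$; it is an $\mathbb F_q$-linear code of length $n$ over the alphabet $\Sigma=\mathbb F_q^m$. The dual of a linear $C\subseteq\Sigma^n$ is $C^\perp=\{\mathbf z\in\Sigma^n:\ \mathbf x\cdot\mathbf z=0 \text{ for all } \mathbf x\in C\}$, where $\cdot$ is the standard bilinear form on $\mathbb F_q^{nm}=\Sigma^n$. The code $C$ is $(\zeta,\ell,L)$-list recoverable if for all $S_1,\dots,S_n\subseteq\Sigma$ with $|S_i|\le\ell$ one has $|\{\mathbf x\in C: |\{i: x_i\in S_i\}|\ge(1-\zeta)n\}|\le L$. For $\mathbf x\in\Sigma^n$, $\mathsf{hw}(\mathbf x)=|\{i: x_i\ne \mathbf 0\}|$. **Statement.** For all constants $0<c<c'<1$ there is a family $\{C_\lambda\}_{\lambda\in\mathbb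 N}$ of folded Reed–Solomon codes (with $q$, $n$, $m$, $k$, $\gamma$, $\Sigma$ depending on $\lambda$) that is explicit, i.e. a single deterministic algorithm computes from $\lambda$, in time $\mathrm{poly}(\lambda)$, the parameters $q,n,m,k$, the generator $\gamma$, and the addition and multiplication tables of $\mathbb F_q$ (whose elements are numbered $0,\dots,q-1$), such that $|\Sigma|=2^{\lambda^{\Theta(1)}}$ and $n=\Theta(\lambda)$ as $\lambda\to\infty$, $|C_\lambda|\ge 2^{n+\lambda}$ for all $\lambda$, and the following hold. 1. There are a constant $\zeta>0$ and a function $L=2^{\tilde O(\lambda^{c'})}$ such that, for every $\lambda$, $C_\lambda$ is $(\zeta,2^{\lambda^c},L(\lambda))$-list recoverable. 2. There is a single deterministic algorithm which, on input $\lambda$ and $\mathbf z\in\Sigma^n$, outputs in time $\mathrm{poly}(\lambda)$ a word $\mathsf{Decode}_{C_\lambda^\perp}(\mathbf z)\in\Sigma^n$, such that $$\Pr_{\mathbf e\leftarrow\mathcal D^n}\left[\forall\,\mathbf x\in C_\lambda^\perp:\ \mathsf{Decode}_{C_\lambda^\perp}(\mathbf x+\mathbf e)=\mathbf x\right]\ \ge\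 1-2^{-\Omega(\lambda)},$$ where $\mathcal D$ is the distribution on $\Sigma$ that takes the value $\mathbf 0$ with probability $1/2$ and is otherwise uniform on $\Sigma\setminus\{\mathbf 0\}$. 3. For every $\lambda$ and every $1\le j\le n-1$, for a uniformly random codeword $\mathbf x\leftarrow C_\lambda$, $\Pr[\mathsf{hw}(\mathbf x)=n-j]\le (n/|\Sigma|)^j$. -/

import Mathlib

open Filter

/-! ### Random access machines with a step count

A random access machine has registers `reg 0, reg 1, …` and arrays `arr 0, arr 1, …`, all holding
natural numbers.  A program is a finite text, so it names finitely many registers and arrays.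
Every instruction and every test costs one step.  The only arithmetic is addition and truncated
subtraction, so numbers gain at most one bit per step and unit cost is, up to polynomials, the cost
on a multitape Turing machine. -/

namespace RAM

structure State where
  reg : ℕ → ℕ
  arr : ℕ → ℕ → ℕ

inductive Prog where
  /-- `reg x := c` -/
  | const (x c : ℕ)
  /-- `reg x := reg y + reg z` -/
  | add (x y z : ℕ)
  /-- `reg x := reg y - reg z` (zero if negative) -/
  | sub (x y z : ℕ)
  /-- `reg x := arr a (reg y)` -/
  | load (x a y : ℕ)
  /-- `arr a (reg y) := reg x` -/
  | store (a y x : ℕ)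
  /-- first `P`, then `Q` -/
  | seq (P Q : Prog)
  /-- if `reg x ≠ 0` then `P` else `Q` -/
  | ite (x : ℕ) (P Q : Prog)
  /-- while `reg x ≠ 0` do `P` -/
  | loop (x : ℕ) (P : Prog)

namespace State

def setReg (s : State) (x v : ℕ) : State :=
  { s with reg := Function.update s.reg x v }

def setArr (s : State) (a i v : ℕ) : State :=
  { s with arr := Function.update s.arr a (Function.update (s.arr a) i v) }

/-- The initial state on an input list: the list is in array `0`, its length is in register `0`,
and everything else is `0`. -/
def init (l : List ℕ) : State where
  reg x := if x = 0 then l.length else 0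
  arr a i := if a = 0 then l.getD i 0 else 0

end State

/-- `Exec P s t s'`: started in state `s`, the program `P` halts in state `s'` after exactly `t`
steps. -/
inductive Exec : Prog → State → ℕ → State → Prop
  | const (s : State) (x c : ℕ) : Exec (.const x c) s 1 (s.setReg x c)
  | add (s : State) (x y z : ℕ) : Exec (.add x y z) s 1 (s.setReg x (s.reg y + s.reg z))
  | sub (s : State) (x y z : ℕ) : Exec (.sub x y z) s 1 (s.setReg x (s.reg y - s.reg z))
  | load (s : State) (x a y : ℕ) : Exec (.load x a y) s 1 (s.setReg x (s.arr a (s.reg y)))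
  | store (s : State) (a y x : ℕ) : Exec (.store a y x) s 1 (s.setArr a (s.reg y) (s.reg x))
  | seq {P Q : Prog} {s s' s'' : State} {t t' : ℕ} :
      Exec P s t s' → Exec Q s' t' s'' → Exec (.seq P Q) s (t + t') s''
  | ite_true {x : ℕ} {P Q : Prog} {s s' : State} {t : ℕ} :
      s.reg x ≠ 0 → Exec P s t s' → Exec (.ite x P Q) s (t + 1) s'
  | ite_false {x : ℕ} {P Q : Prog} {s s' : State} {t : ℕ} :
      s.reg x = 0 → Exec Q s t s' → Exec (.ite x P Q) s (t + 1) s'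
  | loop_done {x : ℕ} {P : Prog} {s : State} :
      s.reg x = 0 → Exec (.loop x P) s 1 s
  | loop_step {x : ℕ} {P : Prog} {s s' s'' : State} {t t' : ℕ} :
      s.reg x ≠ 0 → Exec P s t s' → Exec (.loop x P) s' t' s'' →
        Exec (.loop x P) s (t + t' + 1) s''

/-- On input `inp` the program `P` halts within `T` steps with output `out`: the length of `out` is
in register `1`, and its entries are in array `1`. -/
def OutputsWithin (P : Prog) (inp out : List ℕ) (T : ℕ) : Prop :=
  ∃ t s, t ≤ T ∧ Exec P (State.init inp) t s ∧ s.reg 1 = out.length ∧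
    ∀ i (hi : i < out.length), s.arr 1 i = out[i]

/-- A single program maps `inp i` to `out i`, for all `i`, in time polynomial in `size i`. -/
def PolyTime {ι : Type*} (size : ι → ℕ) (inp out : ι → List ℕ) : Prop :=
  ∃ (P : Prog) (p : Polynomial ℕ), ∀ i, OutputsWithin P (inp i) (out i) (p.eval (size i))

end RAM

/-! ### Codes -/

namespace Code

/-- The code `C` of length `n` is `(ζ, ℓ, L)`-list recoverable. -/
def ListRecoverable {A : Type*} [Finite A] {n : ℕ} (C : Set (Fin n → A)) (ζ ℓ L : ℝ) : Prop :=
  ∀ S : Fin n → Set A, (∀ i, ((S i).ncard : ℝ) ≤ ℓ) →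
    ({x ∈ C | (1 - ζ) * n ≤ ({i | x i ∈ S i}.ncard : ℝ)}.ncard : ℝ) ≤ L

section Linear

variable (F : Type*) [Field F]

/-- The canonical identification of `F^(n*m)` with `(F^m)^n`: consecutive blocks of length `m`. -/
def foldEquiv (n m : ℕ) : (Fin (n * m) → F) ≃ₗ[F] (Fin n → Fin m → F) :=
  (LinearEquiv.funCongrLeft F F finProdFinEquiv).trans (LinearEquiv.curry F F (Fin n) (Fin m))

variable {F}

/-- The `m`-folded version of a linear code of length `n * m`. -/
def folded {n m : ℕ} (C : Submodule F (Fin (n * m) → F)) : Submodule F (Fin n → Fin m → F) :=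
  C.map (foldEquiv F n m).toLinearMap

/-- The Reed–Solomon code `{(f(γ), f(γ^2), …, f(γ^N)) : deg f ≤ k}`. -/
noncomputable def reedSolomon (γ : F) (N k : ℕ) : Submodule F (Fin N → F) :=
  (Polynomial.degreeLE F (k : WithBot ℕ)).map
    (LinearMap.pi fun i : Fin N => Polynomial.leval (γ ^ ((i : ℕ) + 1)))

/-- The dual of a folded linear code, for the standard bilinear form on `F^(n*m)`. -/
def dual {n m : ℕ} (C : Submodule F (Fin n → Fin m → F)) : Submodule F (Fin n → Fin m → F) where
  carrier := {z | ∀ x ∈ C, ∑ i, ∑ j, x i j * z i j = 0}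
  zero_mem' := by simp
  add_mem' := by
    intro a b ha hb x hx
    simp [mul_add, Finset.sum_add_distrib, ha x hx, hb x hx]
  smul_mem' := by
    intro r a ha x hx
    have h : ∀ i j, x i j * (r * a i j) = r * (x i j * a i j) := fun i j => by ring
    simp [h, ← Finset.mul_sum, ha x hx]

end Linear

open Classical in
/-- The mass function of the noise distribution on an alphabet: `0` with probability `1/2`, and
otherwise a uniformly random non-zero element. -/
noncomputable def noise {A : Type*} [Zero A] (a : A) : ℝ :=
  if a = 0 then 1 / 2 else 1 / 2 / ((Nat.card A : ℝ) - 1)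

open Classical in
/-- The probability of the event `E` when the `n` symbols of `e` are drawn independently from the
noise distribution. -/
noncomputable def noiseProb {A : Type*} [Fintype A] [Zero A] {n : ℕ}
    (E : (Fin n → A) → Prop) : ℝ :=
  ∑ e : Fin n → A, if E e then ∏ i, noise (e i) else 0

open Classical in
/-- The probability that a uniformly random codeword has Hamming weight `w` (the number of
non-zero symbols). -/
noncomputable def weightProb {A : Type*} [Zero A] {n : ℕ} (C : Set (Fin n → A)) (w : ℕ) : ℝ :=
  ({x ∈ C | hammingNorm x = w}.ncard : ℝ) / (C.ncard : ℝ)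

end Code

/-! ### Folded Reed–Solomon codes -/

/-- The data of a folded Reed–Solomon code `RS^(m)` of full length `n * m = q - 1`: a field with
`q = n * m + 1` elements together with a numbering of its elements, a generator `γ` of its
multiplicative group, and the degree parameter `k`. -/
structure FoldedRS where
  F : Type
  [field : Field F]
  n : ℕ
  m : ℕ
  k : ℕ
  num : F ≃ Fin (n * m + 1)
  γ : Fˣ
  generates : ∀ x : Fˣ, x ∈ Subgroup.zpowers γ
  k_lt : k < n * m

namespace FoldedRS

instance (C : FoldedRS) : Field C.F := C.field

instance (C : FoldedRS) : Fintype C.F := Fintype.ofEquiv _ C.num.symm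

/-- The size of the field. -/
def q (C : FoldedRS) : ℕ := C.n * C.m + 1

/-- The alphabet `F_q^m`. -/
abbrev Alphabet (C : FoldedRS) : Type := Fin C.m → C.F

/-- Words of length `n` over the alphabet. -/
abbrev Word (C : FoldedRS) : Type := Fin C.n → C.Alphabet

/-- The code itself. -/
noncomputable def code (C : FoldedRS) : Submodule C.F C.Word :=
  Code.folded (Code.reedSolomon (C.γ : C.F) (C.n * C.m) C.k)

/-- The field elements of a word, in order, as numbers below `q`. -/
def wordList (C : FoldedRS) (z : C.Word) : List ℕ :=
  List.ofFn fun i => (C.num ((Code.foldEquiv C.F C.n C.m).symm z i) : ℕ)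

/-- The table of a binary operation on the field, row by row, as numbers below `q`. -/
def table (C : FoldedRS) (op : C.F → C.F → C.F) : List ℕ :=
  (List.finRange (C.n * C.m + 1)).flatMap fun a =>
    (List.finRange (C.n * C.m + 1)).map fun b => (C.num (op (C.num.symm a) (C.num.symm b)) : ℕ)

/-- A complete description of the code: its parameters, the generator `γ`, and the addition and
multiplication tables of the field. -/
def description (C : FoldedRS) : List ℕ :=
  [C.q, C.n, C.m, C.k, (C.num (C.γ : C.F) : ℕ)] ++ C.table (· + ·) ++ C.table (· * ·)

/-- A family of codes is explicit if its descriptions are computable from `lam` in time polynomial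
in `lam`. -/
def Explicit (C : ℕ → FoldedRS) : Prop :=
  RAM.PolyTime (fun lam : ℕ => lam) (fun lam => [lam]) fun lam => (C lam).description

/-- A family of maps on words is efficient if one program computes all of them, from `lam` and the
word, in time polynomial in `lam`. -/
def Efficient (C : ℕ → FoldedRS) (D : ∀ lam, (C lam).Word → (C lam).Word) : Prop :=
  RAM.PolyTime (fun i : Σ lam, (C lam).Word => i.1)
    (fun i => i.1 :: (C i.1).wordList i.2) fun i => (C i.1).wordList (D i.1 i.2)

end FoldedRS

/-- `g = Õ(f)`: `g` is `O(f)` up to a factor polylogarithmic in the argument. -/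
def IsSoftO (g f : ℕ → ℝ) : Prop :=
  ∃ K : ℕ, g =O[atTop] fun lam => f lam * Real.log lam ^ K

/-!
The family consists of folded Reed–Solomon codes of constant rate. For the least prime `p` above
`λ + 100` let `q = p ^ 2` and `N = q - 1`, cut into `n = p - 1` blocks of length `m = p + 1`, and
let `k + 1 = N - ⌊N / 20⌋` be the dimension of the code (`FRSFamily.code`). Only the list sizes
depend on the constants `c` and `c'`.

*Computability.* A predicate `RAM.Comp` says that a function is computed by a random access machine
in polynomial time. It is closed under composition, course-of-values recursion (`RAM.Comp.memo`),
bounded sums and bounded search. Since `q` is polynomial in `λ`, a prime, a quadratic non-residue,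
a generator and inverses can be found by exhaustive search; the element `u + v ω` of `F_q = F_p(ω)`
is represented by the number `u + p v`. Vectors that span the solutions of a linear system are
obtained by imposing one equation after the other (`LinearSystem.nullVec`,
`FRSFamily.comp_nullAt`). This gives `FRSFamily.explicit` and `FRSFamily.efficient_decoder`.

*Decoding the dual code.* The words of the dual code are the values of the polynomials without
constant term of degree at most `N / 20` (`Code.exists_eval_of_mem_dual`). Given a received word
`z`, one interpolates `A₀, A₁, A₂` with `A₀(x) + A₁(x) z(x) + A₂(x) z(γ x) = 0`, with `x` and `γ x`
in the same block. A polynomial `g` that agrees with `z` on `9/20` of the blocks then satisfies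
`A₀ + A₁ g + A₂ g(γ X) = 0`, a system of linear equations for the coefficients of `g` whose
solutions form an affine space of dimension at most one (`Received.exists_separating`). All of its
points that come into question are tried, and the decoder is right if `g` is unique
(`Received.decode_eq`). The noise is zero on `9/20` of the blocks with overwhelming probability
(`Code.noiseProb_few_zeros_le`). A non-zero word of the dual code vanishes on at most `1/20` of the
blocks; for another word of the dual code to agree with the received word on `9/20` of the blocks,
the noise has to hit `2/5` of the symbols of a non-zero word of the dual code exactly, and a union
bound over the dual code, of rate `1/20`, shows that this is unlikely
(`FRSFamily.noiseProb_bad_le`).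

*List recovery.* For windows of length `s`, a polynomial `Q(X, Y₀, …, Y_{s-1})` is interpolated
that vanishes to order `s` at all points `(α, y_j, …, y_{j+s-1})`, where `y` is in the input list
of the block of `α` (`Interpolation.exists_relation`). The numbers of monomials of degree below
`51 s / 50` and below `s` in `s + 1` variables have a ratio exponential in `s`
(`Code.pow_mul_card_lowExponents_le`), so that `s = O(λ ^ c)` is enough for input lists of size
`2 ^ (λ ^ c)`, and the degree of `Q` is so small that `Q(X, f(X), f(γ X), …) = 0` for every
codeword `f` that has to be listed. If `β ^ (q - 1) = γ`, then `f(γ ^ j β) = f(β) ^ (q ^ j)`. Once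
common factors of the coefficients of `Q` are removed, `f(β)` is a root of a non-zero polynomial of
degree less than `q ^ s`, and `f(β)` determines `f`. The output list has at most `q ^ s` elements
(`Interpolation.card_solutions_le`), which is `2 ^ O(λ ^ c log λ)`.

*Weights.* The codewords that vanish on `j` given blocks are a fraction of at most `|Σ| ^ (-j)` of
all codewords if `j m ≤ k + 1`, and otherwise only the zero word does; a union bound over the sets
of `j` blocks gives the claim (`Code.weightProb_le`).
-/

/-! ### Functions computable in polynomial time -/

namespace RAM

theorem eval_mono (p : Polynomial ℕ) {a b : ℕ} (h : a ≤ b) : p.eval a ≤ p.eval b := by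
  induction p using Polynomial.induction_on' with
  | add p q hp hq => simpa using add_le_add hp hq
  | monomial n c => simpa using Nat.mul_le_mul_left c (Nat.pow_le_pow_left h n)

/-- The two states have the same registers and arrays with number below `b`. -/
def Agree (b : ℕ) (s s' : State) : Prop :=
  ∀ r < b, s'.reg r = s.reg r ∧ s'.arr r = s.arr r

theorem Agree.trans {b : ℕ} {s s' s'' : State} (h : Agree b s s') (h' : Agree b s' s'') :
    Agree b s s'' := fun r hr => ⟨(h' r hr).1.trans (h r hr).1, (h' r hr).2.trans (h r hr).2⟩

theorem Agree.mono {b b' : ℕ} {s s' : State} (h : Agree b s s') (hb : b' ≤ b) : Agree b' s s' :=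
  fun r hr => h r (hr.trans_le hb)

theorem Agree.setReg {b x : ℕ} (hx : b ≤ x) (s : State) (v : ℕ) : Agree b s (s.setReg x v) := by
  intro r hr
  simp [State.setReg, Function.update_of_ne (show r ≠ x by omega)]

/-- Data that a machine can hold in consecutive *slots*, a slot being a register together with the
array of the same number.  `Holds π x s` says that the state `s` stores `x`, its `j`-th component
being in slot `π j`.  The `size` of `x` bounds all numbers and the lengths of all lists in `x`. -/
class Env (X : Type) where
  width : ℕ
  size : X → ℕ
  Holds : (ℕ → ℕ) → X → State → Prop
  frame : ∀ {π π' : ℕ → ℕ} {x : X} {s s' : State},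
    (∀ j < width, π' j = π j ∧ s'.reg (π j) = s.reg (π j) ∧ s'.arr (π j) = s.arr (π j)) →
      Holds π x s → Holds π' x s'

open Env

instance : Env ℕ where
  width := 1
  size a := a
  Holds π a s := s.reg (π 0) = a
  frame h hs := by rw [(h 0 one_pos).1, (h 0 one_pos).2.1, hs]

/-- A truth value is stored as a number that is non-zero if and only if it is true. -/
instance : Env Prop where
  width := 1
  size _ := 0
  Holds π p s := s.reg (π 0) ≠ 0 ↔ p
  frame h hs := by rw [(h 0 one_pos).1, (h 0 one_pos).2.1, hs]

/-- A list is stored as an array, with its length in the register of the same number. -/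
instance : Env (List ℕ) where
  width := 1
  size l := l.length + l.sum
  Holds π l s := s.reg (π 0) = l.length ∧ ∀ i < l.length, s.arr (π 0) i = l.getD i 0
  frame h hs := by rw [(h 0 one_pos).1, (h 0 one_pos).2.1, (h 0 one_pos).2.2]; exact hs

instance {X Y : Type} [Env X] [Env Y] : Env (X × Y) where
  width := width X + width Y
  size z := size z.1 + size z.2
  Holds π z s := Holds π z.1 s ∧ Holds (fun j => π (width X + j)) z.2 s
  frame h hs := ⟨Env.frame (fun j hj => h j (by omega)) hs.1,
    Env.frame (fun j hj => h (width X + j) (by omega)) hs.2⟩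

theorem Env.Holds.agree {X : Type} [Env X] {π : ℕ → ℕ} {x : X} {s s' : State} {b : ℕ}
    (hs : Holds π x s) (hπ : ∀ j < width X, π j < b) (h : Agree b s s') : Holds π x s' :=
  Env.frame (fun j hj => ⟨rfl, h _ (hπ j hj)⟩) hs

/-- `f` is computed by a machine in time polynomial in the size of the argument, and its values
have polynomial size.  The machine can be made to leave any prescribed initial segment of the slots
untouched. -/
@[fun_prop]
def Comp {X Y : Type} [Env X] [Env Y] (f : X → Y) : Prop :=
  ∃ p : Polynomial ℕ, (∀ x, size (f x) ≤ p.eval (size x)) ∧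
    ∀ (π : ℕ → ℕ) (b : ℕ), (∀ j < width X, π j < b) →
      ∃ (P : Prog) (π' : ℕ → ℕ) (b' : ℕ), b ≤ b' ∧ (∀ j < width Y, π' j < b') ∧
        ∀ x s, Holds π x s → ∃ t s', t ≤ p.eval (size x) ∧ Exec P s t s' ∧ Agree b s s' ∧
          Holds π' (f x) s'

namespace Comp

variable {X Y Z : Type} [Env X] [Env Y] [Env Z]

@[fun_prop]
protected theorem id : Comp (fun x : X => x) := by
  refine ⟨Polynomial.X + 1, fun x => by simp, fun π b hπ => ⟨.const b 0, π, b + 1, by omega,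
    fun j hj => (hπ j hj).trans (by omega), fun x s hs => ⟨1, _, by simp, .const s b 0,
      .setReg le_rfl _ _, ?_⟩⟩⟩
  exact hs.agree hπ (.setReg le_rfl _ _)

@[fun_prop]
theorem comp {g : Y → Z} {f : X → Y} (hg : Comp g) (hf : Comp f) : Comp (fun x => g (f x)) := by
  obtain ⟨p, hp, hf⟩ := hf
  obtain ⟨r, hr, hg⟩ := hg
  refine ⟨p + r.comp p, fun x => ?_, fun π b hπ => ?_⟩
  · have := (hr (f x)).trans (eval_mono r (hp x))
    simp only [Polynomial.eval_add, Polynomial.eval_comp]; omega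
  · obtain ⟨P, π₁, b₁, hb₁, hπ₁, hP⟩ := hf π b hπ
    obtain ⟨Q, π₂, b₂, hb₂, hπ₂, hQ⟩ := hg π₁ b₁ hπ₁
    refine ⟨.seq P Q, π₂, b₂, hb₁.trans hb₂, hπ₂, fun x s hs => ?_⟩
    obtain ⟨t₁, s₁, ht₁, he₁, ha₁, hs₁⟩ := hP x s hs
    obtain ⟨t₂, s₂, ht₂, he₂, ha₂, hs₂⟩ := hQ _ _ hs₁
    refine ⟨_, _, ?_, .seq he₁ he₂, ha₁.trans (ha₂.mono hb₁), hs₂⟩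
    have := ht₂.trans (eval_mono r (hp x))
    simp only [Polynomial.eval_add, Polynomial.eval_comp]; omega

@[fun_prop]
theorem fst {f : X → Y × Z} (hf : Comp f) : Comp (fun x => (f x).1) := by
  obtain ⟨p, hp, hf⟩ := hf
  refine ⟨p, fun x => le_trans (by simp [size]) (hp x), fun π b hπ => ?_⟩
  obtain ⟨P, π₁, b₁, hb₁, hπ₁, hP⟩ := hf π b hπ
  refine ⟨P, π₁, b₁, hb₁, fun j hj => hπ₁ j (by simp only [width]; omega), fun x s hs => ?_⟩
  obtain ⟨t₁, s₁, ht₁, he₁, ha₁, hs₁⟩ := hP x s hs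
  exact ⟨t₁, s₁, ht₁, he₁, ha₁, hs₁.1⟩

@[fun_prop]
theorem snd {f : X → Y × Z} (hf : Comp f) : Comp (fun x => (f x).2) := by
  obtain ⟨p, hp, hf⟩ := hf
  refine ⟨p, fun x => le_trans (by simp [size]) (hp x), fun π b hπ => ?_⟩
  obtain ⟨P, π₁, b₁, hb₁, hπ₁, hP⟩ := hf π b hπ
  refine ⟨P, fun j => π₁ (width Y + j), b₁, hb₁,
    fun j hj => hπ₁ _ (by simp only [width]; omega), fun x s hs => ?_⟩
  obtain ⟨t₁, s₁, ht₁, he₁, ha₁, hs₁⟩ := hP x s hs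
  exact ⟨t₁, s₁, ht₁, he₁, ha₁, hs₁.2⟩

@[fun_prop]
theorem pair {f : X → Y} {g : X → Z} (hf : Comp f) (hg : Comp g) :
    Comp (fun x => (f x, g x)) := by
  obtain ⟨p, hp, hf⟩ := hf
  obtain ⟨r, hr, hg⟩ := hg
  refine ⟨p + r, fun x => ?_, fun π b hπ => ?_⟩
  · simpa [size] using add_le_add (hp x) (hr x)
  · obtain ⟨P, π₁, b₁, hb₁, hπ₁, hP⟩ := hf π b hπ
    obtain ⟨Q, π₂, b₂, hb₂, hπ₂, hQ⟩ := hg π b₁ (fun j hj => (hπ j hj).trans_le hb₁)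
    refine ⟨.seq P Q, fun j => if j < width Y then π₁ j else π₂ (j - width Y), b₂,
      hb₁.trans hb₂, fun j hj => ?_, fun x s hs => ?_⟩
    · simp only [width] at hj
      beta_reduce
      split_ifs with h
      · exact (hπ₁ j h).trans_le hb₂
      · exact hπ₂ _ (by omega)
    obtain ⟨t₁, s₁, ht₁, he₁, ha₁, hs₁⟩ := hP x s hs
    obtain ⟨t₂, s₂, ht₂, he₂, ha₂, hs₂⟩ := hQ x s₁ (hs.agree hπ ha₁)
    refine ⟨_, _, by simpa using add_le_add ht₁ ht₂, .seq he₁ he₂, ha₁.trans (ha₂.mono hb₁),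
      ?_, ?_⟩
    · refine Env.frame (fun j hj => ?_) (hs₁.agree hπ₁ ha₂)
      simp [hj]
    · refine Env.frame (fun j hj => ?_) hs₂
      simp

@[fun_prop]
theorem const (c : ℕ) : Comp (fun _ : X => c) := by
  refine ⟨(c + 1 : ℕ), fun x => by simp [size], fun π b hπ => ⟨.const b c, fun _ => b, b + 1,
    by omega, fun j hj => by simp, fun x s hs => ⟨1, _, by simp, .const s b c,
      .setReg le_rfl _ _, by simp [Holds, State.setReg]⟩⟩⟩

/-- Running a few more instructions that write their result into a fresh register. -/
theorem ofInstr {f : X → Y} (hf : Comp f) (g : Y → ℕ) (r : Polynomial ℕ)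
    (hr : ∀ y, g y ≤ r.eval (size y))
    (I : (ℕ → ℕ) → ℕ → Prog)
    (hI : ∀ π b, (∀ j < width Y, π j < b) → ∀ y s, Holds π y s →
      ∃ t ≤ 3, ∃ s', Exec (I π b) s t s' ∧ Agree b s s' ∧ s'.reg b = g y) :
    Comp (fun x => g (f x)) := by
  refine Comp.comp (g := g) ⟨r + 3, fun x => (hr x).trans (by simp), fun π b hπ => ?_⟩ hf
  refine ⟨I π b, fun _ => b, b + 1, by omega, fun _ _ => by simp, fun x s hs => ?_⟩
  obtain ⟨t, ht, s', he, ha, h⟩ := hI π b hπ x s hs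
  exact ⟨t, s', by simp; omega, he, ha, h⟩

@[fun_prop]
theorem add {f g : X → ℕ} (hf : Comp f) (hg : Comp g) : Comp (fun x => f x + g x) :=
  ofInstr (hf.pair hg) (fun y => y.1 + y.2) Polynomial.X (fun y => by simp [size])
    (fun π b => .add b (π 0) (π 1)) fun π b hπ y s hs =>
      ⟨1, by omega, _, .add _ _ _ _, .setReg le_rfl _ _, by
        have h1 : s.reg (π 0) = y.1 := hs.1
        have h2 : s.reg (π 1) = y.2 := hs.2
        simp [State.setReg, h1, h2]⟩

@[fun_prop]
theorem sub {f g : X → ℕ} (hf : Comp f) (hg : Comp g) : Comp (fun x => f x - g x) :=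
  ofInstr (hf.pair hg) (fun y => y.1 - y.2) Polynomial.X (fun y => by simp [size]; omega)
    (fun π b => .sub b (π 0) (π 1)) fun π b hπ y s hs =>
      ⟨1, by omega, _, .sub _ _ _ _, .setReg le_rfl _ _, by
        have h1 : s.reg (π 0) = y.1 := hs.1
        have h2 : s.reg (π 1) = y.2 := hs.2
        simp [State.setReg, h1, h2]⟩

@[fun_prop]
theorem length {f : X → List ℕ} (hf : Comp f) : Comp (fun x => (f x).length) := by
  obtain ⟨p, hp, hf⟩ := hf
  refine ⟨p, fun x => le_trans (by simp [size]) (hp x), fun π b hπ => ?_⟩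
  obtain ⟨P, π₁, b₁, hb₁, hπ₁, hP⟩ := hf π b hπ
  refine ⟨P, π₁, b₁, hb₁, hπ₁, fun x s hs => ?_⟩
  obtain ⟨t₁, s₁, ht₁, he₁, ha₁, hs₁⟩ := hP x s hs
  exact ⟨t₁, s₁, ht₁, he₁, ha₁, hs₁.1⟩

@[fun_prop]
theorem getD {f : X → List ℕ} {g : X → ℕ} (hf : Comp f) (hg : Comp g) :
    Comp (fun x => (f x).getD (g x) 0) := by
  refine ofInstr (hf.pair hg) (fun y => y.1.getD y.2 0) Polynomial.X (fun y => ?_)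
    -- the difference of the length and the index tells whether the index is in range
    (fun π b => .seq (.sub b (π 0) (π 1)) (.ite b (.load b (π 0) (π 1)) (.const b 0)))
    fun π b hπ y s hs => ?_
  · rcases lt_or_ge y.2 y.1.length with h | h
    · rw [List.getD_eq_getElem _ _ h]
      have := List.le_sum_of_mem (List.getElem_mem h)
      simp [size]; omega
    · rw [List.getD_eq_default _ _ h]; simp
  · have h1 : s.reg (π 0) = y.1.length ∧ ∀ i < y.1.length, s.arr (π 0) i = y.1.getD i 0 := hs.1
    have h2 : s.reg (π 1) = y.2 := hs.2
    have hb : π 1 < b := hπ 1 (by simp [width])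
    have e : (s.setReg b (s.reg (π 0) - s.reg (π 1))).reg b = y.1.length - y.2 := by
      simp [State.setReg, h1.1, h2]
    have ha : Agree b s (s.setReg b (s.reg (π 0) - s.reg (π 1))) := .setReg le_rfl _ _
    rcases lt_or_ge y.2 y.1.length with h | h
    · refine ⟨_, ?_, _, .seq (.sub _ _ _ _) (.ite_true (by rw [e]; omega) (.load _ _ _ _)),
        ha.trans (.setReg le_rfl _ _), ?_⟩
      · norm_num
      · simp only [State.setReg, Function.update_self]
        rw [Function.update_of_ne (by omega), h2, h1.2 _ h]
    · refine ⟨_, ?_, _, .seq (.sub _ _ _ _) (.ite_false (by rw [e]; omega) (.const _ _ _)),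
        ha.trans (.setReg le_rfl _ _), ?_⟩
      · norm_num
      · simp only [State.setReg, Function.update_self]
        rw [List.getD_eq_default _ _ h]

@[fun_prop]
theorem ne_zero {f : X → ℕ} (hf : Comp f) : Comp (fun x => f x ≠ 0) := by
  obtain ⟨p, hp, hf⟩ := hf
  refine ⟨p, fun x => by simp [size], fun π b hπ => ?_⟩
  obtain ⟨P, π₁, b₁, hb₁, hπ₁, hP⟩ := hf π b hπ
  refine ⟨P, π₁, b₁, hb₁, hπ₁, fun x s hs => ?_⟩
  obtain ⟨t₁, s₁, ht₁, he₁, ha₁, hs₁⟩ := hP x s hs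
  refine ⟨t₁, s₁, ht₁, he₁, ha₁, ?_⟩
  have hs₁' : s₁.reg (π₁ 0) = f x := hs₁
  simp [Holds, hs₁']

@[fun_prop]
theorem ite {c : X → Prop} [DecidablePred c] {f g : X → ℕ} (hc : Comp c) (hf : Comp f)
    (hg : Comp g) : Comp (fun x => if c x then f x else g x) := by
  obtain ⟨pc, hpc, hc⟩ := hc
  obtain ⟨pf, hpf, hf⟩ := hf
  obtain ⟨pg, hpg, hg⟩ := hg
  refine ⟨pc + pf + pg + 3, fun x => ?_, fun π b hπ => ?_⟩
  · have h1 := hpf x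
    have h2 := hpg x
    simp only [Polynomial.eval_add, size] at h1 h2 ⊢
    split_ifs <;> omega
  · obtain ⟨Pc, π₁, b₁, hb₁, hπ₁, hPc⟩ := hc π b hπ
    obtain ⟨Pf, π₂, b₂, hb₂, hπ₂, hPf⟩ := hf π (b₁ + 1) (fun j hj => by have := hπ j hj; omega)
    obtain ⟨Pg, π₃, b₃, hb₃, hπ₃, hPg⟩ := hg π (b₁ + 1) (fun j hj => by have := hπ j hj; omega)
    refine ⟨.seq Pc (.seq (.const b₁ 0) (.ite (π₁ 0) (.seq Pf (.add b₁ b₁ (π₂ 0)))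
      (.seq Pg (.add b₁ b₁ (π₃ 0))))), fun _ => b₁, b₁ + 1, by omega, fun _ _ => by simp,
      fun x s hs => ?_⟩
    obtain ⟨t₁, s₁, ht₁, he₁, ha₁, hs₁⟩ := hPc x s hs
    have hπ10 : π₁ 0 < b₁ := hπ₁ 0 (by simp [width])
    have hs₁' : s₁.reg (π₁ 0) ≠ 0 ↔ c x := hs₁
    have ha' : Agree b₁ s₁ (s₁.setReg b₁ 0) := .setReg le_rfl _ _
    have hs2 : Holds π x (s₁.setReg b₁ 0) :=
      hs.agree hπ (ha₁.trans (ha'.mono hb₁))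
    have hc0 : (s₁.setReg b₁ 0).reg (π₁ 0) ≠ 0 ↔ c x := by rw [(ha' _ hπ10).1, hs₁']
    by_cases h : c x
    · obtain ⟨t₂, s₂, ht₂, he₂, ha₂, hs₂⟩ := hPf x _ hs2
      have hs₂' : s₂.reg (π₂ 0) = f x := hs₂
      refine ⟨_, _, ?_, .seq he₁ (.seq (.const _ _ _) (.ite_true (hc0.2 h)
        (.seq he₂ (.add _ _ _ _)))), ?_, ?_⟩
      · simp only [Polynomial.eval_add, Polynomial.eval_ofNat]; omega
      · exact ha₁.trans (((ha'.trans (ha₂.mono (by omega))).trans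
          (.setReg le_rfl _ _)).mono hb₁)
      · have : s₂.reg b₁ = 0 := by rw [(ha₂ b₁ (by omega)).1]; simp [State.setReg]
        simp [Holds, State.setReg, h, hs₂', this]
    · obtain ⟨t₂, s₂, ht₂, he₂, ha₂, hs₂⟩ := hPg x _ hs2
      have hs₂' : s₂.reg (π₃ 0) = g x := hs₂
      refine ⟨_, _, ?_, .seq he₁ (.seq (.const _ _ _) (.ite_false (not_not.1 (hc0.not.2 h))
        (.seq he₂ (.add _ _ _ _)))), ?_, ?_⟩
      · simp only [Polynomial.eval_add, Polynomial.eval_ofNat]; omega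
      · exact ha₁.trans (((ha'.trans (ha₂.mono (by omega))).trans
          (.setReg le_rfl _ _)).mono hb₁)
      · have : s₂.reg b₁ = 0 := by rw [(ha₂ b₁ (by omega)).1]; simp [State.setReg]
        simp [Holds, State.setReg, h, hs₂', this]

/-- The loop behind `Comp.memo` and `Comp.polyTime`: it appends the entries of a list, one after
the other, to the list in slot `c`, each entry being computed from the entries before it. -/
theorem exists_prog_list {n : X → ℕ} {f : X → ℕ → ℕ} {body : X × List ℕ → ℕ}
    (hn : Comp n) (hbody : Comp body)
    (heq : ∀ x, ∀ j < n x, f x j = body (x, (List.range j).map (f x)))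
    {r : Polynomial ℕ} (hr : ∀ x, ∀ j < n x, f x j ≤ r.eval (size x)) :
    ∃ p : Polynomial ℕ, ∀ (π : ℕ → ℕ) (c b : ℕ), (∀ j < width X, π j < b ∧ π j ≠ c) → c < b →
      ∃ P : Prog, ∀ x s, Holds π x s → ∃ t s', t ≤ p.eval (size x) ∧ Exec P s t s' ∧
        (∀ i < b, i ≠ c → s'.reg i = s.reg i ∧ s'.arr i = s.arr i) ∧
        Holds (fun _ => c) ((List.range (n x)).map (f x)) s' := by
  obtain ⟨pn, hpn, hn⟩ := hn
  obtain ⟨pb, -, hb⟩ := hbody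
  -- the size of `x` together with a list of at most `n x` entries
  let z : Polynomial ℕ := Polynomial.X + pn + pn * r
  refine ⟨pn + 5 + pn * (pb.comp z + 4), fun π c b hπ hc => ?_⟩
  obtain ⟨Pn, π₁, b₁, hb₁, hπ₁, hPn⟩ := hn π b (fun j hj => (hπ j hj).1)
  have hπ₁0 : π₁ 0 < b₁ := hπ₁ 0 (by simp [width])
  obtain ⟨Pb, π₂, b₂, hb₂, hπ₂, hPb⟩ := hb (fun j => if j < width X then π j else c) (b₁ + 2)
    (fun j hj => by
      split_ifs with h
      · have := (hπ j h).1; omega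
      · omega)
  -- one round: append the value of the body to the list, and decrease the counter in slot `b₁`;
  -- slot `b₁ + 1` holds the constant `1`
  let B : Prog :=
    .seq Pb (.seq (.store c c (π₂ 0)) (.seq (.add c c (b₁ + 1)) (.sub b₁ b₁ (b₁ + 1))))
  -- the state after `i` of the `n x` rounds
  let Inv (x : X) (s₀ : State) (i : ℕ) (s : State) : Prop :=
    (∀ k < b, k ≠ c → s.reg k = s₀.reg k ∧ s.arr k = s₀.arr k) ∧ s.reg b₁ = n x - i ∧
      s.reg (b₁ + 1) = 1 ∧ Holds (fun _ => c) ((List.range i).map (f x)) s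
  have round (x : X) (s₀ s : State) (i : ℕ) (hi : i < n x) (h0 : Holds π x s₀)
      (h : Inv x s₀ i s) :
      ∃ t s', t ≤ pb.eval (z.eval (size x)) + 3 ∧ Exec B s t s' ∧ Inv x s₀ (i + 1) s' := by
    obtain ⟨ha, hcnt, hone, hlist⟩ := h
    have hsz : size (x, (List.range i).map (f x)) ≤ z.eval (size x) := by
      have h1 : ((List.range i).map (f x)).sum ≤ i * r.eval (size x) := by
        have := List.sum_le_card_nsmul ((List.range i).map (f x)) (r.eval (size x))
          (by simp only [List.mem_map, List.mem_range]
              rintro _ ⟨a, ha, rfl⟩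
              exact hr x a (ha.trans hi))
        simpa using this
      have h2 : n x ≤ pn.eval (size x) := hpn x
      have h3 : i * r.eval (size x) ≤ pn.eval (size x) * r.eval (size x) :=
        Nat.mul_le_mul_right _ (by omega)
      simp only [size, List.length_map, List.length_range, z, Polynomial.eval_add,
        Polynomial.eval_X, Polynomial.eval_mul] at h2 h3 ⊢
      omega
    have hH : Holds (fun j => if j < width X then π j else c) (x, (List.range i).map (f x)) s := by
      refine ⟨Env.frame (fun j hj => ?_) h0, Env.frame (fun j hj => ?_) hlist⟩
      · simpa [hj] using ha _ (hπ j hj).1 (hπ j hj).2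
      · simp
    obtain ⟨t, s₁, ht, he, ha₁, hv⟩ := hPb _ _ hH
    have hv' : s₁.reg (π₂ 0) = f x i := by rw [heq x i hi]; exact hv
    obtain ⟨hl1, hl2⟩ : s₁.reg c = _ ∧ ∀ k < _, s₁.arr c k = _ :=
      hlist.agree (b := b₁ + 2) (fun _ _ => by omega) ha₁
    simp only [List.length_map, List.length_range] at hl1 hl2
    have hone₁ : s₁.reg (b₁ + 1) = 1 := by rw [(ha₁ _ (by omega)).1, hone]
    have hcnt₁ : s₁.reg b₁ = n x - i := by rw [(ha₁ _ (by omega)).1, hcnt]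
    refine ⟨_, _, ?_, .seq he (.seq (.store _ _ _ _) (.seq (.add _ _ _ _) (.sub _ _ _ _))),
      ?_, ?_, ?_, ?_, ?_⟩
    · have := ht.trans (eval_mono pb hsz); omega
    · intro k hk hkc
      have h1 := ha k hk hkc
      have h2 := ha₁ k (by omega)
      simp only [State.setReg, State.setArr, Function.update_of_ne hkc,
        Function.update_of_ne (show k ≠ b₁ by omega)]
      exact ⟨h2.1.trans h1.1, h2.2.trans h1.2⟩
    · simp only [State.setReg, State.setArr, Function.update_self,
        Function.update_of_ne (show b₁ ≠ c by omega),
        Function.update_of_ne (show b₁ + 1 ≠ c by omega), hone₁, hcnt₁]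
      omega
    · simp only [State.setReg, State.setArr, Function.update_of_ne (show b₁ + 1 ≠ c by omega),
        Function.update_of_ne (show b₁ + 1 ≠ b₁ by omega), hone₁]
    · simp [State.setReg, State.setArr, Function.update_of_ne (show c ≠ b₁ by omega), hl1,
        hone₁]
    · intro k hk
      simp only [List.length_map, List.length_range] at hk
      rw [List.getD_eq_getElem _ _ (by simpa using hk)]
      simp only [State.setReg, State.setArr, Function.update_self, hl1, List.getElem_map,
        List.getElem_range, hv']
      rcases Nat.lt_succ_iff_lt_or_eq.1 hk with h | h
      · rw [Function.update_of_ne h.ne, hl2 k h, List.getD_eq_getElem _ _ (by simpa using h)]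
        simp
      · subst h; simp
  have loop (x : X) (s₀ : State) (h0 : Holds π x s₀) (d : ℕ) : ∀ i s, i + d = n x →
      Inv x s₀ i s → ∃ t s', t ≤ d * (pb.eval (z.eval (size x)) + 4) + 1 ∧
        Exec (.loop b₁ B) s t s' ∧ Inv x s₀ (n x) s' := by
    induction d with
    | zero =>
      intro i s hi h
      have hi' : i = n x := by omega
      subst hi'
      exact ⟨1, s, by omega, .loop_done (by rw [h.2.1]; simp), h⟩
    | succ d ih =>
      intro i s hi h
      obtain ⟨t, s₁, ht, he, h₁⟩ := round x s₀ s i (by omega) h0 h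
      obtain ⟨t', s', ht', he', h'⟩ := ih (i + 1) s₁ (by omega) h₁
      refine ⟨_, s', ?_, .loop_step (by rw [h.2.1]; omega) he he', h'⟩
      rw [Nat.succ_mul]; omega
  refine ⟨.seq Pn (.seq (.const (b₁ + 1) 0) (.seq (.add b₁ (π₁ 0) (b₁ + 1))
    (.seq (.const (b₁ + 1) 1) (.seq (.const c 0) (.loop b₁ B))))), fun x s hs => ?_⟩
  obtain ⟨t₁, s₁, ht₁, he₁, ha₁, hs₁⟩ := hPn x s hs
  have hs₁' : s₁.reg (π₁ 0) = n x := hs₁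
  obtain ⟨t, s', ht, he, h'⟩ := loop x s hs (n x) 0
    (((((s₁.setReg (b₁ + 1) 0).setReg b₁ ((s₁.setReg (b₁ + 1) 0).reg (π₁ 0) +
      (s₁.setReg (b₁ + 1) 0).reg (b₁ + 1))).setReg (b₁ + 1) 1)).setReg c 0) (by simp) (by
      refine ⟨fun k hk hkc => ?_, ?_, ?_, ?_, fun k hk => by simp at hk⟩
      · have := ha₁ k hk
        simpa [State.setReg, Function.update_of_ne hkc,
          Function.update_of_ne (show k ≠ b₁ by omega),
          Function.update_of_ne (show k ≠ b₁ + 1 by omega)] using this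
      · simp [State.setReg, Function.update_of_ne (show b₁ ≠ c by omega),
          Function.update_of_ne (show π₁ 0 ≠ b₁ + 1 by omega), hs₁']
      · simp [State.setReg, Function.update_of_ne (show b₁ + 1 ≠ c by omega)]
      · simp [State.setReg])
  refine ⟨_, s', ?_, .seq he₁ (.seq (.const _ _ _) (.seq (.add _ _ _ _) (.seq (.const _ _ _)
    (.seq (.const _ _ _) he)))), h'.1, h'.2.2.2⟩
  have h2 : n x ≤ pn.eval (size x) := hpn x
  have h3 := Nat.mul_le_mul_right (pb.eval (z.eval (size x)) + 4) h2
  simp only [Polynomial.eval_add, Polynomial.eval_mul, Polynomial.eval_comp,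
    Polynomial.eval_ofNat]
  omega

/-- Course-of-values recursion: a list is computable if each of its entries is computable from the
entries before it, provided that the entries have polynomial size. -/
theorem memo {n : X → ℕ} {f : X → ℕ → ℕ} {body : X × List ℕ → ℕ}
    (hn : Comp n) (hbody : Comp body)
    (heq : ∀ x, ∀ j < n x, f x j = body (x, (List.range j).map (f x)))
    {r : Polynomial ℕ} (hr : ∀ x, ∀ j < n x, f x j ≤ r.eval (size x)) :
    Comp (fun x => (List.range (n x)).map (f x)) := by
  obtain ⟨p, hp⟩ := exists_prog_list hn hbody heq hr
  obtain ⟨pn, hpn, -⟩ := hn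
  refine ⟨p + pn + pn * r, fun x => ?_, fun π b hπ => ?_⟩
  · have h1 : ((List.range (n x)).map (f x)).sum ≤ n x * r.eval (size x) := by
      have := List.sum_le_card_nsmul ((List.range (n x)).map (f x)) (r.eval (size x))
        (by simp only [List.mem_map, List.mem_range]
            rintro _ ⟨a, ha, rfl⟩
            exact hr x a ha)
      simpa using this
    have h2 : n x ≤ pn.eval (size x) := hpn x
    have h3 := Nat.mul_le_mul_right (r.eval (size x)) h2
    simp only [Polynomial.eval_add, Polynomial.eval_mul]
    simp only [size, List.length_map, List.length_range] at h1 h2 h3 ⊢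
    omega
  · obtain ⟨P, hP⟩ := hp π b (b + 1)
      (fun j hj => ⟨by have := hπ j hj; omega, (hπ j hj).ne⟩) (by omega)
    refine ⟨P, fun _ => b, b + 1, by omega, fun _ _ => by simp, fun x s hs => ?_⟩
    obtain ⟨t, s', ht, he, ha, h⟩ := hP x s hs
    exact ⟨t, s', by simp only [Polynomial.eval_add]; omega, he,
      fun i hi => ha i (by omega) (by omega), h⟩

/-- A computable map on lists gives a polynomial-time machine, for any parametrization of inputs
whose size is polynomial in the parameter. -/
theorem polyTime {ι : Type} {h : List ℕ → List ℕ} (hh : Comp h) {sz : ι → ℕ}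
    {inp out : ι → List ℕ} (r : Polynomial ℕ) (hr : ∀ i, size (inp i) ≤ r.eval (sz i))
    (ho : ∀ i, h (inp i) = out i) : PolyTime sz inp out := by
  have hentry : Comp fun z : List ℕ × List ℕ => (h z.1).getD z.2.length 0 :=
    (hh.comp Comp.id.fst).getD Comp.id.snd.length
  have hlen := length hh
  obtain ⟨q, hq, -⟩ := hh
  obtain ⟨p, hp⟩ := exists_prog_list (n := fun l => (h l).length)
    (f := fun l j => (h l).getD j 0) hlen hentry (fun x j _ => by simp)
    (r := q) (fun l j hj => by
      refine le_trans ?_ (hq l)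
      rw [List.getD_eq_getElem _ _ hj]
      have := List.le_sum_of_mem (List.getElem_mem hj)
      simp [size]; omega)
  obtain ⟨P, hP⟩ := hp id 1 2 (fun j hj => by simp [width] at hj; simp [hj]) (by omega)
  refine ⟨P, p.comp r, fun i => ?_⟩
  obtain ⟨t, s', ht, he, -, h1, h2⟩ := hP (inp i) (State.init (inp i)) (by
    refine ⟨by simp [State.init], fun k _ => by simp [State.init]⟩)
  refine ⟨t, s', ?_, he, ?_, fun k hk => ?_⟩
  · rw [Polynomial.eval_comp]; exact ht.trans (eval_mono p (hr i))
  · simpa [ho] using h1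
  · have := h2 k (by simpa [ho] using hk)
    rw [this, List.getD_eq_getElem _ _ (by simpa [ho] using hk)]
    simp [ho, hk]

end Comp

end RAM

/-! ### Arithmetic, bounded quantifiers and recursion -/

namespace RAM
open Env

/-- The least number below `n` with the property `p`, and `n` if there is none. -/
noncomputable def leastBelow (n : ℕ) (p : ℕ → Prop) : ℕ := sInf {i | i = n ∨ p i}

theorem leastBelow_le (n : ℕ) (p : ℕ → Prop) : leastBelow n p ≤ n := Nat.sInf_le (Or.inl rfl)

theorem leastBelow_le_of {n i : ℕ} {p : ℕ → Prop} (h : p i) : leastBelow n p ≤ i :=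
  Nat.sInf_le (Or.inr h)

theorem leastBelow_spec {n : ℕ} {p : ℕ → Prop} (h : ∃ i < n, p i) :
    leastBelow n p < n ∧ p (leastBelow n p) := by
  obtain ⟨i, hi, hp⟩ := h
  have h1 : leastBelow n p < n := (leastBelow_le_of hp).trans_lt hi
  have h2 : leastBelow n p = n ∨ p (leastBelow n p) :=
    Nat.sInf_mem (s := {i | i = n ∨ p i}) ⟨n, Or.inl rfl⟩
  exact ⟨h1, h2.resolve_left h1.ne⟩

theorem leastBelow_eq_of_not {n : ℕ} {p : ℕ → Prop} (h : ∀ i < n, ¬ p i) : leastBelow n p = n := by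
  refine le_antisymm (leastBelow_le n p) (not_lt.1 fun h1 => ?_)
  have h2 : leastBelow n p = n ∨ p (leastBelow n p) :=
    Nat.sInf_mem (s := {i | i = n ∨ p i}) ⟨n, Or.inl rfl⟩
  exact h _ h1 (h2.resolve_left h1.ne)

theorem leastBelow_eq_sum (n : ℕ) (p : ℕ → Prop) [DecidablePred p] : leastBelow n p =
    ∑ i ∈ Finset.range n, if ∀ j < i + 1, ¬ p j then 1 else 0 := by
  have : (Finset.range n).filter (fun i => ∀ j < i + 1, ¬ p j) = Finset.range (leastBelow n p) := by
    ext i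
    simp only [Finset.mem_filter, Finset.mem_range]
    refine ⟨fun ⟨hi, h⟩ => ?_, fun h => ⟨h.trans_le (leastBelow_le n p), fun j hj hp => ?_⟩⟩
    · have h2 : leastBelow n p = n ∨ p (leastBelow n p) :=
        Nat.sInf_mem (s := {i | i = n ∨ p i}) ⟨n, Or.inl rfl⟩
      rcases h2 with h2 | h2
      · omega
      · exact not_le.1 fun h' => h _ (by omega) h2
    · have := leastBelow_le_of (n := n) hp; omega
  rw [← Finset.sum_filter, this]; simp

theorem leastBelow_congr {n : ℕ} {p q : ℕ → Prop} (h : ∀ i < n, (p i ↔ q i)) :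
    leastBelow n p = leastBelow n q := by
  by_cases hp : ∃ i < n, p i
  · have hq : ∃ i < n, q i := hp.imp fun i hi => ⟨hi.1, (h i hi.1).1 hi.2⟩
    have h1 := leastBelow_spec hp
    have h2 := leastBelow_spec hq
    exact le_antisymm (leastBelow_le_of ((h _ h2.1).2 h2.2)) (leastBelow_le_of ((h _ h1.1).1 h1.2))
  · push Not at hp
    rw [leastBelow_eq_of_not hp, leastBelow_eq_of_not fun i hi => (h i hi).not.1 (hp i hi)]

namespace Comp

variable {X Y Z : Type} [Env X] [Env Y] [Env Z]

theorem exists_bound {f : X → ℕ} (hf : Comp f) :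
    ∃ p : Polynomial ℕ, ∀ x, f x ≤ p.eval (size x) := by
  obtain ⟨p, hp, -⟩ := hf
  exact ⟨p, hp⟩

theorem congr {f g : X → Y} (hg : Comp g) (h : ∀ x, f x = g x) : Comp f := by
  rwa [show f = g from funext h]

theorem pred_congr {f g : X → Prop} (hg : Comp g) (h : ∀ x, f x ↔ g x) : Comp f :=
  congr hg fun x => propext (h x)

@[fun_prop]
theorem not {p : X → Prop} (hp : Comp p) : Comp (fun x => ¬ p x) := by
  classical
  exact pred_congr (ne_zero (ite hp (const 0) (const 1))) fun x => by by_cases h : p x <;> simp [h]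

@[fun_prop]
theorem and {p q : X → Prop} (hp : Comp p) (hq : Comp q) : Comp (fun x => p x ∧ q x) := by
  classical
  exact pred_congr (ne_zero (ite hp (ite hq (const 1) (const 0)) (const 0))) fun x => by
    by_cases h : p x <;> by_cases h' : q x <;> simp [h, h']

@[fun_prop]
theorem or {p q : X → Prop} (hp : Comp p) (hq : Comp q) : Comp (fun x => p x ∨ q x) :=
  pred_congr (not (and (not hp) (not hq))) fun x => by tauto

@[fun_prop]
theorem lt {f g : X → ℕ} (hf : Comp f) (hg : Comp g) : Comp (fun x => f x < g x) :=
  pred_congr (ne_zero (sub hg hf)) fun x => by omega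

@[fun_prop]
theorem le {f g : X → ℕ} (hf : Comp f) (hg : Comp g) : Comp (fun x => f x ≤ g x) :=
  pred_congr (not (lt hg hf)) fun x => by omega

@[fun_prop]
theorem eq {f g : X → ℕ} (hf : Comp f) (hg : Comp g) : Comp (fun x => f x = g x) :=
  pred_congr (and (le hf hg) (le hg hf)) fun x => by omega

/-- Primitive recursion, provided that all intermediate values have polynomial size. -/
theorem iterate {n init : X → ℕ} {g : X → ℕ → ℕ} {step : X × ℕ × ℕ → ℕ}
    (hn : Comp n) (hinit : Comp init) (hstep : Comp step)
    (h0 : ∀ x, g x 0 = init x) (hs : ∀ x, ∀ j < n x, g x (j + 1) = step (x, j, g x j))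
    {r : Polynomial ℕ} (hr : ∀ x, ∀ j ≤ n x, g x j ≤ r.eval (size x)) :
    Comp (fun x => g x (n x)) := by
  have hm : Comp (fun x => (List.range (n x + 1)).map (g x)) := by
    refine memo (body := fun z => if z.2.length ≠ 0 then
      step (z.1, z.2.length - 1, z.2.getD (z.2.length - 1) 0) else init z.1)
      (by fun_prop) (by fun_prop) (fun x j hj => ?_) (fun x j hj => hr x j (by omega))
    cases j with
    | zero => simp [h0]
    | succ j => simp [hs x j (by omega)]
  exact congr (getD hm hn) fun x => by simp

@[fun_prop]
theorem sum {n : X → ℕ} {f : X → ℕ → ℕ} (hn : Comp n) (hf : Comp fun z : X × ℕ => f z.1 z.2) :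
    Comp (fun x => ∑ i ∈ Finset.range (n x), f x i) := by
  obtain ⟨p, hp⟩ := exists_bound hf
  obtain ⟨pn, hpn⟩ := exists_bound hn
  refine iterate (g := fun x j => ∑ i ∈ Finset.range j, f x i) (init := fun _ => 0)
    (step := fun z => z.2.2 + f z.1 z.2.1) (r := pn * p.comp (Polynomial.X + pn)) hn (by fun_prop)
    (by fun_prop)
    (fun x => by simp) (fun x j _ => Finset.sum_range_succ _ _) fun x j hj => ?_
  calc ∑ i ∈ Finset.range j, f x i ≤ ∑ i ∈ Finset.range j, p.eval (size x + pn.eval (size x)) :=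
        Finset.sum_le_sum fun i hi => (hp (x, i)).trans (eval_mono p (by
          have := hpn x
          have := Finset.mem_range.1 hi
          simp only [size]; omega))
    _ ≤ _ := by
      simp only [Finset.sum_const, Finset.card_range, smul_eq_mul, Polynomial.eval_mul,
        Polynomial.eval_comp, Polynomial.eval_add, Polynomial.eval_X]
      exact Nat.mul_le_mul_right _ (hj.trans (hpn x))

@[fun_prop]
theorem mul {f g : X → ℕ} (hf : Comp f) (hg : Comp g) : Comp (fun x => f x * g x) :=
  congr (sum (f := fun x _ => g x) hf (by fun_prop)) fun x => by simp

@[fun_prop]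
theorem ball {n : X → ℕ} {p : X → ℕ → Prop} (hn : Comp n)
    (hp : Comp fun z : X × ℕ => p z.1 z.2) : Comp (fun x => ∀ i < n x, p x i) := by
  classical
  exact pred_congr (eq (sum (f := fun x i => if p x i then 0 else 1) hn (by fun_prop)) (const 0))
    fun x => by simp

@[fun_prop]
protected theorem leastBelow {n : X → ℕ} {p : X → ℕ → Prop} (hn : Comp n)
    (hp : Comp fun z : X × ℕ => p z.1 z.2) : Comp (fun x => RAM.leastBelow (n x) (p x)) := by
  classical
  refine congr (sum (f := fun x i => if ∀ j < i + 1, ¬ p x j then 1 else 0) hn ?_)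
    fun x => leastBelow_eq_sum _ _
  exact ite (ball (p := fun (z : X × ℕ) j => ¬ p z.1 j) (by fun_prop) (by fun_prop)) (const 1)
    (const 0)

@[fun_prop]
theorem div {f g : X → ℕ} (hf : Comp f) (hg : Comp g) : Comp (fun x => f x / g x) := by
  refine congr (ite (eq hg (const 0)) (const 0)
    (sum (f := fun x i => if (i + 1) * g x ≤ f x then 1 else 0) hf (by fun_prop))) fun x => ?_
  split_ifs with h
  · simp [h]
  · have : (Finset.range (f x)).filter (fun i => (i + 1) * g x ≤ f x) =
        Finset.range (f x / g x) := by
      ext i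
      have h1 := Nat.le_div_iff_mul_le (x := i + 1) (y := f x) (Nat.pos_of_ne_zero h)
      have h2 := Nat.div_le_self (f x) (g x)
      simp only [Finset.mem_filter, Finset.mem_range]
      omega
    rw [← Finset.sum_filter, this]; simp

@[fun_prop]
theorem mod {f g : X → ℕ} (hf : Comp f) (hg : Comp g) : Comp (fun x => f x % g x) :=
  congr (sub hf (mul hg (div hf hg))) fun _ => Nat.mod_eq_sub_mul_div ..

/-- The list of the first `n x` values of a computable function. -/
theorem map_range {n : X → ℕ} {f : X → ℕ → ℕ} (hn : Comp n)
    (hf : Comp fun z : X × ℕ => f z.1 z.2) : Comp (fun x => (List.range (n x)).map (f x)) := by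
  obtain ⟨p, hp⟩ := exists_bound hf
  obtain ⟨pn, hpn⟩ := exists_bound hn
  refine memo (body := fun z => f z.1 z.2.length) (r := p.comp (Polynomial.X + pn)) hn
    (by fun_prop) (fun _ j _ => by simp) (fun x j hj => ?_)
  simp only [Polynomial.eval_comp, Polynomial.eval_add, Polynomial.eval_X]
  refine (hp (x, j)).trans (eval_mono p ?_)
  have := hpn x
  simp only [size]; omega

end Comp
end RAM

/-! ### The field with `p ^ 2` elements -/

open RAM RAM.Env

namespace FRSFamily

/-- The characteristic `p`: the least prime number above `lam + 100`.  The summand `100` makes the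
inequalities between the parameters of the code hold for all `lam`. -/
noncomputable def chr (lam : ℕ) : ℕ :=
  leastBelow (2 * (lam + 100) + 1) fun p => lam + 100 < p ∧ p.Prime

theorem chr_spec (lam : ℕ) :
    chr lam < 2 * (lam + 100) + 1 ∧ lam + 100 < chr lam ∧ (chr lam).Prime :=
  leastBelow_spec (p := fun p => lam + 100 < p ∧ p.Prime) (by
    obtain ⟨p, hp, h1, h2⟩ := Nat.exists_prime_lt_and_le_two_mul (lam + 100) (by omega)
    exact ⟨p, by omega, h1, hp⟩)

instance (lam : ℕ) : Fact (chr lam).Prime := ⟨(chr_spec lam).2.2⟩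

theorem prime_iff_bounded (p : ℕ) : p.Prime ↔ 2 ≤ p ∧ ∀ i < p, ∀ j < p, ¬ i * j = p := by
  rw [Nat.prime_def_lt]
  refine and_congr_right fun h2 => ⟨fun h i hi j hj hij => ?_, fun h m hm ⟨j, hj⟩ => ?_⟩
  · have := h i hi ⟨j, hij.symm⟩
    subst this; omega
  · by_contra hm1
    have hm0 : m ≠ 0 := by rintro rfl; omega
    refine h m hm j ?_ hj.symm
    by_contra hjp
    have : 2 * p ≤ m * j := Nat.mul_le_mul (by omega) (by omega)
    omega

@[fun_prop]
theorem comp_chr : Comp chr := by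
  refine Comp.leastBelow (by fun_prop) (Comp.pred_congr (g := fun z : ℕ × ℕ =>
    z.1 + 100 < z.2 ∧ 2 ≤ z.2 ∧ ∀ i < z.2, ∀ j < z.2, ¬ i * j = z.2) ?_ fun z => by
      rw [prime_iff_bounded])
  have h : Comp fun z : ℕ × ℕ => ∀ i < z.2, ∀ j < z.2, ¬ i * j = z.2 := by fun_prop
  fun_prop

/-- The least quadratic non-residue modulo the characteristic. -/
noncomputable def nonres (lam : ℕ) : ℕ :=
  leastBelow (chr lam) fun a => ∀ r < chr lam, ¬ r * r % chr lam = a % chr lam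

@[fun_prop]
theorem comp_nonres : Comp nonres := by
  unfold nonres
  fun_prop

theorem nonres_spec (lam : ℕ) (r : ZMod (chr lam)) : r ^ 2 ≠ (nonres lam : ZMod (chr lam)) := by
  have h := leastBelow_spec (n := chr lam)
    (p := fun a => ∀ r < chr lam, ¬ r * r % chr lam = a % chr lam) (by
      obtain ⟨a, ha⟩ := FiniteField.exists_nonsquare (F := ZMod (chr lam)) (by
        rw [ZMod.ringChar_zmod_n]
        have := (chr_spec lam).2.1
        omega)
      refine ⟨a.val, ZMod.val_lt a, fun r _ hr => ha ⟨r, ?_⟩⟩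
      have := (ZMod.natCast_eq_natCast_iff' _ _ _).2 hr
      simpa using this.symm)
  intro hr
  refine h.2 r.val (ZMod.val_lt r) ?_
  change _ = nonres lam % chr lam
  refine (ZMod.natCast_eq_natCast_iff' _ _ _).1 ?_
  simpa [pow_two] using hr

/-- The field with `(chr lam) ^ 2` elements, obtained by adjoining a square root. -/
abbrev Fld (lam : ℕ) : Type := QuadraticAlgebra (ZMod (chr lam)) (nonres lam) 0

instance (lam : ℕ) : Fact (∀ r : ZMod (chr lam), r ^ 2 ≠ (nonres lam : ZMod (chr lam)) + 0 * r) :=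
  ⟨fun r => by simpa using nonres_spec lam r⟩

noncomputable instance (lam : ℕ) : Field (Fld lam) := inferInstance

/-- The number of the field element `u + v ω` is `u + (chr lam) v`. -/
noncomputable def val {lam : ℕ} (x : Fld lam) : ℕ := x.re.val + chr lam * x.im.val

/-- The field element with a given number. -/
noncomputable def elt (lam : ℕ) (a : ℕ) : Fld lam := ⟨(a % chr lam : ℕ), (a / chr lam : ℕ)⟩

theorem chr_pos (lam : ℕ) : 0 < chr lam := (chr_spec lam).2.2.pos

theorem val_lt {lam : ℕ} (x : Fld lam) : val x < chr lam * chr lam := by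
  have h1 := ZMod.val_lt x.re
  have h2 := Nat.mul_le_mul_left (chr lam) (Nat.succ_le_of_lt (ZMod.val_lt x.im))
  rw [Nat.mul_succ] at h2
  unfold val; omega

theorem val_mod {lam : ℕ} (x : Fld lam) : val x % chr lam = x.re.val := by
  simp [val, Nat.mod_eq_of_lt (ZMod.val_lt x.re)]

theorem val_div {lam : ℕ} (x : Fld lam) : val x / chr lam = x.im.val := by
  rw [val, Nat.add_mul_div_left _ _ (chr_pos lam), Nat.div_eq_of_lt (ZMod.val_lt x.re), zero_add]

@[simp]
theorem elt_val {lam : ℕ} (x : Fld lam) : elt lam (val x) = x := by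
  ext <;> simp [elt, val_mod, val_div]

theorem val_elt {lam a : ℕ} (h : a < chr lam * chr lam) : val (elt lam a) = a := by
  have h1 : a % chr lam < chr lam := Nat.mod_lt _ (chr_pos lam)
  have h2 : a / chr lam < chr lam := Nat.div_lt_of_lt_mul h
  simp only [val, elt, ZMod.val_natCast_of_lt h1, ZMod.val_natCast_of_lt h2]
  exact Nat.mod_add_div a _

theorem val_injective (lam : ℕ) : Function.Injective (val (lam := lam)) :=
  Function.LeftInverse.injective elt_val

@[simp]
theorem val_zero (lam : ℕ) : val (0 : Fld lam) = 0 := by simp [val]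

@[simp]
theorem val_one (lam : ℕ) : val (1 : Fld lam) = 1 := by
  have := (chr_spec lam).2.2.one_lt
  have : Fact (1 < chr lam) := ⟨this⟩
  simp [val, QuadraticAlgebra.re_one, QuadraticAlgebra.im_one, ZMod.val_one]

theorem val_eq_zero {lam : ℕ} {x : Fld lam} : val x = 0 ↔ x = 0 := by
  rw [← val_zero lam, (val_injective lam).eq_iff]

@[simp]
theorem elt_zero (lam : ℕ) : elt lam 0 = 0 := by rw [← val_zero lam, elt_val]

/-! The field operations on numbers of field elements. -/

noncomputable def addN (lam a b : ℕ) : ℕ := val (elt lam a + elt lam b)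
noncomputable def mulN (lam a b : ℕ) : ℕ := val (elt lam a * elt lam b)
noncomputable def subN (lam a b : ℕ) : ℕ := val (elt lam a - elt lam b)
noncomputable def invN (lam a : ℕ) : ℕ := val (elt lam a)⁻¹
noncomputable def powN (lam a n : ℕ) : ℕ := val (elt lam a ^ n)
noncomputable def sumN (lam n : ℕ) (f : ℕ → ℕ) : ℕ := val (∑ i ∈ Finset.range n, elt lam (f i))

section

variable {lam : ℕ}

theorem val_add (x y : Fld lam) : val (x + y) = addN lam (val x) (val y) := by simp [addN]
theorem val_mul (x y : Fld lam) : val (x * y) = mulN lam (val x) (val y) := by simp [mulN]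
theorem val_sub (x y : Fld lam) : val (x - y) = subN lam (val x) (val y) := by simp [subN]
theorem val_inv (x : Fld lam) : val x⁻¹ = invN lam (val x) := by simp [invN]
theorem val_pow (x : Fld lam) (n : ℕ) : val (x ^ n) = powN lam (val x) n := by simp [powN]
theorem val_sum (n : ℕ) (f : ℕ → Fld lam) :
    val (∑ i ∈ Finset.range n, f i) = sumN lam n fun i => val (f i) := by simp [sumN]

theorem val_ite (c : Prop) [Decidable c] (x y : Fld lam) :
    val (if c then x else y) = if c then val x else val y := apply_ite val ..

end

variable {X : Type} [Env X] {l f g n : X → ℕ}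

@[fun_prop]
theorem comp_val_elt (hl : Comp l) (hf : Comp f) : Comp fun x => val (elt (l x) (f x)) := by
  refine Comp.congr (g := fun x => f x % chr (l x) + chr (l x) * (f x / chr (l x) % chr (l x)))
    (by fun_prop) fun x => ?_
  simp [val, elt, ZMod.val_natCast]

@[fun_prop]
theorem comp_addN (hl : Comp l) (hf : Comp f) (hg : Comp g) :
    Comp fun x => addN (l x) (f x) (g x) := by
  refine Comp.congr (g := fun x => (f x + g x) % chr (l x) +
    chr (l x) * ((f x / chr (l x) + g x / chr (l x)) % chr (l x))) (by fun_prop) fun x => ?_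
  simp [addN, val, elt, ZMod.val_add, ZMod.val_natCast]

@[fun_prop]
theorem comp_mulN (hl : Comp l) (hf : Comp f) (hg : Comp g) :
    Comp fun x => mulN (l x) (f x) (g x) := by
  refine Comp.congr (g := fun x =>
    (f x * g x + nonres (l x) * (f x / chr (l x)) * (g x / chr (l x))) % chr (l x) +
    chr (l x) * ((f x * (g x / chr (l x)) + f x / chr (l x) * g x) % chr (l x)))
    (by fun_prop) fun x => ?_
  simp [mulN, val, elt, ZMod.val_add, ZMod.val_mul, ZMod.val_natCast]

@[fun_prop]
theorem comp_subN (hl : Comp l) (hf : Comp f) (hg : Comp g) :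
    Comp fun x => subN (l x) (f x) (g x) := by
  -- `-y` is `(p - 1) y` in characteristic `p`
  refine Comp.congr (g := fun x => addN (l x) (f x) (mulN (l x) (chr (l x) - 1) (g x)))
    (by fun_prop) fun x => ?_
  have h : elt (l x) (chr (l x) - 1) = -1 := by
    have := chr_pos (l x)
    ext
    · simp [elt, QuadraticAlgebra.re_one, Nat.cast_sub (Nat.succ_le_of_lt this)]
    · simp [elt, QuadraticAlgebra.im_one, Nat.div_eq_of_lt (Nat.sub_lt this one_pos)]
  simp [addN, mulN, subN, h, sub_eq_add_neg]

@[fun_prop]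
theorem comp_invN (hl : Comp l) (hf : Comp f) : Comp fun x => invN (l x) (f x) := by
  refine Comp.congr (g := fun x => if val (elt (l x) (f x)) = 0 then 0 else
    leastBelow (chr (l x) * chr (l x)) fun a => mulN (l x) (f x) a = 1) ?_ fun x => ?_
  · have : Comp fun x => leastBelow (chr (l x) * chr (l x)) fun a => mulN (l x) (f x) a = 1 := by
      fun_prop
    fun_prop
  · split_ifs with h
    · rw [val_eq_zero] at h
      simp [invN, h]
    · rw [val_eq_zero] at h
      have := leastBelow_spec (n := chr (l x) * chr (l x))
        (p := fun a => mulN (l x) (f x) a = 1) ⟨_, val_lt (elt (l x) (f x))⁻¹, by simp [mulN, h]⟩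
      have h1 : elt (l x) (f x) * elt (l x) (leastBelow _ _) = 1 :=
        val_injective _ (this.2.trans (val_one _).symm)
      rw [invN, inv_eq_of_mul_eq_one_right h1, val_elt this.1]

theorem exists_bound_val (hl : Comp l) :
    ∃ p : Polynomial ℕ, ∀ x (y : Fld (l x)), val y ≤ p.eval (size x) := by
  obtain ⟨p, hp⟩ := Comp.exists_bound (Comp.mul (comp_chr.comp hl) (comp_chr.comp hl))
  exact ⟨p, fun x y => (val_lt y).le.trans (hp x)⟩

@[fun_prop]
theorem comp_powN (hl : Comp l) (hf : Comp f) (hn : Comp n) :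
    Comp fun x => powN (l x) (f x) (n x) := by
  obtain ⟨p, hp⟩ := exists_bound_val hl
  exact Comp.iterate (g := fun x j => powN (l x) (f x) j) (init := fun _ => 1)
    (step := fun z => mulN (l z.1) z.2.2 (f z.1)) hn (by fun_prop) (by fun_prop)
    (fun x => by simp [powN]) (fun x j _ => by simp [powN, mulN, pow_succ])
    (fun x j _ => hp x _)

@[fun_prop]
theorem comp_sumN {f : X → ℕ → ℕ} (hl : Comp l) (hn : Comp n)
    (hf : Comp fun z : X × ℕ => f z.1 z.2) : Comp fun x => sumN (l x) (n x) (f x) := by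
  obtain ⟨p, hp⟩ := exists_bound_val hl
  exact Comp.iterate (g := fun x j => sumN (l x) j (f x)) (init := fun _ => 0)
    (step := fun z => addN (l z.1) z.2.2 (f z.1 z.2.1)) hn (by fun_prop) (by fun_prop)
    (fun x => by simp [sumN]) (fun x j _ => by simp [sumN, addN, Finset.sum_range_succ])
    (fun x j _ => hp x _)

/-! ### The codes and their descriptions -/

/-- The number of the generator of the multiplicative group used in the code: the first non-zero
element of which no power with a positive exponent below `p ^ 2 - 1` is `1`. -/
noncomputable def gen (lam : ℕ) : ℕ :=
  leastBelow (chr lam * chr lam) fun a =>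
    ¬ a = 0 ∧ ∀ i < chr lam * chr lam - 1, 0 < i → ¬ powN lam a i = 1

@[fun_prop]
theorem comp_gen : Comp gen := by
  refine Comp.leastBelow (by fun_prop) (Comp.pred_congr (g := fun z : ℕ × ℕ =>
    ¬ z.2 = 0 ∧ ∀ i < chr z.1 * chr z.1 - 1, (¬ 0 < i ∨ ¬ powN z.1 z.2 i = 1)) ?_ fun z => by
      simp only [imp_iff_not_or])
  have : Comp fun z : ℕ × ℕ => ∀ i < chr z.1 * chr z.1 - 1,
    (¬ 0 < i ∨ ¬ powN z.1 z.2 i = 1) := by fun_prop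
  fun_prop

noncomputable instance (lam : ℕ) : Fintype (Fld lam) :=
  Fintype.ofEquiv _ (QuadraticAlgebra.equivProd _ _).symm

theorem card_fld (lam : ℕ) : Fintype.card (Fld lam) = chr lam * chr lam := by
  rw [Fintype.ofEquiv_card, Fintype.card_prod, ZMod.card]

theorem gen_spec (lam : ℕ) : ∃ u : (Fld lam)ˣ, (u : Fld lam) = elt lam (gen lam) ∧
    ∀ x : (Fld lam)ˣ, x ∈ Subgroup.zpowers u := by
  have hcard : Fintype.card (Fld lam)ˣ = chr lam * chr lam - 1 := by
    rw [Fintype.card_units, card_fld]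
  have h := leastBelow_spec (n := chr lam * chr lam)
    (p := fun a => ¬ a = 0 ∧ ∀ i < chr lam * chr lam - 1, 0 < i → ¬ powN lam a i = 1) (by
      obtain ⟨u, hu⟩ := IsCyclic.exists_generator (α := (Fld lam)ˣ)
      refine ⟨val (u : Fld lam), val_lt _, fun h => u.ne_zero (val_eq_zero.1 h),
        fun i hi hi0 h => ?_⟩
      rw [powN, elt_val, ← val_one lam, (val_injective _).eq_iff] at h
      have h1 : u ^ i = 1 := Units.ext (by simpa using h)
      have h2 := orderOf_le_of_pow_eq_one hi0 h1
      rw [orderOf_eq_card_of_forall_mem_zpowers hu, Nat.card_eq_fintype_card, hcard] at h2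
      omega)
  change gen lam < _ ∧ ¬ gen lam = 0 ∧ ∀ i < _, 0 < i → ¬ powN lam (gen lam) i = 1 at h
  obtain ⟨h1, h2, h3⟩ := h
  have h0 : elt lam (gen lam) ≠ 0 := fun h => by
    rw [← val_eq_zero, val_elt h1] at h
    exact h2 h
  refine ⟨Units.mk0 _ h0, rfl, fun x => ?_⟩
  have h4 : orderOf (Units.mk0 _ h0) = chr lam * chr lam - 1 := by
    rw [← hcard]
    refine le_antisymm orderOf_le_card_univ (not_lt.1 fun hlt => ?_)
    rw [hcard] at hlt
    refine h3 _ hlt (orderOf_pos _) ?_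
    have := congrArg Units.val (pow_orderOf_eq_one (Units.mk0 _ h0))
    simp only [Units.val_pow_eq_pow_val, Units.val_mk0, Units.val_one] at this
    rw [powN, this, val_one]
  have h5 : Subgroup.zpowers (Units.mk0 _ h0) = ⊤ := by
    rw [← Subgroup.card_eq_iff_eq_top, Nat.card_zpowers, h4, ← hcard, Nat.card_eq_fintype_card]
  rw [h5]; trivial

/-- The generator of the multiplicative group used in the code. -/
noncomputable def genUnit (lam : ℕ) : (Fld lam)ˣ := (gen_spec lam).choose

theorem genUnit_coe (lam : ℕ) : (genUnit lam : Fld lam) = elt lam (gen lam) :=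
  (gen_spec lam).choose_spec.1

theorem mem_zpowers_genUnit (lam : ℕ) (x : (Fld lam)ˣ) : x ∈ Subgroup.zpowers (genUnit lam) :=
  (gen_spec lam).choose_spec.2 x

theorem fieldSize_eq (lam : ℕ) : (chr lam - 1) * (chr lam + 1) + 1 = chr lam * chr lam := by
  obtain ⟨p, hp⟩ := Nat.exists_eq_succ_of_ne_zero (chr_pos lam).ne'
  rw [hp, Nat.succ_sub_one]; simp only [Nat.succ_eq_add_one]; ring

/-- The folded Reed–Solomon codes over the field with `p ^ 2` elements, with `p - 1` blocks of
length `p + 1`, and of rate slightly above `19 / 20`. -/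
noncomputable def code (lam : ℕ) : FoldedRS where
  F := Fld lam
  n := chr lam - 1
  m := chr lam + 1
  k := (chr lam - 1) * (chr lam + 1) - 1 - (chr lam - 1) * (chr lam + 1) / 20
  num :=
    { toFun := fun x => ⟨val x, (val_lt x).trans_eq (fieldSize_eq lam).symm⟩
      invFun := fun a => elt lam a
      left_inv := elt_val
      right_inv := fun a => Fin.ext (val_elt (a.2.trans_eq (fieldSize_eq lam))) }
  γ := genUnit lam
  generates := mem_zpowers_genUnit lam
  k_lt := by
    have : 0 < (chr lam - 1) * (chr lam + 1) :=
      Nat.mul_pos (by have := (chr_spec lam).2.1; omega) (by omega)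
    omega

theorem flatMap_finRange (a b : ℕ) (f : ℕ → ℕ → ℕ) :
    ((List.finRange a).flatMap fun i : Fin a => (List.finRange b).map fun j : Fin b => f i j) =
      (List.range (a * b)).map fun i => f (i / b) (i % b) := by
  have h1 (i : ℕ) : ((List.finRange b).map fun j : Fin b => f i j) = (List.range b).map (f i) := by
    rw [← List.map_coe_finRange_eq_range, List.map_map]; rfl
  have h2 : ((List.finRange a).flatMap fun i : Fin a =>
      (List.finRange b).map fun j : Fin b => f i j) =
      (List.range a).flatMap fun i => (List.range b).map (f i) := by
    simp only [h1]
    conv_rhs => rw [← List.map_coe_finRange_eq_range (n := a), List.flatMap_map]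
  rw [h2]
  clear h1 h2
  rcases Nat.eq_zero_or_pos b with rfl | hb
  · simp
  induction a with
  | zero => simp
  | succ a ih =>
    rw [List.range_succ, List.flatMap_append, ih, Nat.succ_mul, List.range_add, List.map_append]
    simp only [List.flatMap_cons, List.flatMap_nil, List.append_nil, List.map_map]
    congr 1
    refine List.map_congr_left fun j hj => ?_
    have hj : j < b := List.mem_range.1 hj
    simp [Nat.add_div hb, Nat.mod_eq_of_lt hj, Nat.div_eq_of_lt hj, Nat.not_le.2 hj,
      Nat.mul_div_cancel _ hb]

theorem table_eq (lam : ℕ) (op : Fld lam → Fld lam → Fld lam) : (code lam).table op =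
    (List.range ((chr lam * chr lam) * (chr lam * chr lam))).map fun i =>
      val (op (elt lam (i / (chr lam * chr lam))) (elt lam (i % (chr lam * chr lam)))) := by
  rw [← fieldSize_eq]
  exact flatMap_finRange _ _ fun a b => val (op (elt lam a) (elt lam b))

theorem comp_append {X : Type} [Env X] {f g : X → List ℕ} (hf : Comp f) (hg : Comp g) :
    Comp fun x => f x ++ g x := by
  refine Comp.congr (Comp.map_range (n := fun x => (f x).length + (g x).length)
    (f := fun x i => if i < (f x).length then (f x).getD i 0
      else (g x).getD (i - (f x).length) 0) (by fun_prop) ?_) fun x => ?_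
  · have h1 : Comp fun z : X × ℕ => (f z.1).getD z.2 0 := by fun_prop
    have h2 : Comp fun z : X × ℕ => (g z.1).getD (z.2 - (f z.1).length) 0 := by fun_prop
    fun_prop
  · refine List.ext_getElem (by simp) fun i h1 h2 => ?_
    simp only [List.getElem_map, List.getElem_range, List.getElem_append]
    split_ifs with h
    · rw [List.getD_eq_getElem _ _ h]
    · rw [List.getD_eq_getElem]

theorem comp_singleton {X : Type} [Env X] {f : X → ℕ} (hf : Comp f) : Comp fun x => [f x] :=
  Comp.congr (Comp.map_range (n := fun _ => 1) (f := fun x _ => f x) (by fun_prop) (by fun_prop))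
    fun x => by simp

theorem description_eq (lam : ℕ) : (code lam).description =
    ([chr lam * chr lam] ++ ([chr lam - 1] ++ ([chr lam + 1] ++ ([(chr lam - 1) * (chr lam + 1) - 1
      - (chr lam - 1) * (chr lam + 1) / 20] ++ [val (elt lam (gen lam))])))) ++
    ((List.range ((chr lam * chr lam) * (chr lam * chr lam))).map fun i =>
      addN lam (i / (chr lam * chr lam)) (i % (chr lam * chr lam))) ++
    ((List.range ((chr lam * chr lam) * (chr lam * chr lam))).map fun i =>
      mulN lam (i / (chr lam * chr lam)) (i % (chr lam * chr lam))) := by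
  rw [← genUnit_coe]
  exact congrArg₂ _ (congrArg₂ _ (congrArg (· :: _) (fieldSize_eq lam)) (table_eq lam _))
    (table_eq lam _)

theorem explicit : FoldedRS.Explicit code := by
  have h : Comp fun l : List ℕ => (code (l.getD 0 0)).description := by
    refine Comp.congr ?_ fun l => description_eq _
    refine comp_append (comp_append (comp_append (comp_singleton ?_) (comp_append
      (comp_singleton ?_) (comp_append (comp_singleton ?_) (comp_append (comp_singleton ?_)
        (comp_singleton ?_))))) (Comp.map_range ?_ ?_)) (Comp.map_range ?_ ?_)
    all_goals fun_prop
  exact h.polyTime (Polynomial.X + 1) (fun lam => by simp [size]; omega) fun lam => by simp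

end FRSFamily

/-! ### Linear systems over a field -/

namespace LinearSystem

variable {F : Type*} [Field F]

/-- The value of the linear form with coefficients `r` at the `j`-th of the vectors `v`. -/
def residue (M : ℕ) (r : ℕ → F) (v : ℕ → ℕ → F) (j : ℕ) : F :=
  ∑ i ∈ Finset.range M, r i * v j i

/-- The index of the first of the `M` vectors `v` at which the linear form `r` does not vanish, and
`M` if there is none. -/
noncomputable def pivot (M : ℕ) (r : ℕ → F) (v : ℕ → ℕ → F) : ℕ :=
  leastBelow M fun j => residue M r v j ≠ 0

/-- Vectors `nullVec M c t j`, `j < M`, that span the space of solutions of the first `t` of the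
linear equations `∑ i < M, c s i * x i = 0`.  They start as the unit vectors; each new equation is
imposed by subtracting from all vectors multiples of one of them, the pivot, that violates it. -/
noncomputable def nullVec (M : ℕ) (c : ℕ → ℕ → F) : ℕ → ℕ → ℕ → F
  | 0 => fun j i => if j = i then 1 else 0
  | t + 1 => fun j i => nullVec M c t j i -
      residue M (c t) (nullVec M c t) j *
        (residue M (c t) (nullVec M c t) (pivot M (c t) (nullVec M c t)))⁻¹ *
          nullVec M c t (pivot M (c t) (nullVec M c t)) i

theorem residue_pivot_ne_zero {M : ℕ} {r : ℕ → F} {v : ℕ → ℕ → F} {j : ℕ} (hj : j < M)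
    (h : residue M r v j ≠ 0) : pivot M r v < M ∧ residue M r v (pivot M r v) ≠ 0 :=
  leastBelow_spec (p := fun j => residue M r v j ≠ 0) ⟨j, hj, h⟩

theorem sum_nullVec_eq_zero (M : ℕ) (c : ℕ → ℕ → F) (t : ℕ) : ∀ j < M, ∀ s < t,
    ∑ i ∈ Finset.range M, c s i * nullVec M c t j i = 0 := by
  induction t with
  | zero => simp
  | succ t ih =>
    intro j hj s hs
    have key (s : ℕ) : ∑ i ∈ Finset.range M, c s i * nullVec M c (t + 1) j i =
        ∑ i ∈ Finset.range M, c s i * nullVec M c t j i -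
          residue M (c t) (nullVec M c t) j *
            (residue M (c t) (nullVec M c t) (pivot M (c t) (nullVec M c t)))⁻¹ *
          ∑ i ∈ Finset.range M, c s i * nullVec M c t (pivot M (c t) (nullVec M c t)) i := by
      rw [Finset.mul_sum, ← Finset.sum_sub_distrib]
      exact Finset.sum_congr rfl fun i _ => by simp only [nullVec]; ring
    rw [key]
    by_cases h0 : residue M (c t) (nullVec M c t) j = 0
    · rcases Nat.lt_succ_iff_lt_or_eq.1 hs with h | rfl
      · simp [h0, ih j hj s h]
      · rw [h0]
        simpa [residue] using h0
    · obtain ⟨h1, h2⟩ := residue_pivot_ne_zero hj h0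
      rcases Nat.lt_succ_iff_lt_or_eq.1 hs with h | rfl
      · simp [ih j hj s h, ih _ h1 s h]
      · change residue M (c s) (nullVec M c s) j - _ * residue M (c s) (nullVec M c s) _ = 0
        rw [mul_assoc, inv_mul_cancel₀ h2, mul_one, sub_self]

/-- The vectors `nullVec M c t j` span the solutions of the first `t` equations, and the
coefficients can be taken to be the coordinates of the solution. -/
theorem eq_sum_nullVec (M : ℕ) (c : ℕ → ℕ → F) (x : ℕ → F) (t : ℕ)
    (hx : ∀ s < t, ∑ i ∈ Finset.range M, c s i * x i = 0) :
    ∀ i < M, x i = ∑ j ∈ Finset.range M, x j * nullVec M c t j i := by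
  induction t with
  | zero => intro i hi; simp [nullVec, hi]
  | succ t ih =>
    have ih := ih fun s hs => hx s (by omega)
    have h0 : ∑ j ∈ Finset.range M, x j * residue M (c t) (nullVec M c t) j = 0 := by
      rw [← hx t (by omega)]
      simp only [residue, Finset.mul_sum]
      rw [Finset.sum_comm]
      refine Finset.sum_congr rfl fun i hi => ?_
      conv_rhs => rw [ih i (Finset.mem_range.1 hi), Finset.mul_sum]
      exact Finset.sum_congr rfl fun j _ => by ring
    intro i hi
    have : ∑ j ∈ Finset.range M, x j * nullVec M c (t + 1) j i =
        ∑ j ∈ Finset.range M, x j * nullVec M c t j i -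
          (∑ j ∈ Finset.range M, x j * residue M (c t) (nullVec M c t) j) *
          ((residue M (c t) (nullVec M c t) (pivot M (c t) (nullVec M c t)))⁻¹ *
            nullVec M c t (pivot M (c t) (nullVec M c t)) i) := by
      rw [Finset.sum_mul, ← Finset.sum_sub_distrib]
      exact Finset.sum_congr rfl fun j _ => by simp only [nullVec]; ring
    rw [this, h0, zero_mul, sub_zero, ← ih i hi]

/-- The entries of the vectors `nullVec M c t j`, continued by zero. -/
noncomputable def nullAt (M : ℕ) (c : ℕ → ℕ → F) (t j i : ℕ) : F :=
  if j < M ∧ i < M then nullVec M c t j i else 0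

end LinearSystem

namespace FRSFamily

open LinearSystem

variable {X : Type} [Env X] {l : X → ℕ}

/-- The body of the recursion that tabulates the vectors `nullVec`: the entry that follows the
entries in the list `L`, if `c` gives the numbers of the coefficients of the equations.  The entry
`nullVec M c t j i` has position `t * (M * M) + j * M + i` in the table. -/
noncomputable def nullStep (lam M : ℕ) (c : ℕ → ℕ → ℕ) (L : List ℕ) : ℕ :=
  if L.length / (M * M) = 0 then if L.length % (M * M) / M = L.length % M then 1 else 0 else
    subN lam (L.getD ((L.length / (M * M) - 1) * (M * M) + L.length % (M * M) / M * M +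
        L.length % M) 0)
      (mulN lam (mulN lam
        (sumN lam M fun i => mulN lam (c (L.length / (M * M) - 1) i)
          (L.getD ((L.length / (M * M) - 1) * (M * M) + L.length % (M * M) / M * M + i) 0))
        (invN lam (sumN lam M fun i => mulN lam (c (L.length / (M * M) - 1) i)
          (L.getD ((L.length / (M * M) - 1) * (M * M) + (leastBelow M fun j =>
            ¬ (sumN lam M fun i => mulN lam (c (L.length / (M * M) - 1) i)
              (L.getD ((L.length / (M * M) - 1) * (M * M) + j * M + i) 0)) = 0) * M + i) 0))))
        (L.getD ((L.length / (M * M) - 1) * (M * M) + (leastBelow M fun j =>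
            ¬ (sumN lam M fun i => mulN lam (c (L.length / (M * M) - 1) i)
              (L.getD ((L.length / (M * M) - 1) * (M * M) + j * M + i) 0)) = 0) * M +
                L.length % M) 0))

theorem comp_nullStep {M : X → ℕ} {c : X → ℕ → ℕ → ℕ} (hl : Comp l) (hM : Comp M)
    (hc : Comp fun z : X × ℕ × ℕ => c z.1 z.2.1 z.2.2) :
    Comp fun z : X × List ℕ => nullStep (l z.1) (M z.1) (c z.1) z.2 := by
  have h0 : Comp fun z : (X × List ℕ) × ℕ => sumN (l z.1.1) (M z.1.1) fun i =>
      mulN (l z.1.1) (c z.1.1 (z.1.2.length / (M z.1.1 * M z.1.1) - 1) i)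
        (z.1.2.getD ((z.1.2.length / (M z.1.1 * M z.1.1) - 1) * (M z.1.1 * M z.1.1) +
          z.2 * M z.1.1 + i) 0) := by fun_prop
  have h1 : Comp fun z : X × List ℕ => leastBelow (M z.1) fun j =>
      ¬ (sumN (l z.1) (M z.1) fun i => mulN (l z.1) (c z.1 (z.2.length / (M z.1 * M z.1) - 1) i)
        (z.2.getD ((z.2.length / (M z.1 * M z.1) - 1) * (M z.1 * M z.1) + j * M z.1 + i) 0)) =
          0 := by
    fun_prop
  unfold nullStep
  fun_prop

theorem flat_index {M s j i : ℕ} (hj : j < M) (hi : i < M) :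
    (s * (M * M) + j * M + i) / (M * M) = s ∧ (s * (M * M) + j * M + i) % (M * M) / M = j ∧
      (s * (M * M) + j * M + i) % M = i := by
  have hM : 0 < M := by omega
  have h1 : j * M + i < M * M := by
    have := Nat.mul_le_mul_right M (Nat.succ_le_of_lt hj)
    rw [Nat.succ_mul] at this; omega
  have h2 : s * (M * M) + j * M + i = j * M + i + M * M * s := by ring
  have h3 : (j * M + i) % M = i := by
    rw [Nat.add_comm, Nat.add_mul_mod_self_right, Nat.mod_eq_of_lt hi]
  have h4 : (j * M + i) / M = j := by
    rw [Nat.add_comm, Nat.add_mul_div_right _ _ hM, Nat.div_eq_of_lt hi, zero_add]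
  refine ⟨?_, ?_, ?_⟩
  · rw [h2, Nat.add_mul_div_left _ _ (by positivity), Nat.div_eq_of_lt h1, zero_add]
  · rw [h2, Nat.add_mul_mod_self_left, Nat.mod_eq_of_lt h1, h4]
  · rw [h2, mul_assoc, Nat.add_mul_mod_self_left, h3]

theorem flat_lt {M s t j i : ℕ} (hj : j < M) (hi : i < M) (hs : s < t) :
    s * (M * M) + j * M + i < t * (M * M) := by
  have h1 := Nat.mul_le_mul_right M (Nat.succ_le_of_lt hj)
  have h2 := Nat.mul_le_mul_right (M * M) (Nat.succ_le_of_lt hs)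
  rw [Nat.succ_mul] at h1 h2
  omega

theorem nullStep_eq {lam M : ℕ} {c : ℕ → ℕ → Fld lam} {τ : ℕ} (hM : 0 < M) :
    nullStep lam M (fun t i => val (c t i)) ((List.range τ).map fun τ =>
      val (nullVec M c (τ / (M * M)) (τ % (M * M) / M) (τ % M))) =
    val (nullVec M c (τ / (M * M)) (τ % (M * M) / M) (τ % M)) := by
  have hi : τ % M < M := Nat.mod_lt _ hM
  have hj : τ % (M * M) / M < M := Nat.div_lt_of_lt_mul (Nat.mod_lt _ (by positivity))
  have hτ : τ / (M * M) * (M * M) ≤ τ := Nat.div_mul_le_self _ _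
  simp only [nullStep, List.length_map, List.length_range]
  generalize τ / (M * M) = t at *
  generalize τ % (M * M) / M = j at *
  generalize τ % M = i at *
  rcases t with - | t
  · simp only [if_true, nullVec]
    split_ifs <;> simp
  have hget (j' i' : ℕ) (hj' : j' < M) (hi' : i' < M) :
      ((List.range τ).map fun τ => val (nullVec M c (τ / (M * M)) (τ % (M * M) / M) (τ % M))).getD
        ((t + 1 - 1) * (M * M) + j' * M + i') 0 = val (nullVec M c t j' i') := by
    have h1 := flat_lt hj' hi' (Nat.lt_succ_self t)
    rw [List.getD_eq_getElem _ _ (by simpa using h1.trans_le hτ)]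
    obtain ⟨h2, h3, h4⟩ := flat_index (s := t) hj' hi'
    simp [h2, h3, h4]
  have hres (j' : ℕ) (hj' : j' < M) : (sumN lam M fun i' => mulN lam (val (c (t + 1 - 1) i'))
      (((List.range τ).map fun τ => val (nullVec M c (τ / (M * M)) (τ % (M * M) / M)
        (τ % M))).getD ((t + 1 - 1) * (M * M) + j' * M + i') 0)) =
      val (residue M (c t) (nullVec M c t) j') := by
    rw [residue, sumN]
    congr 1
    refine Finset.sum_congr rfl fun i' hi' => ?_
    rw [hget j' i' hj' (Finset.mem_range.1 hi'), ← val_mul, elt_val, Nat.add_sub_cancel]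
  rw [if_neg (by omega), hget j i hj hi, hres j hj, leastBelow_congr (q := fun j =>
    residue M (c t) (nullVec M c t) j ≠ 0) fun j' hj' => by rw [hres j' hj', val_eq_zero]]
  change subN lam _ (mulN lam (mulN lam _ (invN lam (sumN lam M fun i' => mulN lam _
    (List.getD _ (_ + pivot M (c t) (nullVec M c t) * M + i') 0)))) (List.getD _ (_ +
    pivot M (c t) (nullVec M c t) * M + i) 0)) = val (nullVec M c t j i - _)
  by_cases h0 : residue M (c t) (nullVec M c t) j = 0
  · simp [h0, mulN, subN]
  · have h1 := (residue_pivot_ne_zero hj h0).1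
    rw [hres _ h1, hget _ _ h1 hi, ← val_inv, ← val_mul, ← val_mul, ← val_sub]

/-- The vectors that span the solutions of a linear system are computable in polynomial time. -/
theorem comp_nullAt {M T : X → ℕ} {c : ∀ x, ℕ → ℕ → Fld (l x)} (hl : Comp l) (hM : Comp M)
    (hT : Comp T) (hc : Comp fun z : X × ℕ × ℕ => val (c z.1 z.2.1 z.2.2)) :
    Comp fun z : X × ℕ × ℕ => val (nullAt (M z.1) (c z.1) (T z.1) z.2.1 z.2.2) := by
  obtain ⟨p, hp⟩ := exists_bound_val hl
  have htab : Comp fun x => (List.range ((T x + 1) * (M x * M x))).map fun τ =>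
      val (nullVec (M x) (c x) (τ / (M x * M x)) (τ % (M x * M x) / M x) (τ % M x)) := by
    refine Comp.memo (by fun_prop) (comp_nullStep (c := fun x t i => val (c x t i)) hl hM hc)
      (fun x j hj => (nullStep_eq (Nat.pos_of_ne_zero fun h => ?_)).symm) (fun x j _ => hp x _)
    simp [h] at hj
  have h1 (tab : X → List ℕ) (h : Comp tab) : Comp fun z : X × ℕ × ℕ =>
      if z.2.1 < M z.1 ∧ z.2.2 < M z.1 then
        (tab z.1).getD (T z.1 * (M z.1 * M z.1) + z.2.1 * M z.1 + z.2.2) 0 else 0 := by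
    fun_prop
  refine (h1 _ htab).congr fun z => ?_
  rw [nullAt, val_ite, val_zero]
  refine if_ctx_congr Iff.rfl (fun h => ?_) fun _ => rfl
  have h2 := flat_lt h.1 h.2 (Nat.lt_succ_self (T z.1))
  rw [List.getD_eq_getElem _ _ (by simpa using h2)]
  obtain ⟨h3, h4, h5⟩ := flat_index (s := T z.1) h.1 h.2
  simp [h3, h4, h5]

end FRSFamily

/-! ### The decoder -/

/-- The data of a decoding problem: a word `z` of `n` blocks of length `m`, whose `t`-th entry
belongs to the point `γ ^ (t + 1)`, the bound `K` on the degree of the polynomials to be found, the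
number `W` of coefficients of the interpolation polynomials, and an enumeration `e` of the field,
of length `q`. -/
structure Received (F : Type) where
  γ : F
  n : ℕ
  m : ℕ
  K : ℕ
  W : ℕ
  q : ℕ
  e : ℕ → F
  z : ℕ → F

namespace Received

open LinearSystem

variable {F : Type} [Field F] (d : Received F)

/-- The interpolation conditions `A₀(x) + A₁(x) z(x) + A₂(x) z(γ x) = 0`, one for each point
`x = γ ^ (t + 1)` that is not the last one of its block.  The unknowns are the coefficients of `A₀`,
`A₁` and `A₂`, in this order. -/
def interpRow (t i : ℕ) : F :=
  if (t + 1) % d.m = 0 then 0 else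
    (if i / d.W = 0 then 1 else if i / d.W = 1 then d.z t else d.z (t + 1)) *
      (d.γ ^ (t + 1)) ^ (i % d.W)

/-- Vectors that span the solutions of the interpolation conditions. -/
noncomputable def interp (j i : ℕ) : F :=
  nullAt (3 * d.W) d.interpRow (d.n * d.m) j i

/-- The number of the first non-zero one of these vectors. -/
noncomputable def interpIndex : ℕ :=
  leastBelow (3 * d.W) fun j => ¬ ∀ i < 3 * d.W, interp d j i = 0

/-- The coefficient of `X ^ i` in the interpolation polynomial `A_r`. -/
noncomputable def coef (r i : ℕ) : F :=
  if i < d.W then d.interp d.interpIndex (r * d.W + i) else 0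

/-- The coefficients of the linear equations `w A₀ + A₁ g + A₂ g(γ X) = 0`, one for each power
`X ^ t`, in the unknowns `w` (with number `0`) and the coefficients `g_i` of `g`, `1 ≤ i ≤ K`;
followed by the equation `w = 0`. -/
noncomputable def rootRow (t i : ℕ) : F :=
  if t < d.W + d.K then
    if i = 0 then d.coef 0 t
    else if i ≤ t then d.coef 1 (t - i) + d.γ ^ i * d.coef 2 (t - i) else 0
  else if i = 0 then 1 else 0

/-- Vectors that span the solutions `(w, g)` of `w A₀ + A₁ g + A₂ g(γ X) = 0`. -/
noncomputable def rootSol (j i : ℕ) : F :=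
  nullAt (d.K + 1) d.rootRow (d.W + d.K) j i

/-- Vectors that span the solutions with `w = 0`. -/
noncomputable def rootDir (j i : ℕ) : F :=
  nullAt (d.K + 1) d.rootRow (d.W + d.K + 1) j i

/-- The number of the first one of these vectors with `w ≠ 0`. -/
noncomputable def rootIndex : ℕ :=
  leastBelow (d.K + 1) fun j => ¬ d.rootSol j 0 = 0

/-- A solution with `w = 1`, if there is one; otherwise `0`. -/
noncomputable def rootBase (i : ℕ) : F :=
  (d.rootSol d.rootIndex 0)⁻¹ * d.rootSol d.rootIndex i

/-- The candidates for `g`: the base solution plus a multiple of one of the directions.  The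
quotient of `κ` by `q` is the number of the direction, the remainder that of the scalar. -/
noncomputable def cand (κ i : ℕ) : F :=
  d.rootBase i + d.e (κ % d.q) * d.rootDir (κ / d.q) i

/-- The values of the candidate with number `κ`. -/
noncomputable def word (κ t : ℕ) : F :=
  ∑ i ∈ Finset.range d.K, d.cand κ (i + 1) * d.γ ^ ((t + 1) * (i + 1))

/-- The word `w` agrees with the received word on block `b`. -/
def AgreesOn (w : ℕ → F) (b : ℕ) : Prop :=
  ∀ j < d.m, w (b * d.m + j) = d.z (b * d.m + j)

open Classical in
/-- The candidate with number `κ` agrees with the received word on `9/20` of the blocks. -/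
def Agrees (κ : ℕ) : Prop :=
  9 * d.n ≤ 20 * ∑ b ∈ Finset.range d.n, if d.AgreesOn (d.word κ) b then 1 else 0

/-- The first candidate that agrees with the received word on `9/20` of the blocks. -/
noncomputable def best : ℕ := leastBelow ((d.K + 1) * d.q) d.Agrees

/-- The decoded word. -/
noncomputable def decode (t : ℕ) : F := d.word d.best t

end Received

namespace FRSFamily

open LinearSystem

/-- The decoding problem for the dual of the code, for a word given by numbers of field elements.
The dual code consists of the values of the polynomials without constant term of degree at most
`N / 20`, where `N = n * m`; three interpolation polynomials with `N / 3 + 1` coefficients each have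
more coefficients than there are interpolation conditions. -/
noncomputable def problem (lam : ℕ) (z : ℕ → ℕ) : Received (Fld lam) where
  γ := elt lam (gen lam)
  n := chr lam - 1
  m := chr lam + 1
  K := (chr lam - 1) * (chr lam + 1) / 20
  W := (chr lam - 1) * (chr lam + 1) / 3 + 1
  q := chr lam * chr lam
  e := elt lam
  z t := elt lam (z t)

variable {X : Type} [Env X] {l : X → ℕ} {z : X → ℕ → ℕ}

/-! The numbers of the field elements that occur in the decoder. -/

noncomputable def interpN (lam : ℕ) (z : ℕ → ℕ) (j i : ℕ) : ℕ := val ((problem lam z).interp j i)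
noncomputable def coefN (lam : ℕ) (z : ℕ → ℕ) (r i : ℕ) : ℕ := val ((problem lam z).coef r i)
noncomputable def rootSolN (lam : ℕ) (z : ℕ → ℕ) (j i : ℕ) : ℕ := val ((problem lam z).rootSol j i)
noncomputable def rootDirN (lam : ℕ) (z : ℕ → ℕ) (j i : ℕ) : ℕ := val ((problem lam z).rootDir j i)
noncomputable def wordN (lam : ℕ) (z : ℕ → ℕ) (j i : ℕ) : ℕ := val ((problem lam z).word j i)

@[fun_prop]
theorem comp_interpN {j i : X → ℕ} (hl : Comp l) (hz : Comp fun w : X × ℕ => z w.1 w.2)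
    (hj : Comp j) (hi : Comp i) : Comp fun x => interpN (l x) (z x) (j x) (i x) := by
  have h0 : Comp fun w : X × ℕ × ℕ =>
      if (w.2.1 + 1) % (chr (l w.1) + 1) = 0 then 0 else mulN (l w.1)
        (if w.2.2 / ((chr (l w.1) - 1) * (chr (l w.1) + 1) / 3 + 1) = 0 then 1
          else if w.2.2 / ((chr (l w.1) - 1) * (chr (l w.1) + 1) / 3 + 1) = 1 then
            val (elt (l w.1) (z w.1 w.2.1))
          else val (elt (l w.1) (z w.1 (w.2.1 + 1))))
        (powN (l w.1) (powN (l w.1) (val (elt (l w.1) (gen (l w.1)))) (w.2.1 + 1))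
          (w.2.2 % ((chr (l w.1) - 1) * (chr (l w.1) + 1) / 3 + 1))) := by
    fun_prop
  have h := comp_nullAt (l := l) (M := fun x => 3 * ((chr (l x) - 1) * (chr (l x) + 1) / 3 + 1))
    (T := fun x => (chr (l x) - 1) * (chr (l x) + 1))
    (c := fun x => (problem (l x) (z x)).interpRow) hl (by fun_prop) (by fun_prop)
    (h0.congr fun w => by
      simp only [Received.interpRow, val_ite, val_mul, val_pow, val_zero, val_one]
      rfl)
  exact h.comp (f := fun x => (x, j x, i x)) (by fun_prop)

@[fun_prop]
theorem comp_coefN {j i : X → ℕ} (hl : Comp l) (hz : Comp fun w : X × ℕ => z w.1 w.2)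
    (hj : Comp j) (hi : Comp i) : Comp fun x => coefN (l x) (z x) (j x) (i x) := by
  have h : Comp fun x => (problem (l x) (z x)).interpIndex := by
    refine Comp.congr (g := fun x => leastBelow (3 * ((chr (l x) - 1) * (chr (l x) + 1) / 3 + 1))
      fun j => ¬ ∀ i < 3 * ((chr (l x) - 1) * (chr (l x) + 1) / 3 + 1),
        interpN (l x) (z x) j i = 0) ?_ fun x => ?_
    · have : Comp fun w : X × ℕ => ∀ i < 3 * ((chr (l w.1) - 1) * (chr (l w.1) + 1) / 3 + 1),
        interpN (l w.1) (z w.1) w.2 i = 0 := by fun_prop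
      fun_prop
    · simp only [interpN, val_eq_zero]; rfl
  have h2 (f : X → ℕ) (hf : Comp f) : Comp fun x =>
      if i x < (chr (l x) - 1) * (chr (l x) + 1) / 3 + 1 then
        interpN (l x) (z x) (f x) (j x * ((chr (l x) - 1) * (chr (l x) + 1) / 3 + 1) + i x)
      else 0 := by fun_prop
  exact (h2 _ h).congr fun x => by rw [coefN, Received.coef, val_ite, val_zero]; rfl

theorem comp_rootRow (hl : Comp l) (hz : Comp fun w : X × ℕ => z w.1 w.2) :
    Comp fun w : X × ℕ × ℕ => val ((problem (l w.1) (z w.1)).rootRow w.2.1 w.2.2) := by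
  have h : Comp fun w : X × ℕ × ℕ =>
      if w.2.1 < (chr (l w.1) - 1) * (chr (l w.1) + 1) / 3 + 1 +
        (chr (l w.1) - 1) * (chr (l w.1) + 1) / 20 then
        if w.2.2 = 0 then coefN (l w.1) (z w.1) 0 w.2.1
        else if w.2.2 ≤ w.2.1 then addN (l w.1) (coefN (l w.1) (z w.1) 1 (w.2.1 - w.2.2))
          (mulN (l w.1) (powN (l w.1) (val (elt (l w.1) (gen (l w.1)))) w.2.2)
            (coefN (l w.1) (z w.1) 2 (w.2.1 - w.2.2))) else 0
      else if w.2.2 = 0 then 1 else 0 := by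
    fun_prop
  refine h.congr fun w => ?_
  simp only [Received.rootRow, val_ite, val_add, val_mul, val_pow, val_zero, val_one]
  rfl

@[fun_prop]
theorem comp_rootSolN {j i : X → ℕ} (hl : Comp l) (hz : Comp fun w : X × ℕ => z w.1 w.2)
    (hj : Comp j) (hi : Comp i) : Comp fun x => rootSolN (l x) (z x) (j x) (i x) := by
  have h := comp_nullAt (l := l) (M := fun x => (chr (l x) - 1) * (chr (l x) + 1) / 20 + 1)
    (T := fun x => (chr (l x) - 1) * (chr (l x) + 1) / 3 + 1 +
      (chr (l x) - 1) * (chr (l x) + 1) / 20)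
    (c := fun x => (problem (l x) (z x)).rootRow) hl (by fun_prop) (by fun_prop)
    (comp_rootRow hl hz)
  exact h.comp (f := fun x => (x, j x, i x)) (by fun_prop)

@[fun_prop]
theorem comp_rootDirN {j i : X → ℕ} (hl : Comp l) (hz : Comp fun w : X × ℕ => z w.1 w.2)
    (hj : Comp j) (hi : Comp i) : Comp fun x => rootDirN (l x) (z x) (j x) (i x) := by
  have h := comp_nullAt (l := l) (M := fun x => (chr (l x) - 1) * (chr (l x) + 1) / 20 + 1)
    (T := fun x => (chr (l x) - 1) * (chr (l x) + 1) / 3 + 1 +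
      (chr (l x) - 1) * (chr (l x) + 1) / 20 + 1)
    (c := fun x => (problem (l x) (z x)).rootRow) hl (by fun_prop) (by fun_prop)
    (comp_rootRow hl hz)
  exact h.comp (f := fun x => (x, j x, i x)) (by fun_prop)

@[fun_prop]
theorem comp_wordN {j i : X → ℕ} (hl : Comp l) (hz : Comp fun w : X × ℕ => z w.1 w.2)
    (hj : Comp j) (hi : Comp i) : Comp fun x => wordN (l x) (z x) (j x) (i x) := by
  have h : Comp fun x => (problem (l x) (z x)).rootIndex := by
    refine Comp.congr (g := fun x => leastBelow ((chr (l x) - 1) * (chr (l x) + 1) / 20 + 1)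
      fun j => ¬ rootSolN (l x) (z x) j 0 = 0) (by fun_prop) fun x => ?_
    simp only [rootSolN, val_eq_zero]; rfl
  have h2 (f : X → ℕ) (hf : Comp f) : Comp fun x =>
      sumN (l x) ((chr (l x) - 1) * (chr (l x) + 1) / 20) fun k => mulN (l x)
        (addN (l x)
          (mulN (l x) (invN (l x) (rootSolN (l x) (z x) (f x) 0))
            (rootSolN (l x) (z x) (f x) (k + 1)))
          (mulN (l x) (val (elt (l x) (j x % (chr (l x) * chr (l x)))))
            (rootDirN (l x) (z x) (j x / (chr (l x) * chr (l x))) (k + 1))))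
        (powN (l x) (val (elt (l x) (gen (l x)))) ((i x + 1) * (k + 1))) := by
    fun_prop
  refine (h2 _ h).congr fun x => ?_
  simp only [wordN, Received.word, Received.cand, Received.rootBase, val_sum, val_add, val_mul,
    val_pow, val_inv]
  rfl

theorem comp_decode (hl : Comp l) (hz : Comp fun w : X × ℕ => z w.1 w.2) :
    Comp fun w : X × ℕ => val ((problem (l w.1) (z w.1)).decode w.2) := by
  classical
  have hag : Comp fun w : X × ℕ => (problem (l w.1) (z w.1)).Agrees w.2 := by
    have h3 : Comp fun w : (X × ℕ) × ℕ => ∀ j < chr (l w.1.1) + 1,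
        wordN (l w.1.1) (z w.1.1) w.1.2 (w.2 * (chr (l w.1.1) + 1) + j) =
          val (elt (l w.1.1) (z w.1.1 (w.2 * (chr (l w.1.1) + 1) + j))) := by
      fun_prop
    have h4 (P : X × ℕ → ℕ → Prop) (hP : Comp fun w : (X × ℕ) × ℕ => P w.1 w.2) :
        Comp fun w : X × ℕ => 9 * (chr (l w.1) - 1) ≤ 20 * ∑ b ∈ Finset.range (chr (l w.1) - 1),
          if P w b then 1 else 0 := by
      fun_prop
    refine h4 (fun w b => (problem (l w.1) (z w.1)).AgreesOn ((problem (l w.1) (z w.1)).word w.2) b)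
      (h3.pred_congr fun w => ?_)
    simp only [wordN, (val_injective _).eq_iff]
    rfl
  have hb (P : X × ℕ → Prop) (hP : Comp P) : Comp fun x =>
      leastBelow (((chr (l x) - 1) * (chr (l x) + 1) / 20 + 1) * (chr (l x) * chr (l x)))
        fun k => P (x, k) := by
    fun_prop
  exact comp_wordN (z := fun w : X × ℕ => z w.1) (i := fun w => w.2)
    (hl.comp Comp.id.fst) (by fun_prop) ((hb _ hag).comp Comp.id.fst) Comp.id.snd

/-- The decoder for the dual of the code: the interpolation decoder for folded Reed–Solomon codes,
with windows of length two. -/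
noncomputable def decoder (lam : ℕ) (z : (code lam).Word) : (code lam).Word :=
  Code.foldEquiv (Fld lam) (chr lam - 1) (chr lam + 1) fun i =>
    (problem lam fun t => ((code lam).wordList z).getD t 0).decode i

theorem efficient_decoder : FoldedRS.Efficient code decoder := by
  have h1 : Comp fun w : List ℕ × ℕ => val ((problem (w.1.getD 0 0) fun t =>
      w.1.getD (t + 1) 0).decode w.2) :=
    comp_decode (X := List ℕ) (l := fun w => w.getD 0 0) (z := fun w t => w.getD (t + 1) 0)
      (by fun_prop) (by fun_prop)
  have h := Comp.map_range (n := fun w : List ℕ => (chr (w.getD 0 0) - 1) * (chr (w.getD 0 0) + 1))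
    (f := fun w t => val ((problem (w.getD 0 0) fun t => w.getD (t + 1) 0).decode t))
    (by fun_prop) h1
  obtain ⟨p, hp⟩ := Comp.exists_bound comp_chr
  refine h.polyTime (1 + Polynomial.X + p * p + p * p * (p * p)) (fun i => ?_) fun i => ?_
  · obtain ⟨lam, w⟩ := i
    have h1 : ((code lam).wordList w).length = (chr lam - 1) * (chr lam + 1) := by
      simp [FoldedRS.wordList, code]
    have h2 : ((code lam).wordList w).sum ≤ ((chr lam - 1) * (chr lam + 1)) *
        (chr lam * chr lam) := by
      rw [← h1, ← smul_eq_mul]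
      refine List.sum_le_card_nsmul _ _ fun a ha => ?_
      obtain ⟨i, rfl⟩ := List.mem_ofFn.1 ha
      exact (val_lt _).le
    have h3 : (chr lam - 1) * (chr lam + 1) ≤ chr lam * chr lam := by
      have := fieldSize_eq lam; omega
    have h4 := Nat.mul_le_mul_right (chr lam * chr lam) h3
    have h5 := Nat.mul_le_mul (hp lam) (hp lam)
    have h6 := Nat.mul_le_mul h5 h5
    simp only [size, List.length_cons, List.sum_cons, h1, Polynomial.eval_add, Polynomial.eval_mul,
      Polynomial.eval_one, Polynomial.eval_X] at h5 h6 ⊢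
    omega
  · obtain ⟨lam, w⟩ := i
    refine List.ext_getElem (by simp [FoldedRS.wordList, code]) fun i h1 h2 => ?_
    simp only [List.getElem_map, List.getElem_range, FoldedRS.wordList, List.getElem_ofFn]
    refine Eq.trans ?_ (congrArg val (congrFun ((Code.foldEquiv (Fld lam) (chr lam - 1)
      (chr lam + 1)).symm_apply_apply _) _)).symm
    rfl

end FRSFamily

/-! ### Correctness of the decoder -/

namespace Received

open LinearSystem Polynomial RAM

variable {F : Type} [Field F] (d : Received F)

/-- The word of values of the polynomial with coefficients `g 1, …, g K`. -/
def eval (g : ℕ → F) (t : ℕ) : F :=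
  ∑ i ∈ Finset.range d.K, g (i + 1) * d.γ ^ ((t + 1) * (i + 1))

open Classical in
/-- The blocks on which a word agrees with the received one. -/
noncomputable def agreement (w : ℕ → F) : Finset ℕ :=
  (Finset.range d.n).filter (d.AgreesOn w)

/-- The properties of the parameters that make the decoder work. -/
structure Valid : Prop where
  inj : ∀ i j, 1 ≤ i → i ≤ d.n * d.m → 1 ≤ j → j ≤ d.n * d.m → d.γ ^ i = d.γ ^ j → i = j
  interp_lt : d.n * d.m < 3 * d.W
  agree_le : ∀ a, 9 * d.n ≤ 20 * a → d.W + d.K ≤ a * (d.m - 1)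
  K_le : d.K ≤ d.n * d.m
  enum : ∀ c, ∃ i < d.q, d.e i = c

variable {d}

/-- A linear system with fewer equations than unknowns has a non-zero solution, so that one of the
vectors computed for it is not zero. -/
theorem exists_nullVec_ne_zero {M T : ℕ} (c : ℕ → ℕ → F) (h : T < M) :
    ∃ j < M, ∃ i < M, nullAt M c T j i ≠ 0 := by
  let f : (Fin M → F) →ₗ[F] (Fin T → F) :=
    Matrix.toLin' (Matrix.of fun (t : Fin T) (i : Fin M) => c t i)
  obtain ⟨x, hx, hx0⟩ := Submodule.exists_mem_ne_zero_of_ne_bot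
    (LinearMap.ker_ne_bot_of_finrank_lt (f := f) (by simpa using h))
  let y : ℕ → F := fun i => if hi : i < M then x ⟨i, hi⟩ else 0
  have hy (i : Fin M) : y i = x i := by simp [y]
  have hsol : ∀ s < T, ∑ i ∈ Finset.range M, c s i * y i = 0 := by
    intro s hs
    have := congrFun (LinearMap.mem_ker.1 hx) ⟨s, hs⟩
    rw [Finset.sum_range]
    simpa [f, Matrix.mulVec, dotProduct, hy] using this
  have hsum := eq_sum_nullVec M c y T hsol
  by_contra! hcon
  refine hx0 (funext fun i => ?_)
  rw [← hy, hsum i i.2]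
  refine Finset.sum_eq_zero fun j hj => ?_
  have h1 := Finset.mem_range.1 hj
  have := hcon j h1 i i.2
  rw [nullAt, if_pos ⟨h1, i.2⟩] at this
  rw [this, mul_zero]

theorem interp_spec (hd : d.Valid) : d.interpIndex < 3 * d.W ∧
    (∃ i < 3 * d.W, d.interp d.interpIndex i ≠ 0) ∧
    ∀ t < d.n * d.m,
      ∑ i ∈ Finset.range (3 * d.W), d.interpRow t i * d.interp d.interpIndex i = 0 := by
  obtain ⟨j, hj, i, hi, hne⟩ := exists_nullVec_ne_zero d.interpRow hd.interp_lt
  obtain ⟨h1, h2⟩ := leastBelow_spec (p := fun j => ¬ ∀ i < 3 * d.W, interp d j i = 0)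
    ⟨j, hj, fun h => hne (h i hi)⟩
  change d.interpIndex < 3 * d.W at h1
  change ¬ ∀ i < 3 * d.W, interp d d.interpIndex i = 0 at h2
  refine ⟨h1, by push Not at h2; exact h2, fun t ht => ?_⟩
  rw [← sum_nullVec_eq_zero (3 * d.W) d.interpRow (d.n * d.m) _ h1 t ht]
  refine Finset.sum_congr rfl fun i hi => ?_
  rw [interp, nullAt, if_pos ⟨h1, Finset.mem_range.1 hi⟩]

theorem sum_range_three_mul (W : ℕ) (f : ℕ → F) : ∑ i ∈ Finset.range (3 * W), f i =
    ∑ i ∈ Finset.range W, f i + ∑ i ∈ Finset.range W, f (W + i) +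
      ∑ i ∈ Finset.range W, f (2 * W + i) := by
  rw [show 3 * W = W + W + W by ring, Finset.sum_range_add, Finset.sum_range_add, ← two_mul]

variable (d) in
/-- The interpolation polynomials. -/
noncomputable def interpPoly (r : ℕ) : F[X] := ∑ i ∈ Finset.range d.W, C (d.coef r i) * X ^ i

theorem coeff_interpPoly (r i : ℕ) : (d.interpPoly r).coeff i = d.coef r i := by
  simp only [interpPoly, finsetSum_coeff, coeff_C_mul_X_pow]
  rw [Finset.sum_ite_eq]
  split_ifs with h
  · rfl
  · rw [coef, if_neg (by simpa using h)]

theorem degree_interpPoly_lt (r : ℕ) : (d.interpPoly r).degree < d.W := by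
  rw [degree_lt_iff_coeff_zero]
  intro i hi
  rw [coeff_interpPoly, coef, if_neg (by omega)]

variable (d) in
/-- The polynomial `g₁ X + … + g_K X ^ K`. -/
noncomputable def messagePoly (g : ℕ → F) : F[X] :=
  ∑ i ∈ Finset.range d.K, C (g (i + 1)) * X ^ (i + 1)

theorem eval_messagePoly (g : ℕ → F) (t : ℕ) :
    (d.messagePoly g).eval (d.γ ^ (t + 1)) = d.eval g t := by
  simp [messagePoly, eval, eval_finsetSum, ← pow_mul]

theorem degree_messagePoly_le (g : ℕ → F) : (d.messagePoly g).degree ≤ d.K := by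
  refine (degree_sum_le _ _).trans (Finset.sup_le fun i hi => ?_)
  refine (degree_C_mul_X_pow_le _ _).trans ?_
  have := Finset.mem_range.1 hi
  exact_mod_cast this

variable (d) in
/-- The polynomial `A₀ + A₁ g + A₂ g(γ X)`. -/
noncomputable def combination (w : F) (g : ℕ → F) : F[X] :=
  C w * d.interpPoly 0 + d.interpPoly 1 * d.messagePoly g +
    d.interpPoly 2 * (d.messagePoly g).comp (C d.γ * X)

theorem coeff_mul_messagePoly (A : F[X]) (g : ℕ → F) (t : ℕ) :
    (A * d.messagePoly g).coeff t =
      ∑ i ∈ Finset.range d.K, if i + 1 ≤ t then A.coeff (t - (i + 1)) * g (i + 1) else 0 := by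
  simp only [messagePoly, Finset.mul_sum, finsetSum_coeff]
  refine Finset.sum_congr rfl fun i _ => ?_
  rw [← mul_assoc, coeff_mul_X_pow']
  simp [coeff_mul_C]

theorem messagePoly_comp (g : ℕ → F) : (d.messagePoly g).comp (C d.γ * X) =
    d.messagePoly fun i => d.γ ^ i * g i := by
  rw [messagePoly, ← coe_compRingHom_apply, map_sum]
  refine Finset.sum_congr rfl fun i _ => ?_
  simp only [coe_compRingHom_apply, mul_comp, C_comp, pow_comp, X_comp, mul_pow, ← C_pow, C_mul]
  ring

theorem coeff_combination (x : ℕ → F) (t : ℕ) (ht : t < d.W + d.K) :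
    (d.combination (x 0) x).coeff t = ∑ i ∈ Finset.range (d.K + 1), d.rootRow t i * x i := by
  rw [Finset.sum_range_succ', combination, messagePoly_comp, coeff_add, coeff_add,
    coeff_mul_messagePoly, coeff_mul_messagePoly, coeff_C_mul, coeff_interpPoly, add_assoc,
    ← Finset.sum_add_distrib, add_comm]
  congr 1
  · refine Finset.sum_congr rfl fun i _ => ?_
    simp only [rootRow, if_pos ht, coeff_interpPoly, Nat.succ_ne_zero, if_false]
    split_ifs <;> ring
  · simp [rootRow, ht, mul_comm]

theorem degree_combination_lt (w : F) (g : ℕ → F) :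
    (d.combination w g).degree < (d.W + d.K : ℕ) := by
  have h1 (A B : F[X]) (hA : A.degree < d.W) (hB : B.degree ≤ d.K) :
      (A * B).degree < (d.W + d.K : ℕ) := by
    rcases eq_or_ne A 0 with rfl | hA0
    · simp [bot_lt_iff_ne_bot]
    rcases eq_or_ne B 0 with rfl | hB0
    · simp [bot_lt_iff_ne_bot]
    rw [degree_mul, degree_eq_natDegree hA0, degree_eq_natDegree hB0] at *
    norm_cast at *
    omega
  refine (degree_add_le _ _).trans_lt (max_lt ((degree_add_le _ _).trans_lt (max_lt ?_ ?_)) ?_)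
  · rw [mul_comm]
    exact h1 _ _ (degree_interpPoly_lt 0) (degree_C_le.trans (by exact_mod_cast Nat.zero_le _))
  · exact h1 _ _ (degree_interpPoly_lt 1) (degree_messagePoly_le _)
  · rw [messagePoly_comp]
    exact h1 _ _ (degree_interpPoly_lt 2) (degree_messagePoly_le _)

theorem eval_interpPoly (hd : d.Valid) {t : ℕ} (ht : t < d.n * d.m) (hm : (t + 1) % d.m ≠ 0) :
    (d.interpPoly 0).eval (d.γ ^ (t + 1)) + (d.interpPoly 1).eval (d.γ ^ (t + 1)) * d.z t +
      (d.interpPoly 2).eval (d.γ ^ (t + 1)) * d.z (t + 1) = 0 := by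
  have h := (interp_spec hd).2.2 t ht
  rw [sum_range_three_mul] at h
  simp only [interpPoly, eval_finsetSum, eval_mul, eval_C, eval_pow, eval_X, Finset.sum_mul]
  rw [← h]
  refine congrArg₂ _ (congrArg₂ _ ?_ ?_) ?_ <;> refine Finset.sum_congr rfl fun i hi => ?_ <;>
    have hi := Finset.mem_range.1 hi <;> have hW : 0 < d.W := by omega
  · simp [coef, interpRow, hm, hi, Nat.div_eq_of_lt hi, Nat.mod_eq_of_lt hi, mul_comm]
  · have h1 : (d.W + i) / d.W = 1 := by
      rw [Nat.add_div_left _ hW, Nat.div_eq_of_lt hi]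
    simp [coef, interpRow, hm, hi, h1, Nat.mod_eq_of_lt hi]
    ring
  · have h1 : (2 * d.W + i) / d.W = 2 := by
      rw [mul_comm, Nat.mul_add_div hW, Nat.div_eq_of_lt hi]
    simp [coef, interpRow, hm, hi, h1, Nat.mod_eq_of_lt hi]
    ring

theorem index_lt {n m b j : ℕ} (hb : b < n) (hj : j < m) : b * m + j < n * m := by
  have := Nat.mul_le_mul_right m (Nat.succ_le_of_lt hb)
  rw [Nat.succ_mul] at this; omega

/-- The interpolation polynomials annihilate every polynomial that agrees with the received word on
sufficiently many blocks. -/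
theorem combination_eq_zero (hd : d.Valid) (g : ℕ → F)
    (hg : 9 * d.n ≤ 20 * (d.agreement (d.eval g)).card) : d.combination 1 g = 0 := by
  classical
  have hlt (p : ℕ × ℕ) (hp : p ∈ d.agreement (d.eval g) ×ˢ Finset.range (d.m - 1)) :
      p.1 < d.n ∧ p.2 + 1 < d.m ∧
        ∀ j < d.m, d.eval g (p.1 * d.m + j) = d.z (p.1 * d.m + j) := by
    simp only [agreement, Finset.mem_product, Finset.mem_filter, Finset.mem_range] at hp
    exact ⟨hp.1.1, by omega, hp.1.2⟩
  let s := (d.agreement (d.eval g) ×ˢ Finset.range (d.m - 1)).image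
    fun p => d.γ ^ (p.1 * d.m + p.2 + 1)
  have hs : s.card = (d.agreement (d.eval g)).card * (d.m - 1) := by
    rw [Finset.card_image_of_injOn, Finset.card_product, Finset.card_range]
    intro p hp p' hp' h
    obtain ⟨h1, h2, -⟩ := hlt p hp
    obtain ⟨h1', h2', -⟩ := hlt p' hp'
    have h3 := index_lt h1 (show p.2 < d.m by omega)
    have h4 := index_lt h1' (show p'.2 < d.m by omega)
    have h5 := hd.inj _ _ (by omega) (by omega) (by omega) (by omega) h
    have h6 : p.1 * d.m + p.2 = p'.1 * d.m + p'.2 := by omega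
    have h7 : p.2 = p'.2 := by
      have := congrArg (· % d.m) h6
      simpa [Nat.mul_add_mod', Nat.mod_eq_of_lt (show p.2 < d.m by omega),
        Nat.mod_eq_of_lt (show p'.2 < d.m by omega)] using this
    refine Prod.ext ?_ h7
    rw [h7] at h6
    exact Nat.eq_of_mul_eq_mul_right (show 0 < d.m by omega) (by omega)
  refine eq_zero_of_degree_lt_of_eval_finset_eq_zero s ?_ fun x hx => ?_
  · rw [hs]
    exact (degree_combination_lt 1 g).trans_le (by exact_mod_cast hd.agree_le _ hg)
  · obtain ⟨p, hp, rfl⟩ := Finset.mem_image.1 hx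
    obtain ⟨h1, h2, h3⟩ := hlt p hp
    have h4 := eval_interpPoly hd (index_lt h1 (show p.2 < d.m by omega)) (by
      rw [add_assoc, Nat.mul_add_mod', Nat.mod_eq_of_lt h2]; omega)
    rw [← h3 p.2 (by omega), add_assoc _ p.2 1, ← h3 _ h2, ← eval_messagePoly,
      ← eval_messagePoly] at h4
    simp only [combination, eval_add, eval_mul, eval_comp, eval_C, eval_X, one_mul]
    rw [← pow_succ']
    exact h4

/-- Some coordinate separates the solutions of the homogeneous equation `A₁ g + A₂ g(γ X) = 0`: if
`μ` is the least exponent that occurs in `A₁` or `A₂`, then the `r`-th coordinate of a solution is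
determined by the previous ones unless `a_{1,μ} + γ ^ r a_{2,μ} = 0`, which happens for one `r` at
most. -/
theorem exists_separating (hd : d.Valid) (hn : ∃ r i, r ≠ 0 ∧ d.coef r i ≠ 0 ∧ r < 3) :
    ∃ r₀, ∀ y : ℕ → F, y 0 = 0 → y r₀ = 0 →
      (∀ t < d.W + d.K, ∑ i ∈ Finset.range (d.K + 1), d.rootRow t i * y i = 0) →
        ∀ i ≤ d.K, y i = 0 := by
  classical
  have hex : ∃ i, d.coef 1 i ≠ 0 ∨ d.coef 2 i ≠ 0 := by
    obtain ⟨r, i, h0, h1, h2⟩ := hn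
    interval_cases r
    · exact absurd rfl h0
    · exact ⟨i, .inl h1⟩
    · exact ⟨i, .inr h1⟩
  set μ := Nat.find hex with hμ
  have hμ1 : d.coef 1 μ ≠ 0 ∨ d.coef 2 μ ≠ 0 := Nat.find_spec hex
  have hμ2 (i : ℕ) (hi : i < μ) : d.coef 1 i = 0 ∧ d.coef 2 i = 0 := by
    simpa using Nat.find_min hex hi
  have hμW : μ < d.W := by
    by_contra h
    simp [coef, h] at hμ1
  have huniq (r r' : ℕ) (h1 : 1 ≤ r) (h2 : r ≤ d.K) (h1' : 1 ≤ r') (h2' : r' ≤ d.K)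
      (h : d.coef 1 μ + d.γ ^ r * d.coef 2 μ = 0) (h' : d.coef 1 μ + d.γ ^ r' * d.coef 2 μ = 0) :
      r = r' := by
    have hK := hd.K_le
    have h3 : (d.γ ^ r - d.γ ^ r') * d.coef 2 μ = 0 := by linear_combination h - h'
    rcases mul_eq_zero.1 h3 with h4 | h4
    · exact hd.inj _ _ h1 (by omega) h1' (by omega) (sub_eq_zero.1 h4)
    · rw [h4, mul_zero, add_zero] at h
      exact (hμ1.elim (· h) (· h4)).elim
  obtain ⟨r₀, hr₀⟩ : ∃ r₀, ∀ r, 1 ≤ r → r ≤ d.K → r ≠ r₀ →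
      d.coef 1 μ + d.γ ^ r * d.coef 2 μ ≠ 0 := by
    by_cases h : ∃ r, 1 ≤ r ∧ r ≤ d.K ∧ d.coef 1 μ + d.γ ^ r * d.coef 2 μ = 0
    · obtain ⟨r, h1, h2, h3⟩ := h
      exact ⟨r, fun r' h1' h2' hne h3' => hne (huniq _ _ h1' h2' h1 h2 h3' h3)⟩
    · push Not at h
      exact ⟨0, fun r h1 h2 _ => h r h1 h2⟩
  refine ⟨r₀, fun y h0 hr hy i => ?_⟩
  induction i using Nat.strong_induction_on with
  | _ i ih =>
    intro hi
    rcases Nat.eq_zero_or_pos i with rfl | hi0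
    · exact h0
    by_cases hir : i = r₀
    · rw [hir, hr]
    have h1 := hy (μ + i) (by omega)
    rw [Finset.sum_eq_single i] at h1
    · have h2 : d.rootRow (μ + i) i = d.coef 1 μ + d.γ ^ i * d.coef 2 μ := by
        rw [rootRow, if_pos (by omega), if_neg (by omega), if_pos (by omega),
          Nat.add_sub_cancel]
      rw [h2] at h1
      exact (mul_eq_zero.1 h1).resolve_left (hr₀ i hi0 hi hir)
    · intro j hj hne
      have hj := Finset.mem_range.1 hj
      rcases lt_or_gt_of_ne hne with h | h
      · rw [ih j h (by omega), mul_zero]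
      · rw [rootRow, if_pos (by omega), if_neg (by omega)]
        split_ifs with h3
        · have := hμ2 (μ + i - j) (by omega)
          simp [this.1, this.2]
        · simp
    · intro h; simp at h; omega

theorem exists_coef_ne_zero (hd : d.Valid) (g : ℕ → F) (hg : d.combination 1 g = 0) :
    ∃ r i, r ≠ 0 ∧ d.coef r i ≠ 0 ∧ r < 3 := by
  by_contra! hcon
  have h12 (r : ℕ) (hr0 : r ≠ 0) (hr : r < 3) : d.interpPoly r = 0 := by
    ext i
    rw [coeff_interpPoly, coeff_zero]
    by_contra h
    exact absurd (hcon r i hr0 h) (by omega)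
  have h0 : d.interpPoly 0 = 0 := by
    simpa [combination, h12 1, h12 2] using hg
  obtain ⟨-, ⟨i, hi, hne⟩, -⟩ := interp_spec hd
  have hW : 0 < d.W := by omega
  have hr : i / d.W < 3 := Nat.div_lt_of_lt_mul (by linarith)
  have h : d.coef (i / d.W) (i % d.W) ≠ 0 := by
    rw [coef, if_pos (Nat.mod_lt _ hW), mul_comm, Nat.div_add_mod]
    exact hne
  rw [← coeff_interpPoly] at h
  rcases Nat.eq_zero_or_pos (i / d.W) with h3 | h3
  · rw [h3, h0] at h; simp at h
  · rw [h12 _ h3.ne' hr] at h; simp at h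

/-- The decoder finds a polynomial that agrees with the received word on `9/20` of the blocks,
provided that all such polynomials have the same values. -/
theorem decode_eq (hd : d.Valid) (g : ℕ → F)
    (hg : 9 * d.n ≤ 20 * (d.agreement (d.eval g)).card)
    (huniq : ∀ g', 9 * d.n ≤ 20 * (d.agreement (d.eval g')).card →
      ∀ t < d.n * d.m, d.eval g' t = d.eval g t) :
    ∀ t < d.n * d.m, d.decode t = d.eval g t := by
  classical
  have hcomb := combination_eq_zero hd g hg
  obtain ⟨r₀, hr₀⟩ := exists_separating hd (exists_coef_ne_zero hd g hcomb)
  -- the solution that is sought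
  let x : ℕ → F := fun i => if i = 0 then 1 else g i
  have hx : ∀ t < d.W + d.K, ∑ i ∈ Finset.range (d.K + 1), d.rootRow t i * x i = 0 := by
    intro t ht
    rw [← coeff_combination x t ht]
    have : d.combination (x 0) x = d.combination 1 g := by simp [combination, messagePoly, x]
    rw [this, hcomb, coeff_zero]
  have hp : d.rootIndex < d.K + 1 ∧ ¬ d.rootSol d.rootIndex 0 = 0 := by
    refine leastBelow_spec (p := fun j => ¬ d.rootSol j 0 = 0) ?_
    by_contra! hcon
    have h := eq_sum_nullVec (d.K + 1) d.rootRow x _ hx 0 (by omega)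
    rw [Finset.sum_eq_zero fun j hj => ?_] at h
    · simp [x] at h
    · have := hcon j (Finset.mem_range.1 hj)
      rw [rootSol, nullAt, if_pos ⟨Finset.mem_range.1 hj, by omega⟩] at this
      rw [this, mul_zero]
  have hbase : ∀ t < d.W + d.K, ∑ i ∈ Finset.range (d.K + 1), d.rootRow t i * d.rootBase i = 0 := by
    intro t ht
    have h := sum_nullVec_eq_zero (d.K + 1) d.rootRow (d.W + d.K) _ hp.1 t ht
    rw [← mul_zero (d.rootSol d.rootIndex 0)⁻¹, ← h, Finset.mul_sum]
    refine Finset.sum_congr rfl fun i hi => ?_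
    have : d.rootSol d.rootIndex i = nullVec (d.K + 1) d.rootRow (d.W + d.K) d.rootIndex i := by
      rw [rootSol, nullAt, if_pos ⟨hp.1, Finset.mem_range.1 hi⟩]
    rw [rootBase, this]
    ring
  have hbase0 : d.rootBase 0 = 1 := inv_mul_cancel₀ hp.2
  have hdir (j : ℕ) (hj : j < d.K + 1) : ∀ t < d.W + d.K + 1,
      ∑ i ∈ Finset.range (d.K + 1), d.rootRow t i * d.rootDir j i = 0 := by
    intro t ht
    rw [← sum_nullVec_eq_zero (d.K + 1) d.rootRow (d.W + d.K + 1) j hj t ht]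
    refine Finset.sum_congr rfl fun i hi => ?_
    rw [rootDir, nullAt, if_pos ⟨hj, Finset.mem_range.1 hi⟩]
  have hlast (y : ℕ → F) : ∑ i ∈ Finset.range (d.K + 1), d.rootRow (d.W + d.K) i * y i = y 0 := by
    rw [Finset.sum_eq_single 0]
    · simp [rootRow]
    · intro i _ hi; simp [rootRow, hi]
    · simp
  -- the difference of the two solutions is a multiple of one of the directions
  let y : ℕ → F := fun i => x i - d.rootBase i
  have hy0 : y 0 = 0 := by simp [y, x, hbase0]
  have hy : ∀ t < d.W + d.K + 1, ∑ i ∈ Finset.range (d.K + 1), d.rootRow t i * y i = 0 := by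
    intro t ht
    rcases Nat.lt_succ_iff_lt_or_eq.1 ht with h | rfl
    · simp only [y, mul_sub, Finset.sum_sub_distrib, hx t h, hbase t h, sub_zero]
    · rw [hlast, hy0]
  obtain ⟨j, hj, c, hc⟩ : ∃ j < d.K + 1, ∃ c, ∀ i ≤ d.K, y i = c * d.rootDir j i := by
    by_cases hex : ∃ j < d.K + 1, ∃ i ≤ d.K, d.rootDir j i ≠ 0
    · obtain ⟨j, hj, i, hi, hne⟩ := hex
      have hj0 : d.rootDir j 0 = 0 := by rw [← hlast (d.rootDir j)]; exact hdir j hj _ (by omega)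
      have hjr : d.rootDir j r₀ ≠ 0 := fun h =>
        hne (hr₀ (d.rootDir j) hj0 h (fun t ht => hdir j hj t (by omega)) i hi)
      refine ⟨j, hj, y r₀ / d.rootDir j r₀, fun i hi => sub_eq_zero.1 (hr₀ (fun i => y i -
        y r₀ / d.rootDir j r₀ * d.rootDir j i) (by simp [hy0, hj0]) (by field_simp; ring)
        (fun t ht => ?_) i hi)⟩
      have h1 := hy t (by omega)
      have h2 := hdir j hj t (by omega)
      simp only [mul_sub, Finset.sum_sub_distrib, h1, zero_sub, neg_eq_zero]
      rw [← mul_zero (y r₀ / d.rootDir j r₀), ← h2, Finset.mul_sum]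
      exact Finset.sum_congr rfl fun i _ => by ring
    · push Not at hex
      refine ⟨0, by omega, 0, fun i hi => ?_⟩
      rw [zero_mul, eq_sum_nullVec (d.K + 1) d.rootRow y _ hy i (by omega)]
      refine Finset.sum_eq_zero fun j hj => ?_
      have := hex j (Finset.mem_range.1 hj) i hi
      rw [rootDir, nullAt, if_pos ⟨Finset.mem_range.1 hj, by omega⟩] at this
      rw [this, mul_zero]
  obtain ⟨a, ha, hac⟩ := hd.enum c
  have hκ : ∀ t, d.word (j * d.q + a) t = d.eval g t := by
    intro t
    refine Finset.sum_congr rfl fun i hi => ?_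
    have h1 := hc (i + 1) (Finset.mem_range.1 hi)
    have h2 : (j * d.q + a) / d.q = j := by
      rw [mul_comm, Nat.mul_add_div (by omega), Nat.div_eq_of_lt ha, add_zero]
    have h3 : (j * d.q + a) % d.q = a := by
      rw [Nat.mul_add_mod', Nat.mod_eq_of_lt ha]
    rw [cand, h2, h3, hac, ← h1]
    simp [y, x]
  have hcount (κ : ℕ) : d.Agrees κ ↔ 9 * d.n ≤ 20 * (d.agreement (d.word κ)).card := by
    simp only [Agrees, agreement, Finset.card_filter]
  have hbest := leastBelow_spec (n := (d.K + 1) * d.q) (p := d.Agrees)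
    ⟨j * d.q + a, index_lt hj ha, by
      rw [hcount, show d.word (j * d.q + a) = d.eval g from funext hκ]; exact hg⟩
  exact huniq (d.cand d.best) ((hcount _).1 hbest.2)

end Received

/-! ### The dual code -/

namespace Code

theorem foldEquiv_apply {F : Type*} [Field F] {n m : ℕ} (v : Fin (n * m) → F) (i : Fin n)
    (j : Fin m) : foldEquiv F n m v i j = v (finProdFinEquiv (i, j)) := rfl

theorem foldEquiv_symm_apply {F : Type*} [Field F] {n m : ℕ} (x : Fin n → Fin m → F) (i : Fin n)
    (j : Fin m) : (foldEquiv F n m).symm x (finProdFinEquiv (i, j)) = x i j := by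
  exact congrFun (congrFun ((foldEquiv F n m).apply_symm_apply x) i) j

section Dual

variable {F : Type*} [Field F] [Fintype F] {γ : Fˣ}

theorem orderOf_generator (hγ : ∀ x : Fˣ, x ∈ Subgroup.zpowers γ) {N : ℕ}
    (hN : Fintype.card F = N + 1) : orderOf γ = N := by
  classical
  rw [orderOf_eq_card_of_forall_mem_zpowers hγ, Nat.card_eq_fintype_card, Fintype.card_units, hN,
    Nat.add_sub_cancel]

theorem pow_injOn (hγ : ∀ x : Fˣ, x ∈ Subgroup.zpowers γ) {N : ℕ}
    (hN : Fintype.card F = N + 1) {i j : ℕ} (hi : 1 ≤ i) (hiN : i ≤ N) (hj : 1 ≤ j) (hjN : j ≤ N)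
    (h : (γ : F) ^ i = (γ : F) ^ j) : i = j := by
  have h1 : γ ^ i = γ ^ j := Units.ext (by simpa using h)
  rw [pow_eq_pow_iff_modEq, orderOf_generator hγ hN] at h1
  have h2 : (i - 1) ≡ (j - 1) [MOD N] := by
    refine Nat.ModEq.add_right_cancel' 1 ?_
    rwa [Nat.sub_add_cancel hi, Nat.sub_add_cancel hj]
  have := Nat.ModEq.eq_of_lt_of_lt h2 (by omega) (by omega)
  omega

/-- The words of the dual code are given by polynomials without constant term, of degree less than
`N - k`: these are the exponents that do not cancel against any exponent up to `k`. -/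
theorem exists_eval_of_mem_dual (hγ : ∀ x : Fˣ, x ∈ Subgroup.zpowers γ) {n m k K : ℕ}
    (hN : Fintype.card F = n * m + 1) (hK : k + 1 + K = n * m) {x : Fin n → Fin m → F}
    (hx : x ∈ dual (folded (reedSolomon (γ : F) (n * m) k))) :
    ∃ g : ℕ → F, ∀ t : Fin (n * m), (foldEquiv F n m).symm x t =
      ∑ i ∈ Finset.range K, g (i + 1) * (γ : F) ^ (((t : ℕ) + 1) * (i + 1)) := by
  set N := n * m with hNdef
  set v := (foldEquiv F n m).symm x with hv
  have horth (d : ℕ) (hd : d ≤ k) : ∑ t : Fin N, (γ : F) ^ (((t : ℕ) + 1) * d) * v t = 0 := by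
    have h1 : foldEquiv F n m (fun t => (γ : F) ^ (((t : ℕ) + 1) * d)) ∈
        folded (reedSolomon (γ : F) (n * m) k) := by
      refine Submodule.mem_map_of_mem (Submodule.mem_map.2 ⟨Polynomial.X ^ d, ?_, ?_⟩)
      · rw [Polynomial.mem_degreeLE]
        exact (Polynomial.degree_X_pow_le d).trans (by exact_mod_cast hd)
      · ext t
        simp [Polynomial.leval, ← pow_mul]
    rw [← hx _ h1, ← Fintype.sum_prod_type']
    refine (Fintype.sum_equiv finProdFinEquiv _ _ fun p => ?_).symm
    rw [foldEquiv_apply, hv, foldEquiv_symm_apply]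
  have hpow : (γ : F) ^ N = 1 := by
    have := pow_orderOf_eq_one γ
    rw [orderOf_generator hγ hN] at this
    simpa using congrArg Units.val this
  have hcast : (N : F) = -1 := by
    have := FiniteField.cast_card_eq_zero F
    rw [hN] at this
    push_cast at this
    exact eq_neg_of_add_eq_zero_left this
  let g : ℕ → F := fun e => -∑ t : Fin N, v t * (γ : F) ^ (((t : ℕ) + 1) * (N - e))
  have hg0 (e : ℕ) (he : N - e ≤ k) : g e = 0 := by
    have := horth _ he
    simp only [g, neg_eq_zero]
    rw [← this]
    exact Finset.sum_congr rfl fun t _ => mul_comm _ _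
  refine ⟨g, fun s => ?_⟩
  have hsplit : ∑ i ∈ Finset.range K, g (i + 1) * (γ : F) ^ (((s : ℕ) + 1) * (i + 1)) =
      ∑ i ∈ Finset.range N, g (i + 1) * (γ : F) ^ (((s : ℕ) + 1) * (i + 1)) := by
    refine Finset.sum_subset (Finset.range_subset_range.2 (by omega)) fun i hi hi' => ?_
    rw [hg0, zero_mul]
    simp only [Finset.mem_range] at hi hi'
    omega
  -- orthogonality of the characters of the cyclic group of order `N`
  have hgeom (t : Fin N) : ∑ i ∈ Finset.range N, (γ : F) ^ (((t : ℕ) + 1) * (N - (i + 1))) *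
      (γ : F) ^ (((s : ℕ) + 1) * (i + 1)) = if t = s then -1 else 0 := by
    set a := (γ : F) ^ ((t : ℕ) + 1) with ha
    set b := (γ : F) ^ ((s : ℕ) + 1) with hb
    have h1 : ∑ i ∈ Finset.range N, (γ : F) ^ (((t : ℕ) + 1) * (N - (i + 1))) *
        (γ : F) ^ (((s : ℕ) + 1) * (i + 1)) =
        b * ∑ i ∈ Finset.range N, b ^ i * a ^ (N - 1 - i) := by
      rw [Finset.mul_sum]
      refine Finset.sum_congr rfl fun i _ => ?_
      rw [pow_mul, pow_mul, ← ha, ← hb, pow_succ, show N - (i + 1) = N - 1 - i by omega]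
      ring
    have haN : a ^ N = 1 := by rw [ha, ← pow_mul, mul_comm, pow_mul, hpow, one_pow]
    have hbN : b ^ N = 1 := by rw [hb, ← pow_mul, mul_comm, pow_mul, hpow, one_pow]
    rw [h1]
    split_ifs with hts
    · have hab : a = b := by rw [ha, hb, hts]
      have hpos : 0 < N := by have := s.2; omega
      have h2 : ∑ i ∈ Finset.range N, b ^ i * a ^ (N - 1 - i) = N * b ^ (N - 1) := by
        rw [Finset.sum_congr rfl fun i hi => show b ^ i * a ^ (N - 1 - i) = b ^ (N - 1) by
          rw [hab, ← pow_add]; congr 1; have := Finset.mem_range.1 hi; omega]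
        simp
      rw [h2, mul_left_comm, ← pow_succ', Nat.sub_add_cancel hpos, hbN, hcast, mul_one]
    · have hab : b - a ≠ 0 := by
        rw [sub_ne_zero]
        intro h
        have := pow_injOn hγ hN (i := (s : ℕ) + 1) (j := (t : ℕ) + 1) (by omega)
          (by have := s.2; omega) (by omega) (by have := t.2; omega) h
        exact hts (Fin.ext (by omega))
      have h2 := (Commute.all b a).geom_sum₂_mul N
      rw [haN, hbN, sub_self] at h2
      rw [(mul_eq_zero.1 h2).resolve_right hab, mul_zero]
  rw [hsplit]
  simp only [g, neg_mul, Finset.sum_mul, Finset.sum_neg_distrib]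
  rw [Finset.sum_comm]
  have : ∀ t : Fin N, ∑ i ∈ Finset.range N, v t * (γ : F) ^ (((t : ℕ) + 1) * (N - (i + 1))) *
      (γ : F) ^ (((s : ℕ) + 1) * (i + 1)) = if t = s then -v t else 0 := by
    intro t
    simp only [mul_assoc, ← Finset.mul_sum, hgeom]
    split_ifs <;> simp
  rw [Finset.sum_congr rfl fun t _ => this t]
  simp

end Dual

/-! ### The noise distribution -/

section Noise

variable {A : Type*} [Fintype A] [Zero A] {n : ℕ}

theorem noise_nonneg [Nontrivial A] (a : A) : 0 ≤ noise a := by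
  have : (1 : ℝ) < Nat.card A := by exact_mod_cast Finite.one_lt_card
  unfold noise
  split_ifs
  · norm_num
  · exact div_nonneg (by norm_num) (by linarith)

open Classical in
theorem sum_noise [Nontrivial A] : ∑ a : A, noise a = 1 := by
  have h1 : (1 : ℝ) < Nat.card A := by exact_mod_cast Finite.one_lt_card
  have h2 : ∑ a ∈ Finset.univ.erase (0 : A), noise a = 1 / 2 := by
    rw [Finset.sum_congr rfl fun a ha => show noise a = 1 / 2 / ((Nat.card A : ℝ) - 1) by
      rw [noise, if_neg (Finset.ne_of_mem_erase ha)]]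
    rw [Finset.sum_const, Finset.card_erase_of_mem (Finset.mem_univ _), Finset.card_univ,
      nsmul_eq_mul, ← Nat.card_eq_fintype_card, Nat.cast_sub Nat.card_pos]
    have : (Nat.card A : ℝ) - 1 ≠ 0 := by linarith
    push_cast
    field_simp
  rw [← Finset.add_sum_erase _ _ (Finset.mem_univ (0 : A)), h2, noise, if_pos rfl]
  norm_num

/-- The exponential moment method: if `∏ i, h i (e i)` is at least `a` on an event, then `a⁻¹` times
the expectation of this product bounds the probability of the event. -/
theorem noiseProb_le [Nontrivial A] {E : (Fin n → A) → Prop} {a : ℝ} (ha : 0 < a)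
    (h : Fin n → A → ℝ) (h0 : ∀ i x, 0 ≤ h i x) (hE : ∀ e, E e → a ≤ ∏ i, h i (e i)) :
    noiseProb E ≤ a⁻¹ * ∏ i, ∑ x, noise x * h i x := by
  classical
  rw [Finset.prod_univ_sum, Fintype.piFinset_univ, Finset.mul_sum]
  refine Finset.sum_le_sum fun e _ => ?_
  have h1 : 0 ≤ ∏ i, noise (e i) := Finset.prod_nonneg fun i _ => noise_nonneg _
  rw [Finset.prod_mul_distrib]
  split_ifs with hEe
  · have := mul_le_mul_of_nonneg_left (hE e hEe) h1
    rw [inv_mul_eq_div, le_div_iff₀ ha]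
    exact this
  · exact mul_nonneg (inv_nonneg.2 ha.le)
      (mul_nonneg h1 (Finset.prod_nonneg fun i _ => h0 _ _))

theorem noiseProb_mono [Nontrivial A] {E E' : (Fin n → A) → Prop} (h : ∀ e, E e → E' e) :
    noiseProb E ≤ noiseProb E' := by
  refine Finset.sum_le_sum fun e _ => ?_
  have h1 : 0 ≤ ∏ i, noise (e i) := Finset.prod_nonneg fun i _ => noise_nonneg _
  split_ifs with h2 h3 h3
  · exact le_rfl
  · exact absurd (h e h2) h3
  · exact h1
  · exact le_rfl

theorem noiseProb_add_noiseProb_not [Nontrivial A] (E : (Fin n → A) → Prop) :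
    noiseProb E + noiseProb (fun e => ¬ E e) = 1 := by
  classical
  rw [noiseProb, noiseProb, ← Finset.sum_add_distrib]
  have h1 : ∑ e : Fin n → A, ∏ i, noise (e i) = 1 := by
    have := Finset.prod_univ_sum (fun _ : Fin n => (Finset.univ : Finset A)) fun _ a => noise a
    rw [Fintype.piFinset_univ] at this
    rw [← this]
    simp [sum_noise]
  rw [← h1]
  refine Finset.sum_congr rfl fun e _ => ?_
  by_cases h : E e <;> simp [h]

theorem noiseProb_or_le [Nontrivial A] (E E' : (Fin n → A) → Prop) :
    noiseProb (fun e => E e ∨ E' e) ≤ noiseProb E + noiseProb E' := by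
  rw [noiseProb, noiseProb, noiseProb, ← Finset.sum_add_distrib]
  refine Finset.sum_le_sum fun e _ => ?_
  have h1 : 0 ≤ ∏ i, noise (e i) := Finset.prod_nonneg fun i _ => noise_nonneg _
  by_cases h : E e <;> by_cases h' : E' e <;> simp [h, h', h1]

theorem noiseProb_exists_le [Nontrivial A] {ι : Type*} [Fintype ι]
    (E : ι → (Fin n → A) → Prop) :
    noiseProb (fun e => ∃ i, E i e) ≤ ∑ i, noiseProb (E i) := by
  classical
  simp only [noiseProb]
  rw [Finset.sum_comm]
  refine Finset.sum_le_sum fun e _ => ?_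
  have h1 : 0 ≤ ∏ i, noise (e i) := Finset.prod_nonneg fun i _ => noise_nonneg _
  split_ifs with h
  · obtain ⟨i, hi⟩ := h
    refine le_trans ?_ (Finset.single_le_sum (fun j _ => ?_) (Finset.mem_univ i))
    · simp [hi]
    · split_ifs <;> simp [h1]
  · exact Finset.sum_nonneg fun j _ => by split_ifs <;> simp [h1]

open Classical in
/-- The number of errors exceeds `11/20` of the length with exponentially small probability. -/
theorem noiseProb_few_zeros_le [Nontrivial A] :
    noiseProb (fun e : Fin n → A => ¬ 9 * n ≤ 20 * (Finset.univ.filter fun i => e i = 0).card) ≤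
      ((11 / 10 : ℝ) / (6 / 5 : ℝ) ^ (11 / 20 : ℝ)) ^ n := by
  have hpos : (0 : ℝ) < ((6 / 5 : ℝ) ^ (11 / 20 : ℝ)) ^ n := by positivity
  -- weight `6 / 5` for every non-zero symbol; its expectation is `11 / 10`, and
  -- `(6 / 5) ^ (11 / 20)` is larger
  have key := noiseProb_le (A := A) (n := n) hpos (fun _ a => if a = 0 then 1 else 6 / 5)
    (fun i x => by split_ifs <;> norm_num)
    (E := fun e => ¬ 9 * n ≤ 20 * (Finset.univ.filter fun i => e i = 0).card) (fun e he => ?_)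
  · refine key.trans_eq ?_
    have h1 : ∑ x : A, noise x * (if x = 0 then 1 else 6 / 5) = 11 / 10 := by
      have h2 : ∀ x : A, noise x * (if x = 0 then (1 : ℝ) else 6 / 5) =
          6 / 5 * noise x - if x = 0 then 1 / 10 else 0 := by
        intro x
        split_ifs with h
        · subst h; simp [noise]; norm_num
        · ring
      simp only [h2, Finset.sum_sub_distrib, ← Finset.mul_sum, sum_noise]
      simp
      norm_num
    rw [h1, Finset.prod_const, Finset.card_univ, Fintype.card_fin, div_pow (11 / 10 : ℝ),
      inv_mul_eq_div]
  · rw [Finset.prod_ite, Finset.prod_const_one, one_mul, Finset.prod_const, ← Real.rpow_natCast,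
      ← Real.rpow_mul (by norm_num), ← Real.rpow_natCast]
    refine Real.rpow_le_rpow_of_exponent_le (by norm_num) ?_
    have h1 := Finset.card_filter_add_card_filter_not (s := (Finset.univ : Finset (Fin n)))
      (fun i => e i = 0)
    rw [Finset.card_univ, Fintype.card_fin] at h1
    have h2 : 11 * n ≤ 20 * (Finset.univ.filter fun i => ¬ e i = 0).card := by omega
    have h3 : (11 * n : ℝ) ≤ 20 * ((Finset.univ.filter fun i => ¬ e i = 0).card : ℝ) := by
      exact_mod_cast h2
    linarith

open Classical in
/-- Random noise agrees with the non-zero symbols of a given word in `r` places with probability at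
most `2 ^ n * |A| ^ (-r)`. -/
theorem noiseProb_agree_le [Nontrivial A] (x : Fin n → A) (r : ℕ) :
    noiseProb (fun e : Fin n → A => r ≤ (Finset.univ.filter fun i => x i ≠ 0 ∧ e i = x i).card) ≤
      2 ^ n * ((Nat.card A : ℝ) ^ r)⁻¹ := by
  have h1 : (1 : ℝ) < Nat.card A := by exact_mod_cast Finite.one_lt_card
  have hpos : (0 : ℝ) < (Nat.card A : ℝ) ^ r := by positivity
  refine (noiseProb_le hpos (fun i a => if x i ≠ 0 ∧ a = x i then (Nat.card A : ℝ) else 1)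
    (fun i x => by split_ifs <;> linarith) fun e he => ?_).trans ?_
  · rw [Finset.prod_ite, Finset.prod_const_one, mul_one, Finset.prod_const]
    exact pow_le_pow_right₀ h1.le he
  · rw [mul_comm]
    refine mul_le_mul_of_nonneg_right ?_ (inv_nonneg.2 hpos.le)
    rw [show (2 : ℝ) ^ n = ∏ _i : Fin n, (2 : ℝ) by simp]
    refine Finset.prod_le_prod (fun i _ => Finset.sum_nonneg fun a _ =>
      mul_nonneg (noise_nonneg a) (by split_ifs <;> linarith)) fun i _ => ?_
    by_cases hx : x i = 0
    · simp only [hx, ne_eq, not_true_eq_false, false_and, if_false, mul_one, sum_noise]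
      norm_num
    · have h2 : ∀ a : A, noise a * (if x i ≠ 0 ∧ a = x i then (Nat.card A : ℝ) else 1) =
          noise a + if a = x i then 1 / 2 else 0 := by
        intro a
        by_cases ha : a = x i
        · have h3 : (Nat.card A : ℝ) - 1 ≠ 0 := by linarith
          subst ha
          simp only [noise, hx, ne_eq, not_false_eq_true, and_self, if_true, if_false]
          field_simp
          ring
        · simp [ha]
      simp only [h2, Finset.sum_add_distrib, sum_noise]
      simp
      norm_num

end Noise

end Code

/-! ### The error probability of the decoder -/

namespace FRSFamily

open Received Polynomial

theorem card_eq (lam : ℕ) : Fintype.card (Fld lam) = (chr lam - 1) * (chr lam + 1) + 1 := by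
  rw [card_fld, fieldSize_eq]

theorem generator_spec (lam : ℕ) : elt lam (gen lam) = (genUnit lam : Fld lam) :=
  (genUnit_coe lam).symm

theorem problem_valid (lam : ℕ) (z : ℕ → ℕ) : (problem lam z).Valid where
  inj i j hi hiN hj hjN h := by
    rw [show (problem lam z).γ = (genUnit lam : Fld lam) from generator_spec lam] at h
    exact Code.pow_injOn (mem_zpowers_genUnit lam) (card_eq lam) hi hiN hj hjN h
  interp_lt := by simp only [problem]; omega
  agree_le a ha := by
    simp only [problem] at ha ⊢
    have hp := (chr_spec lam).2.1
    obtain ⟨p, hp'⟩ : ∃ p, chr lam = p + 1 := ⟨chr lam - 1, by omega⟩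
    rw [hp'] at ha hp ⊢
    simp only [Nat.add_sub_cancel] at ha ⊢
    have h1 := Nat.mul_div_le (p * (p + 1 + 1)) 3
    have h2 := Nat.mul_div_le (p * (p + 1 + 1)) 20
    nlinarith
  K_le := Nat.div_le_self _ _
  enum c := ⟨val c, val_lt c, elt_val c⟩

/-- The values of the polynomial with coefficients `g 1, g 2, …`, up to the degree that occurs in
the dual code. -/
noncomputable def dualWord (lam : ℕ) (g : ℕ → Fld lam) (t : ℕ) : Fld lam :=
  (problem lam fun _ => 0).eval g t

theorem index_lt {lam : ℕ} (b : Fin (chr lam - 1)) (j : Fin (chr lam + 1)) :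
    (b : ℕ) * (chr lam + 1) + j < (chr lam - 1) * (chr lam + 1) :=
  Received.index_lt b.2 j.2

theorem finProdFinEquiv_eq {lam : ℕ} (b : Fin (chr lam - 1)) (j : Fin (chr lam + 1)) :
    finProdFinEquiv (b, j) = ⟨(b : ℕ) * (chr lam + 1) + j, index_lt b j⟩ :=
  Fin.ext (by rw [finProdFinEquiv_apply_val]; simp only; ring)

/-- The words of the code of index `lam`, with explicit parameters. -/
abbrev Words (lam : ℕ) : Type := Fin (chr lam - 1) → Fin (chr lam + 1) → Fld lam

/-- The bound on the degree of the polynomials that define the code. -/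
noncomputable abbrev degreeBound (lam : ℕ) : ℕ :=
  (chr lam - 1) * (chr lam + 1) - 1 - (chr lam - 1) * (chr lam + 1) / 20

/-- The code of index `lam`, as a subspace of `Words lam`. -/
noncomputable def codewords (lam : ℕ) : Submodule (Fld lam) (Words lam) :=
  Code.folded (Code.reedSolomon (genUnit lam : Fld lam) ((chr lam - 1) * (chr lam + 1))
    (degreeBound lam))

/-- The symbols of a word, as numbers. -/
noncomputable def numbers (lam : ℕ) (e : Words lam) : List ℕ :=
  List.ofFn fun i => val ((Code.foldEquiv (Fld lam) (chr lam - 1) (chr lam + 1)).symm e i)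

/-- The decoding problem for a word. -/
noncomputable def received (lam : ℕ) (e : Words lam) : Received (Fld lam) :=
  problem lam fun t => (numbers lam e).getD t 0

theorem decoder_apply (lam : ℕ) (e : Words lam) (b : Fin (chr lam - 1)) (j : Fin (chr lam + 1)) :
    decoder lam e b j = (received lam e).decode ((b : ℕ) * (chr lam + 1) + j) := by
  change (received lam e).decode (finProdFinEquiv (b, j) : Fin _) = _
  rw [finProdFinEquiv_eq]

theorem received_z {lam : ℕ} (e : Words lam) (b : Fin (chr lam - 1)) (j : Fin (chr lam + 1)) :
    (received lam e).z ((b : ℕ) * (chr lam + 1) + j) = e b j := by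
  have h1 : (numbers lam e).getD ((b : ℕ) * (chr lam + 1) + j) 0 = val (e b j) := by
    rw [List.getD_eq_getElem _ _ (by rw [numbers, List.length_ofFn]; exact index_lt b j)]
    simp only [numbers, List.getElem_ofFn]
    rw [← finProdFinEquiv_eq, Code.foldEquiv_symm_apply]
  change elt lam ((numbers lam e).getD ((b : ℕ) * (chr lam + 1) + j) 0) = _
  rw [h1, elt_val]

open Classical in
theorem card_agreement {lam : ℕ} (e : Words lam) (w : ℕ → Fld lam) :
    ((received lam e).agreement w).card =
      (Finset.univ.filter fun b : Fin (chr lam - 1) =>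
        ∀ j : Fin (chr lam + 1), w ((b : ℕ) * (chr lam + 1) + j) = e b j).card := by
  symm
  refine Finset.card_bij (fun b _ => (b : ℕ)) (fun b hb => ?_) (fun b _ b' _ h => Fin.ext h)
    fun b hb => ?_
  · have hb := (Finset.mem_filter.1 hb).2
    refine Finset.mem_filter.2 ⟨Finset.mem_range.2 b.2, fun j hj => ?_⟩
    exact (hb ⟨j, hj⟩).trans (received_z e b ⟨j, hj⟩).symm
  · obtain ⟨hb, hb'⟩ := Finset.mem_filter.1 hb
    refine ⟨⟨b, Finset.mem_range.1 hb⟩, Finset.mem_filter.2 ⟨Finset.mem_univ _, fun j => ?_⟩, rfl⟩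
    exact (hb' j j.2).trans (received_z e ⟨b, Finset.mem_range.1 hb⟩ j)

open Classical in
/-- The decoder corrects every error that vanishes on `9/20` of the blocks and does not agree with
a non-zero word of the dual code on `9/20` of the blocks. -/
theorem decoder_eq {lam : ℕ} (e : Words lam)
    (h0 : 9 * (chr lam - 1) ≤ 20 * (Finset.univ.filter fun b => e b = 0).card)
    (h1 : ∀ g : ℕ → Fld lam, 9 * (chr lam - 1) ≤ 20 *
      (Finset.univ.filter fun b : Fin (chr lam - 1) => ∀ j : Fin (chr lam + 1),
        dualWord lam g ((b : ℕ) * (chr lam + 1) + j) = e b j).card →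
      ∀ t < (chr lam - 1) * (chr lam + 1), dualWord lam g t = 0)
    (x : Words lam) (hx : x ∈ Code.dual (codewords lam)) : decoder lam (x + e : Words lam) = x := by
  have hpos : 0 < (chr lam - 1) * (chr lam + 1) :=
    Nat.mul_pos (by have := (chr_spec lam).2.1; omega) (by omega)
  obtain ⟨g, hg⟩ := Code.exists_eval_of_mem_dual (mem_zpowers_genUnit lam)
    (K := (chr lam - 1) * (chr lam + 1) / 20) (k := degreeBound lam) (card_eq lam)
    (by simp only [degreeBound]; omega) hx
  have hgx (b : Fin (chr lam - 1)) (j : Fin (chr lam + 1)) :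
      dualWord lam g ((b : ℕ) * (chr lam + 1) + j) = x b j := by
    rw [← Code.foldEquiv_symm_apply x, hg, finProdFinEquiv_eq, ← generator_spec]
    rfl
  have hsub (g' : ℕ → Fld lam) (t : ℕ) : dualWord lam (fun i => g' i - g i) t =
      dualWord lam g' t - dualWord lam g t := by
    simp only [dualWord, Received.eval, sub_mul, Finset.sum_sub_distrib]
  have key := decode_eq (d := received lam (x + e)) (problem_valid lam _) g
    (by
      rw [card_agreement]
      refine h0.trans (Nat.mul_le_mul_left _ (Finset.card_le_card fun b hb => ?_))
      refine Finset.mem_filter.2 ⟨Finset.mem_univ _, fun j => (hgx b j).trans ?_⟩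
      rw [Pi.add_apply, (Finset.mem_filter.1 hb).2, add_zero])
    (by
      intro g' hg2 t ht
      rw [card_agreement] at hg2
      have h2 := h1 (fun i => g' i - g i) (hg2.trans (Nat.mul_le_mul_left _
        (Finset.card_le_card fun b hb =>
          Finset.mem_filter.2 ⟨Finset.mem_univ _, fun j => ?_⟩))) t ht
      · rw [hsub, sub_eq_zero] at h2
        exact h2
      · have h3 : dualWord lam g' ((b : ℕ) * (chr lam + 1) + j) = x b j + e b j :=
          (Finset.mem_filter.1 hb).2 j
        rw [hsub, hgx, h3, add_sub_cancel_left])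
  funext b j
  refine (decoder_apply lam (x + e) b j).trans ((key _ (index_lt b j)).trans ?_)
  exact hgx b j

/-- A non-zero word of the dual code vanishes on at most `1/20` of the blocks. -/
theorem card_zero_blocks_le {lam : ℕ} (g : ℕ → Fld lam) {t : ℕ} (ht : dualWord lam g t ≠ 0)
    (Z : Finset (Fin (chr lam - 1)))
    (hZ : ∀ b ∈ Z, ∀ j : Fin (chr lam + 1), dualWord lam g ((b : ℕ) * (chr lam + 1) + j) = 0) :
    20 * Z.card ≤ chr lam - 1 := by
  classical
  set d := problem lam fun _ => 0
  let s := (Z ×ˢ (Finset.univ : Finset (Fin (chr lam + 1)))).image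
    fun p => d.γ ^ ((p.1 : ℕ) * (chr lam + 1) + p.2 + 1)
  have hs : s.card = Z.card * (chr lam + 1) := by
    rw [Finset.card_image_of_injective, Finset.card_product, Finset.card_univ, Fintype.card_fin]
    intro p p' h
    have h1 := index_lt p.1 p.2
    have h2 := index_lt p'.1 p'.2
    have h3 := (problem_valid lam fun _ => 0).inj _ _ (by omega) h1 (by omega) h2 h
    have h4 : finProdFinEquiv (p.1, p.2) = finProdFinEquiv (p'.1, p'.2) := by
      rw [finProdFinEquiv_eq, finProdFinEquiv_eq, Fin.mk.injEq]
      omega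
    exact finProdFinEquiv.injective h4
  by_contra hcon
  have hK : (chr lam - 1) * (chr lam + 1) / 20 < Z.card * (chr lam + 1) := by
    rw [Nat.div_lt_iff_lt_mul (by norm_num)]
    nlinarith
  have hzero : d.messagePoly g = 0 := by
    refine eq_zero_of_degree_lt_of_eval_finset_eq_zero s ?_ fun x hx => ?_
    · rw [hs]
      exact (degree_messagePoly_le g).trans_lt (by exact_mod_cast hK)
    · obtain ⟨p, hp, rfl⟩ := Finset.mem_image.1 hx
      rw [eval_messagePoly]
      exact hZ p.1 (Finset.mem_product.1 hp).1 p.2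
  apply ht
  rw [dualWord, ← eval_messagePoly]
  change Polynomial.eval _ (d.messagePoly g) = 0
  rw [hzero, eval_zero]

theorem dualWord_congr {lam : ℕ} {g g' : ℕ → Fld lam}
    (h : ∀ i < (chr lam - 1) * (chr lam + 1) / 20, g (i + 1) = g' (i + 1)) (t : ℕ) :
    dualWord lam g t = dualWord lam g' t := by
  simp only [dualWord, Received.eval]
  refine Finset.sum_congr rfl fun i hi => ?_
  rw [h i (Finset.mem_range.1 hi)]

instance (lam : ℕ) : Nontrivial (Fin (chr lam + 1) → Fld lam) := Function.nontrivial

open Classical in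
/-- The probability that the noise agrees with a given non-zero word of the dual code on `9/20` of
the blocks: as the word vanishes on at most `1/20` of the blocks, at least `2/5` of the blocks are
non-zero symbols on which there is agreement. -/
theorem noiseProb_bad_word_le (lam : ℕ) (g : ℕ → Fld lam) {t : ℕ} (ht : dualWord lam g t ≠ 0) :
    Code.noiseProb (fun e : Words lam => 9 * (chr lam - 1) ≤ 20 *
      (Finset.univ.filter fun b : Fin (chr lam - 1) => ∀ j : Fin (chr lam + 1),
        dualWord lam g ((b : ℕ) * (chr lam + 1) + j) = e b j).card) ≤
      2 ^ (chr lam - 1) * ((((chr lam * chr lam : ℕ) : ℝ) ^ (chr lam + 1)) ^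
        ((2 * (chr lam - 1) + 4) / 5))⁻¹ := by
  let x : Words lam := fun b j => dualWord lam g ((b : ℕ) * (chr lam + 1) + j)
  have hA : Nat.card (Fin (chr lam + 1) → Fld lam) = (chr lam * chr lam) ^ (chr lam + 1) := by
    rw [Nat.card_eq_fintype_card, Fintype.card_fun, Fintype.card_fin, card_fld]
  have key := Code.noiseProb_agree_le x ((2 * (chr lam - 1) + 4) / 5)
  rw [hA] at key
  push_cast at key ⊢
  refine (Code.noiseProb_mono fun e he => ?_).trans key
  have h1 := card_zero_blocks_le g ht (Finset.univ.filter fun b => x b = 0) fun b hb j =>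
    congrFun (Finset.mem_filter.1 hb).2 j
  have h2 : (Finset.univ.filter fun b : Fin (chr lam - 1) => ∀ j : Fin (chr lam + 1),
      dualWord lam g ((b : ℕ) * (chr lam + 1) + j) = e b j) ⊆
      (Finset.univ.filter fun b => x b ≠ 0 ∧ e b = x b) ∪ Finset.univ.filter fun b => x b = 0 := by
    intro b hb
    have hb := (Finset.mem_filter.1 hb).2
    by_cases hxb : x b = 0
    · exact Finset.mem_union_right _ (Finset.mem_filter.2 ⟨Finset.mem_univ _, hxb⟩)
    · exact Finset.mem_union_left _ (Finset.mem_filter.2 ⟨Finset.mem_univ _, hxb,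
        funext fun j => (hb j).symm⟩)
  have h3 := (Finset.card_le_card h2).trans (Finset.card_union_le _ _)
  refine le_trans (b := (Finset.univ.filter fun b => x b ≠ 0 ∧ e b = x b).card) (by omega)
    (le_of_eq ?_)
  congr!

open Classical in
/-- A union bound over the `q ^ K` words of the dual code, of rate `1/20`. -/
theorem noiseProb_bad_le (lam : ℕ) : Code.noiseProb (fun e : Words lam =>
    ∃ g : ℕ → Fld lam, (∃ t, dualWord lam g t ≠ 0) ∧ 9 * (chr lam - 1) ≤ 20 *
      (Finset.univ.filter fun b : Fin (chr lam - 1) => ∀ j : Fin (chr lam + 1),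
        dualWord lam g ((b : ℕ) * (chr lam + 1) + j) = e b j).card) ≤
      (1 / 2 : ℝ) ^ (chr lam - 1) := by
  set n := chr lam - 1 with hn
  set K := n * (chr lam + 1) / 20 with hK
  set r := (2 * n + 4) / 5 with hr
  set q := chr lam * chr lam with hq
  have hp := (chr_spec lam).2.1
  -- a word of the dual code depends on the first `K` coefficients only
  let G (a : Fin K → Fld lam) (i : ℕ) : Fld lam := if h : i - 1 < K then a ⟨i - 1, h⟩ else 0
  have hB : (0 : ℝ) ≤ 2 ^ n * (((q : ℝ) ^ (chr lam + 1)) ^ r)⁻¹ := by positivity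
  have hnum : (q ^ K * 2 ^ n : ℝ) * 2 ^ n ≤ ((q : ℝ) ^ (chr lam + 1)) ^ r := by
    rw [mul_assoc, ← mul_pow, ← pow_mul]
    have hq4 : (2 * 2 : ℝ) ≤ q := by
      have : 2 * 2 ≤ q := Nat.mul_le_mul (by omega) (by omega)
      exact_mod_cast this
    have hexp : K + n ≤ (chr lam + 1) * r := by
      have h1 := Nat.div_mul_le_self (n * (chr lam + 1)) 20
      have h2 : 2 * n ≤ 5 * r := by omega
      nlinarith
    calc (q : ℝ) ^ K * (2 * 2) ^ n ≤ (q : ℝ) ^ K * (q : ℝ) ^ n := by gcongr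
      _ = (q : ℝ) ^ (K + n) := (pow_add _ _ _).symm
      _ ≤ _ := pow_le_pow_right₀ (by linarith) hexp
  calc Code.noiseProb _ ≤ Code.noiseProb (fun e : Words lam => ∃ a : Fin K → Fld lam,
        (∃ t, dualWord lam (G a) t ≠ 0) ∧ 9 * n ≤ 20 *
        (Finset.univ.filter fun b : Fin n => ∀ j : Fin (chr lam + 1),
          dualWord lam (G a) ((b : ℕ) * (chr lam + 1) + j) = e b j).card) := by
        refine Code.noiseProb_mono fun e ⟨g, ⟨t, ht⟩, hg⟩ => ?_
        have h1 (t : ℕ) : dualWord lam (G fun i => g (i + 1)) t = dualWord lam g t :=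
          dualWord_congr (fun i hi => by
            simp only [G, Nat.add_sub_cancel]
            exact dif_pos hi) t
        exact ⟨fun i => g (i + 1), ⟨t, by rwa [h1]⟩, by simpa only [h1] using hg⟩
    _ ≤ ∑ a : Fin K → Fld lam, 2 ^ n * (((q : ℝ) ^ (chr lam + 1)) ^ r)⁻¹ := by
        refine (Code.noiseProb_exists_le _).trans (Finset.sum_le_sum fun a _ => ?_)
        by_cases h : ∃ t, dualWord lam (G a) t ≠ 0
        · obtain ⟨t, ht⟩ := h
          exact (Code.noiseProb_mono fun e he => he.2).trans (noiseProb_bad_word_le lam _ ht)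
        · simp only [h, false_and]
          simp [Code.noiseProb, hB]
    _ = q ^ K * 2 ^ n * (((q : ℝ) ^ (chr lam + 1)) ^ r)⁻¹ := by
        rw [Finset.sum_const, Finset.card_univ, Fintype.card_fun, Fintype.card_fin, card_fld,
          nsmul_eq_mul, Nat.cast_pow, mul_assoc]
    _ ≤ (1 / 2 : ℝ) ^ n := by
        have h2 : (0 : ℝ) < ((q : ℝ) ^ (chr lam + 1)) ^ r := by
          have : 0 < q := Nat.mul_pos (by omega) (by omega)
          positivity
        rw [one_div, inv_pow, mul_inv_le_iff₀ h2, ← div_eq_inv_mul, le_div_iff₀ (by positivity)]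
        exact hnum

open Classical in
/-- The decoder fails only if there are few zeros in the noise, or if the noise is close to a word
of the dual code.  The enumeration of the alphabet is arbitrary, because the one that comes with
`FoldedRS` is not the one of the field. -/
theorem decoding_bound (lam : ℕ) (inst : Fintype (Fin (chr lam + 1) → Fld lam)) :
    1 - (((11 / 10 : ℝ) / (6 / 5 : ℝ) ^ (11 / 20 : ℝ)) ^ (chr lam - 1) +
      (1 / 2 : ℝ) ^ (chr lam - 1)) ≤ Code.noiseProb fun e : Words lam =>
        ∀ x ∈ Code.dual (codewords lam), decoder lam (x + e : Words lam) = x := by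
  obtain rfl : inst = Pi.instFintype := Subsingleton.elim _ _
  have h := Code.noiseProb_add_noiseProb_not (A := Fin (chr lam + 1) → Fld lam) fun e : Words lam =>
      ∀ x ∈ Code.dual (codewords lam), decoder lam (x + e : Words lam) = x
  suffices h' : Code.noiseProb (fun e : Words lam =>
      ¬ ∀ x ∈ Code.dual (codewords lam), decoder lam (x + e : Words lam) = x) ≤
      ((11 / 10 : ℝ) / (6 / 5 : ℝ) ^ (11 / 20 : ℝ)) ^ (chr lam - 1) +
        (1 / 2 : ℝ) ^ (chr lam - 1) by
    linarith
  refine le_trans ?_ (add_le_add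
    (Code.noiseProb_few_zeros_le (A := Fin (chr lam + 1) → Fld lam)) (noiseProb_bad_le lam))
  refine (Code.noiseProb_mono fun e he => ?_).trans (Code.noiseProb_or_le _ _)
  contrapose! he
  obtain ⟨h0, h1⟩ := he
  refine decoder_eq e (by convert h0) fun g hg t _ => ?_
  by_contra ht
  exact absurd hg (not_le.2 (h1 g ⟨t, ht⟩))

theorem exists_decoding_bound : ∃ δ : ℝ, 0 < δ ∧ ∀ᶠ lam : ℕ in atTop,
    1 - (2 : ℝ) ^ (-(δ * lam)) ≤ Code.noiseProb fun e : (code lam).Word =>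
      ∀ x ∈ Code.dual (code lam).code, decoder lam (x + e) = x := by
  set ρ : ℝ := (11 / 10 : ℝ) / (6 / 5 : ℝ) ^ (11 / 20 : ℝ) with hρ
  have hρ0 : 0 < ρ := by positivity
  have hρ1 : ρ < 1 := by
    rw [hρ, div_lt_one (by positivity)]
    refine lt_of_pow_lt_pow_left₀ 20 (by positivity) ?_
    rw [← Real.rpow_natCast ((6 / 5 : ℝ) ^ (11 / 20 : ℝ)), ← Real.rpow_mul (by norm_num)]
    norm_num
  -- `τ ^ n = (√τ ^ n) ^ 2`, and one of the two factors makes up for the factor `2`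
  obtain ⟨τ, hτ1, hτ2⟩ := exists_between (max_lt hρ1 (by norm_num : (1 / 2 : ℝ) < 1))
  have hτ0 : 0 < τ := hρ0.trans ((le_max_left _ _).trans_lt hτ1)
  set σ := √τ
  have hσ0 : 0 < σ := Real.sqrt_pos.2 hτ0
  have hσ1 : σ < 1 := by rw [Real.sqrt_lt' one_pos]; simpa using hτ2
  refine ⟨-Real.logb 2 σ, by
    have := Real.logb_neg (b := 2) (by norm_num) hσ0 hσ1; linarith, ?_⟩
  have hlim : ∀ᶠ lam : ℕ in atTop, 2 * σ ^ lam ≤ 1 := by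
    have h := ((tendsto_pow_atTop_nhds_zero_of_lt_one hσ0.le hσ1).const_mul 2)
    rw [mul_zero] at h
    exact h.eventually (eventually_le_nhds one_pos)
  filter_upwards [hlim] with lam h
  refine le_trans ?_ (decoding_bound lam (show Fintype (code lam).Alphabet from inferInstance))
  have h1 : (2 : ℝ) ^ (-(-Real.logb 2 σ * lam)) = σ ^ lam := by
    rw [neg_mul, neg_neg, Real.rpow_mul (by norm_num), Real.rpow_logb (by norm_num) (by norm_num)
      hσ0, Real.rpow_natCast]
  rw [h1]
  have hp := (chr_spec lam).2.1
  have h2 (y : ℝ) (hy : 0 ≤ y) (hyτ : y ≤ τ) : y ^ (chr lam - 1) ≤ σ ^ lam * σ ^ lam := by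
    rw [← mul_pow, Real.mul_self_sqrt hτ0.le]
    exact (pow_le_pow_left₀ hy hyτ _).trans (pow_le_pow_of_le_one hτ0.le hτ2.le (by omega))
  have h3 := h2 ρ hρ0.le ((le_max_left _ _).trans hτ1.le)
  have h4 := h2 (1 / 2) (by norm_num) ((le_max_right _ _).trans hτ1.le)
  have h5 : 0 ≤ σ ^ lam := by positivity
  nlinarith

end FRSFamily

/-! ### Interpolation with multiplicities -/

namespace Interpolation

open Polynomial

variable {F σ : Type*} [Field F]

/-- The exponents of the monomials of total degree less than `t`. -/
noncomputable def lowExponents (σ : Type*) [Finite σ] (t : ℕ) : Finset (σ →₀ ℕ) :=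
  (Finsupp.finite_of_degree_lt t).toFinset

theorem mem_lowExponents [Finite σ] {t : ℕ} {e : σ →₀ ℕ} : e ∈ lowExponents σ t ↔ e.degree < t := by
  simp [lowExponents]

theorem factorial_mul_card_lowExponents [Fintype σ] [Nonempty σ] (t : ℕ) :
    (Fintype.card σ).factorial * (lowExponents σ t).card = t.ascFactorial (Fintype.card σ) := by
  classical
  have h : (lowExponents σ t).card =
      ∑ i ∈ Finset.range t, (Fintype.card σ).multichoose i := by
    rw [Finset.card_eq_sum_card_fiberwise (f := Finsupp.degree) (t := Finset.range t)]
    · refine Finset.sum_congr rfl fun i hi => ?_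
      rw [← Finset.card_univ, ← Finset.card_finsuppAntidiag_nat_eq_multichoose]
      congr 1
      ext e
      simp only [Finset.mem_filter, mem_lowExponents, Finset.mem_finsuppAntidiag,
        Finsupp.degree_eq_sum, Finset.subset_univ, and_true]
      exact ⟨fun h => h.2, fun h => ⟨h.trans_lt (Finset.mem_range.1 hi), h⟩⟩
    · intro e he
      simpa using mem_lowExponents.1 he
  obtain ⟨m, hm⟩ : ∃ m, Fintype.card σ = m + 1 :=
    ⟨_, (Nat.succ_pred_eq_of_pos Fintype.card_pos).symm⟩
  rw [h]
  cases t with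
  | zero => rw [hm]; simp [Nat.zero_ascFactorial]
  | succ t => rw [Nat.sum_range_multichoose, ← Nat.ascFactorial_eq_factorial_mul_choose]

/-- The substitution `X ↦ X + p`. -/
noncomputable def translate (p : σ → F) : MvPolynomial σ F →ₐ[F] MvPolynomial σ F :=
  MvPolynomial.aeval fun i => MvPolynomial.X i + MvPolynomial.C (p i)

theorem aeval_translate (p : σ → F) (g : σ → F[X]) (Q : MvPolynomial σ F) :
    MvPolynomial.aeval (fun i => g i - C (p i)) (translate p Q) = MvPolynomial.aeval g Q := by
  rw [← AlgHom.comp_apply]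
  congr 1
  ext i
  simp [translate, ← Polynomial.algebraMap_eq]

/-- Along a curve through a point at which `Q` vanishes to order `r`, the value of `Q` vanishes to
order `r` as well. -/
theorem pow_dvd_aeval [Fintype σ] {Q : MvPolynomial σ F} {p : σ → F} {r : ℕ}
    (hQ : ∀ e ∈ lowExponents σ r, (translate p Q).coeff e = 0) {g : σ → F[X]} {u : F[X]}
    (hg : ∀ i, u ∣ g i - C (p i)) : u ^ r ∣ MvPolynomial.aeval g Q := by
  rw [← aeval_translate p, MvPolynomial.aeval_def, MvPolynomial.eval₂_eq']
  refine Finset.dvd_sum fun e _ => ?_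
  by_cases he : e.degree < r
  · rw [hQ e (mem_lowExponents.2 he), map_zero, zero_mul]
    exact dvd_zero _
  · refine Dvd.dvd.mul_left ((pow_dvd_pow u (not_lt.1 he)).trans ?_) _
    rw [Finsupp.degree_eq_sum, ← Finset.prod_pow_eq_pow_sum]
    exact Finset.prod_dvd_prod_of_dvd _ _ fun i _ => pow_dvd_pow_of_dvd (hg i) _

/-- Counting conditions: more polynomials than conditions yield a combination that vanishes to
order `r` at all points. -/
theorem exists_combination [Finite σ] {I : Type*} [Fintype I] (v : I → MvPolynomial σ F)
    (P : Finset (σ → F)) (r : ℕ) (h : P.card * (lowExponents σ r).card < Fintype.card I) :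
    ∃ c : I → F, c ≠ 0 ∧ ∀ p ∈ P, ∀ e ∈ lowExponents σ r,
      (translate p (∑ x, c x • v x)).coeff e = 0 := by
  let Φ : (I → F) →ₗ[F] (P × lowExponents σ r → F) :=
    { toFun := fun c w => (translate w.1.1 (∑ x, c x • v x)).coeff w.2.1
      map_add' := fun c c' => by
        ext w
        simp [add_smul, Finset.sum_add_distrib]
      map_smul' := fun a c => by
        ext w
        simp [mul_smul, ← Finset.smul_sum] }
  obtain ⟨c, hc, hc0⟩ := Submodule.exists_mem_ne_zero_of_ne_bot
    (LinearMap.ker_ne_bot_of_finrank_lt (f := Φ) (by simpa using h))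
  exact ⟨c, hc0, fun p hp e he => congrFun (LinearMap.mem_ker.1 hc) (⟨p, hp⟩, ⟨e, he⟩)⟩

/-- The polynomials `X, f(X), f(γ X), …, f(γ ^ (s - 1) X)`. -/
noncomputable def shifts (γ : F) (s : ℕ) (f : F[X]) : Option (Fin s) → F[X]
  | none => X
  | some j => f.comp (C (γ ^ (j : ℕ)) * X)

/-- Interpolation with multiplicities: there is a non-zero polynomial relation
`∑ b, A b * ∏ j, Y j ^ b j` with coefficients in `F[X]`, satisfied by all `f` of degree at most `k`
whose shifts pass through sufficiently many of the given points. -/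
theorem exists_relation {s k t r q : ℕ} (γ : F) (htq : t ≤ q)
    (P : Finset (Option (Fin s) → F))
    (hcard : P.card * (lowExponents (Option (Fin s)) r).card <
      k * (lowExponents (Option (Fin s)) t).card) :
    ∃ A : (Fin s → Fin q) → F[X], A ≠ 0 ∧ ∀ f : F[X], f.natDegree ≤ k → ∀ Z : Finset F,
      (∀ α ∈ Z, (fun i => (shifts γ s f i).eval α) ∈ P) → k * t ≤ Z.card * r →
        ∑ b, A b * ∏ j, shifts γ s f (some j) ^ (b j : ℕ) = 0 := by
  classical
  -- the monomial of `(a, e)` is `X ^ (a + k * e none) * ∏ j, Y j ^ e (some j)`; if `Y j` is given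
  -- degree `k`, its degree is less than `k * t`
  let I := Fin k × lowExponents (Option (Fin s)) t
  have hI (x : I) : (x.2 : Option (Fin s) →₀ ℕ) none +
      ∑ j, (x.2 : Option (Fin s) →₀ ℕ) (some j) < t := by
    have := mem_lowExponents.1 x.2.2
    rwa [Finsupp.degree_eq_sum, Fintype.sum_option] at this
  let φ (x : I) : Fin s → Fin q := fun j => ⟨(x.2 : Option (Fin s) →₀ ℕ) (some j), by
    have h1 := hI x
    have h2 := Finset.single_le_sum (f := fun j => (x.2 : Option (Fin s) →₀ ℕ) (some j))
      (fun _ _ => Nat.zero_le _) (Finset.mem_univ j)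
    omega⟩
  let ψ (x : I) : ℕ := x.1 + k * (x.2 : Option (Fin s) →₀ ℕ) none
  have hinj {x x' : I} (h1 : φ x = φ x') (h2 : ψ x = ψ x') : x = x' := by
    have hk : 0 < k := by have := x.1.2; omega
    have h3 : (x.1 : ℕ) = x'.1 := by
      have := congrArg (· % k) h2
      simpa [ψ, Nat.mod_eq_of_lt] using this
    refine Prod.ext (Fin.ext h3) (Subtype.ext (Finsupp.ext fun i => ?_))
    cases i with
    | none =>
      have h4 : k * (x.2 : Option (Fin s) →₀ ℕ) none = k * (x'.2 : Option (Fin s) →₀ ℕ) none := by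
        simp only [ψ] at h2
        omega
      exact Nat.eq_of_mul_eq_mul_left hk h4
    | some j => exact Fin.mk.inj_iff.1 (congrFun h1 j)
  obtain ⟨c, hc0, hc⟩ := exists_combination (I := I)
    (fun x => MvPolynomial.X none ^ ψ x * ∏ j, MvPolynomial.X (some j) ^ (φ x j : ℕ)) P r
    (by simpa [I] using hcard)
  refine ⟨fun b => ∑ x with φ x = b, C (c x) * X ^ ψ x, ?_, fun f hf Z hZ hlarge => ?_⟩
  · obtain ⟨x, hx⟩ := Function.ne_iff.1 hc0
    intro h
    have h1 := congrArg (fun p => coeff p (ψ x)) (congrFun h (φ x))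
    simp only [finsetSum_coeff, coeff_C_mul_X_pow, Pi.zero_apply, coeff_zero] at h1
    rw [Finset.sum_eq_single_of_mem x (by simp)] at h1
    · exact hx (by simpa using h1)
    · intro x' hx' hne
      rw [if_neg]
      exact fun h2 => hne (hinj (Finset.mem_filter.1 hx').2 h2.symm)
  · set g := shifts γ s f
    have hsum : ∑ b, (∑ x with φ x = b, C (c x) * X ^ ψ x) * ∏ j, g (some j) ^ (b j : ℕ) =
        ∑ x, C (c x) * (X ^ ψ x * ∏ j, g (some j) ^ (φ x j : ℕ)) := by
      rw [← Finset.sum_fiberwise Finset.univ φ]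
      refine Finset.sum_congr rfl fun b _ => ?_
      rw [Finset.sum_mul]
      refine Finset.sum_congr rfl fun x hx => ?_
      rw [(Finset.mem_filter.1 hx).2, mul_assoc]
    have haeval : ∑ x, C (c x) * (X ^ ψ x * ∏ j, g (some j) ^ (φ x j : ℕ)) =
        MvPolynomial.aeval g (∑ x : I, c x • (MvPolynomial.X none ^ ψ x *
          ∏ j, MvPolynomial.X (some j) ^ (φ x j : ℕ) : MvPolynomial (Option (Fin s)) F)) := by
      simp [map_sum, Polynomial.smul_eq_C_mul, g, shifts]
    rw [hsum]
    have hdvd : ∏ α ∈ Z, (X - C α) ^ r ∣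
        ∑ x, C (c x) * (X ^ ψ x * ∏ j, g (some j) ^ (φ x j : ℕ)) := by
      rw [haeval]
      refine Finset.prod_dvd_of_coprime (fun α _ β _ hαβ => ?_) fun α hα => ?_
      · exact (pairwise_coprime_X_sub_C (s := fun a : F => a) Function.injective_id hαβ).pow
      · exact pow_dvd_aeval (hc _ (hZ α hα)) fun i =>
          dvd_iff_isRoot.2 (by simp)
    refine eq_zero_of_dvd_of_degree_lt hdvd ?_
    have hdeg : (∏ α ∈ Z, (X - C α) ^ r).degree = ((Z.card * r : ℕ) : WithBot ℕ) := by
      simp [degree_prod]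
    rw [hdeg]
    refine lt_of_lt_of_le ?_ (Nat.cast_le.2 hlarge)
    refine (degree_sum_le _ _).trans_lt ((Finset.sup_lt_iff (WithBot.bot_lt_coe _)).2 fun x _ => ?_)
    have hg (j : Fin s) : (g (some j)).natDegree ≤ k := by
      refine natDegree_comp_le.trans ((Nat.mul_le_mul hf
        ((natDegree_C_mul_le _ _).trans natDegree_X_le)).trans_eq ?_)
      rw [mul_one]
    have h1 : (C (c x) * (X ^ ψ x * ∏ j, g (some j) ^ (φ x j : ℕ))).natDegree < k * t := by
      refine (natDegree_C_mul_le _ _).trans_lt (natDegree_mul_le.trans_lt ?_)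
      rw [natDegree_X_pow]
      have h2 : (∏ j, g (some j) ^ (φ x j : ℕ)).natDegree ≤ ∑ j, (φ x j : ℕ) * k :=
        (natDegree_prod_le _ _).trans (Finset.sum_le_sum fun j _ =>
          natDegree_pow_le.trans (Nat.mul_le_mul_left _ (hg j)))
      rw [← Finset.sum_mul] at h2
      have h3 := hI x
      have h4 := x.1.2
      simp only [ψ, φ] at h2 ⊢
      nlinarith
    exact degree_le_natDegree.trans_lt (Nat.cast_lt.2 h1)

/-- A generator `γ` of the multiplicative group has a root `β` of order `q - 1` in the algebraic
closure; then `β ^ q = γ β`, and `f(γ ^ j β) = f(β) ^ (q ^ j)` for `f` with coefficients in `F`. -/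
theorem exists_frobenius_root [Fintype F] {q : ℕ} (hq : Fintype.card F = q) (γ : F) (hγ : γ ≠ 0) :
    ∃ β : AlgebraicClosure F, β ≠ 0 ∧ ∀ (f : F[X]) (j : ℕ),
      aeval (algebraMap F _ γ ^ j * β) f = aeval β f ^ q ^ j := by
  have hq2 : 1 < q := hq ▸ Fintype.one_lt_card
  obtain ⟨β, hβ⟩ := IsAlgClosed.exists_pow_nat_eq (algebraMap F (AlgebraicClosure F) γ)
    (n := q - 1) (by omega)
  have hβ0 : β ≠ 0 := by
    rintro rfl
    rw [zero_pow (by omega)] at hβ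
    exact hγ ((map_eq_zero _).1 hβ.symm)
  refine ⟨β, hβ0, fun f j => ?_⟩
  have hstep (y : AlgebraicClosure F) : aeval (y ^ q) f = aeval y f ^ q := by
    rw [← expand_aeval, ← hq, FiniteField.expand_card, map_pow]
  have hβq : β ^ q = algebraMap F _ γ * β := by
    rw [← hβ, ← pow_succ, Nat.sub_add_cancel (by omega)]
  have hγq : algebraMap F (AlgebraicClosure F) γ ^ q = algebraMap F _ γ := by
    rw [← map_pow, ← hq, FiniteField.pow_card]
  induction j with
  | zero => simp
  | succ j ih =>
    have h : algebraMap F (AlgebraicClosure F) γ ^ (j + 1) * β =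
        (algebraMap F _ γ ^ j * β) ^ q := by
      rw [mul_pow, hβq, ← pow_mul, mul_comm j, pow_mul, hγq]
      ring
    rw [h, hstep, ih, ← pow_mul, ← pow_succ]

/-- A non-zero relation with exponents below `q` has at most `q ^ s` solutions: with `β` as in
`exists_frobenius_root`, it says that `f(β)` is a root of a polynomial of degree less than `q ^ s`,
and `f` is determined by `f(β)` as its degree is less than `q - 1`. -/
theorem card_solutions_le [Fintype F] {q : ℕ} (hq : Fintype.card F = q) {γ : Fˣ}
    (hγ : ∀ x : Fˣ, x ∈ Subgroup.zpowers γ) {s k : ℕ} (hk : k + 1 < q)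
    {A : (Fin s → Fin q) → F[X]} (hA : A ≠ 0) {L : Finset F[X]}
    (hdeg : ∀ f ∈ L, f.natDegree ≤ k)
    (hL : ∀ f ∈ L, ∑ b, A b * ∏ j, shifts (γ : F) s f (some j) ^ (b j : ℕ) = 0) :
    L.card ≤ q ^ s := by
  classical
  obtain ⟨β, hβ0, hβ⟩ := exists_frobenius_root hq (γ : F) γ.ne_zero
  -- divide the coefficients by their greatest common divisor
  obtain ⟨b₀, hb₀⟩ := Function.ne_iff.1 hA
  obtain ⟨G, hG⟩ := IsPrincipalIdealRing.principal (Ideal.span (Set.range A))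
  have hdvd (b) : G ∣ A b := by
    rw [← Ideal.mem_span_singleton]
    change A b ∈ Submodule.span _ _
    rw [← hG]
    exact Ideal.subset_span ⟨b, rfl⟩
  choose a ha using hdvd
  have hG0 : G ≠ 0 := by
    rintro rfl
    exact hb₀ (by simpa using ha b₀)
  obtain ⟨w, hw⟩ : ∃ w : (Fin s → Fin q) → F[X], ∑ b, w b * A b = G := by
    have h1 : G ∈ Ideal.span (Set.range A) := by
      rw [hG]
      exact Submodule.mem_span_singleton_self G
    exact (Ideal.mem_span_range_iff_exists_fun).1 h1
  have hone : ∑ b, w b * a b = 1 := by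
    refine mul_left_cancel₀ hG0 ?_
    rw [mul_one, Finset.mul_sum]
    refine Eq.trans (Finset.sum_congr rfl fun b _ => ?_) hw
    rw [ha b]
    ring
  -- the relation at `β` becomes a polynomial equation for `f(β)`; the exponents `∑ j, b j * q ^ j`
  -- are distinct since `b j < q`
  let T : (AlgebraicClosure F)[X] := ∑ b, C (aeval β (a b)) * X ^ (finFunctionFinEquiv b : ℕ)
  have hcoeff (b) : T.coeff (finFunctionFinEquiv b : ℕ) = aeval β (a b) := by
    simp only [T, finsetSum_coeff, coeff_C_mul_X_pow]
    rw [Finset.sum_eq_single b]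
    · simp
    · intro b' _ hne
      rw [if_neg]
      exact fun h => hne (finFunctionFinEquiv.injective (Fin.ext h)).symm
    · simp
  have hT0 : T ≠ 0 := by
    intro h
    have h1 := congrArg (aeval β) hone
    rw [map_sum, map_one, Finset.sum_eq_zero fun b _ => ?_] at h1
    · exact zero_ne_one h1
    · rw [map_mul, ← hcoeff, h, coeff_zero, mul_zero]
  have hTdeg : T.natDegree ≤ q ^ s :=
    natDegree_sum_le_of_forall_le _ _ fun b _ =>
      (natDegree_C_mul_X_pow_le _ _).trans (finFunctionFinEquiv b).2.le
  have hroot : ∀ f ∈ L, T.IsRoot (aeval β f) := by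
    intro f hf
    have h1 : ∑ b, a b * ∏ j, shifts (γ : F) s f (some j) ^ (b j : ℕ) = 0 := by
      refine (mul_eq_zero.1 ?_).resolve_left hG0
      rw [Finset.mul_sum, ← hL f hf]
      refine Finset.sum_congr rfl fun b _ => ?_
      rw [← mul_assoc, ← ha b]
    have h2 := congrArg (aeval β) h1
    rw [map_sum, map_zero] at h2
    simp only [T, IsRoot, eval_finsetSum, eval_mul, eval_C, eval_pow, eval_X]
    rw [← h2]
    refine Finset.sum_congr rfl fun b _ => ?_
    rw [map_mul, map_prod, finFunctionFinEquiv_apply, ← Finset.prod_pow_eq_pow_sum]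
    congr 1
    refine Finset.prod_congr rfl fun j _ => ?_
    rw [map_pow, shifts, aeval_comp]
    simp only [map_mul, aeval_C, aeval_X, map_pow]
    rw [hβ, ← pow_mul, mul_comm]
  -- a polynomial that vanishes at `β` vanishes at the `q - 1` elements `γ ^ j β`
  have hinj : Set.InjOn (fun f : F[X] => aeval β f) L := by
    intro f hf f' hf' h
    rw [← sub_eq_zero] at h ⊢
    simp only at h
    rw [← map_sub] at h
    by_contra hne
    have hdeg' : (f - f').natDegree ≤ k :=
      (natDegree_sub_le _ _).trans (max_le (hdeg f hf) (hdeg f' hf'))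
    have hord := Code.orderOf_generator hγ (N := q - 1) (by omega)
    let Z : Finset (AlgebraicClosure F) :=
      (Finset.range (q - 1)).image fun j => algebraMap F _ (γ : F) ^ j * β
    have hZ : Z.card = q - 1 := by
      rw [Finset.card_image_of_injOn, Finset.card_range]
      intro i hi j hj hij
      have h1 := mul_right_cancel₀ hβ0 hij
      rw [← map_pow, ← map_pow] at h1
      have h2 : γ ^ i = γ ^ j := Units.ext (by
        simpa using (algebraMap F (AlgebraicClosure F)).injective h1)
      rw [pow_eq_pow_iff_modEq, hord] at h2
      exact h2.eq_of_lt_of_lt (Finset.mem_range.1 hi) (Finset.mem_range.1 hj)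
    have hmap : (f - f').map (algebraMap F (AlgebraicClosure F)) ≠ 0 :=
      (Polynomial.map_ne_zero_iff (algebraMap F _).injective).2 hne
    have hle : Z.card ≤ ((f - f').map (algebraMap F (AlgebraicClosure F))).natDegree := by
      refine card_le_degree_of_subset_roots fun y hy => ?_
      obtain ⟨j, _, rfl⟩ := Finset.mem_image.1 (show y ∈ Z from hy)
      rw [mem_roots hmap, IsRoot, eval_map_algebraMap, hβ, h, zero_pow]
      exact pow_ne_zero _ (by omega)
    rw [natDegree_map] at hle
    omega
  rw [← Finset.card_image_of_injOn hinj]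
  refine le_trans (card_le_degree_of_subset_roots fun y hy => ?_) hTdeg
  obtain ⟨f, hf, rfl⟩ := Finset.mem_image.1 (show y ∈ L.image fun f : F[X] => aeval β f from hy)
  exact (mem_roots hT0).2 (hroot f hf)

end Interpolation

/-! ### Codewords and their weights -/

namespace Code

open Polynomial

variable {F : Type*} [Field F]

/-- The word of values of a polynomial at `γ, γ ^ 2, …, γ ^ (n * m)`, in blocks of length `m`. -/
noncomputable def word (γ : F) (n m : ℕ) (f : F[X]) : Fin n → Fin m → F :=
  fun i j => f.eval (γ ^ ((i : ℕ) * m + j + 1))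

theorem word_sub (γ : F) (n m : ℕ) (f g : F[X]) :
    word γ n m (f - g) = word γ n m f - word γ n m g := by
  funext i j
  simp [word]

theorem coe_folded_reedSolomon (γ : F) (n m k : ℕ) :
    (folded (reedSolomon γ (n * m) k) : Set (Fin n → Fin m → F)) =
      word γ n m '' (degreeLT F (k + 1) : Set F[X]) := by
  have h1 (f : F[X]) : foldEquiv F n m ((LinearMap.pi fun i : Fin (n * m) =>
      leval (γ ^ ((i : ℕ) + 1))) f) = word γ n m f := by
    funext i j
    rw [foldEquiv_apply, word, LinearMap.pi_apply, finProdFinEquiv_apply_val]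
    simp only [leval_apply]
    congr 2
    ring
  have h2 (f : F[X]) : f.degree ≤ k ↔ f.degree < (k + 1 : ℕ) := by
    simp only [degree_le_iff_coeff_zero, degree_lt_iff_coeff_zero, Nat.cast_lt, Nat.succ_le_iff]
  ext x
  simp only [folded, reedSolomon, Submodule.map_coe, Set.mem_image, SetLike.mem_coe, mem_degreeLE,
    mem_degreeLT, exists_exists_and_eq_and, LinearEquiv.coe_coe, h1, h2]

theorem index_injective {n m : ℕ} {i i' : Fin n} {j j' : Fin m}
    (h : (i : ℕ) * m + j = (i' : ℕ) * m + j') : i = i' ∧ j = j' := by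
  have h1 : finProdFinEquiv (i, j) = finProdFinEquiv (i', j') := by
    refine Fin.ext ?_
    rw [finProdFinEquiv_apply_val, finProdFinEquiv_apply_val]
    simp only
    rw [add_comm, mul_comm m, h]
    ring
  exact Prod.ext_iff.1 (finProdFinEquiv.injective h1)

theorem index_le {n m : ℕ} (i : Fin n) (j : Fin m) : (i : ℕ) * m + j + 1 ≤ n * m := by
  have h1 : ((i : ℕ) + 1) * m ≤ n * m := Nat.mul_le_mul_right _ i.2
  have h2 := j.2
  nlinarith

section Finite

variable [Fintype F] {γ : Fˣ} {n m k : ℕ}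

theorem evaluationPoint_injective (hγ : ∀ x : Fˣ, x ∈ Subgroup.zpowers γ)
    (hN : Fintype.card F = n * m + 1) :
    Function.Injective fun p : Fin n × Fin m => (γ : F) ^ ((p.1 : ℕ) * m + p.2 + 1) := by
  intro p p' h
  have h1 := pow_injOn hγ hN (by omega) (index_le p.1 p.2) (by omega) (index_le p'.1 p'.2) h
  obtain ⟨h2, h3⟩ := index_injective (i := p.1) (i' := p'.1) (j := p.2) (j' := p'.2) (by omega)
  exact Prod.ext h2 h3

theorem word_eq_zero_iff (hγ : ∀ x : Fˣ, x ∈ Subgroup.zpowers γ)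
    (hN : Fintype.card F = n * m + 1) {f : F[X]} (hf : f.degree < (n * m : ℕ)) :
    word (γ : F) n m f = 0 ↔ f = 0 := by
  classical
  refine ⟨fun h => ?_, fun h => by subst h; funext i j; simp [word]⟩
  refine eq_zero_of_degree_lt_of_eval_finset_eq_zero
    (Finset.univ.image fun p : Fin n × Fin m => (γ : F) ^ ((p.1 : ℕ) * m + p.2 + 1)) ?_ ?_
  · rw [Finset.card_image_of_injective _ (evaluationPoint_injective hγ hN)]
    simpa using hf
  · intro x hx
    obtain ⟨p, _, rfl⟩ := Finset.mem_image.1 hx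
    exact congrFun (congrFun h p.1) p.2

theorem ncard_degreeLT (n : ℕ) :
    (degreeLT F n : Set F[X]).ncard = Fintype.card F ^ n := by
  rw [← Nat.card_coe_set_eq, ← Nat.card_eq_fintype_card (α := F)]
  refine (Nat.card_congr (degreeLTEquiv F n).toEquiv).trans ?_
  rw [Nat.card_fun, Nat.card_fin]

theorem finite_degreeLT (n : ℕ) : (degreeLT F n : Set F[X]).Finite :=
  Set.finite_coe_iff.1 (Finite.of_equiv _ (degreeLTEquiv F n).toEquiv.symm)

theorem ncard_folded_reedSolomon (hγ : ∀ x : Fˣ, x ∈ Subgroup.zpowers γ)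
    (hN : Fintype.card F = n * m + 1) (hk : k < n * m) :
    (folded (reedSolomon (γ : F) (n * m) k) : Set (Fin n → Fin m → F)).ncard =
      Fintype.card F ^ (k + 1) := by
  rw [coe_folded_reedSolomon, Set.InjOn.ncard_image, ncard_degreeLT]
  intro f hf g hg h
  rw [← sub_eq_zero, ← word_sub] at h
  have hdeg : (f - g).degree < (k + 1 : ℕ) := mem_degreeLT.1 (Submodule.sub_mem _ hf hg)
  exact sub_eq_zero.1 ((word_eq_zero_iff hγ hN (hdeg.trans_le (by exact_mod_cast hk))).1 h)

/-- The codewords vanishing on `j` given blocks are given by the multiples of a polynomial of degree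
`j * m`. -/
theorem vanishing_subset (hγ : ∀ x : Fˣ, x ∈ Subgroup.zpowers γ)
    (hN : Fintype.card F = n * m + 1) (J : Finset (Fin n)) :
    ∃ E : F[X], {x ∈ (folded (reedSolomon (γ : F) (n * m) k) : Set (Fin n → Fin m → F)) |
      ∀ i ∈ J, x i = 0} ⊆
        (fun h => word (γ : F) n m (E * h)) '' (degreeLT F (k + 1 - J.card * m) : Set F[X]) := by
  classical
  let E : F[X] := ∏ p ∈ J ×ˢ (Finset.univ : Finset (Fin m)),
    (X - C ((γ : F) ^ ((p.1 : ℕ) * m + p.2 + 1)))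
  have hE : E.Monic := monic_prod_of_monic _ _ fun p _ => monic_X_sub_C _
  have hEdeg : E.natDegree = J.card * m := by
    rw [natDegree_prod_of_monic _ _ fun p _ => monic_X_sub_C _,
      Finset.sum_congr rfl fun p _ => natDegree_X_sub_C _]
    simp
  refine ⟨E, fun x hx => ?_⟩
  obtain ⟨hx, hJ⟩ := hx
  rw [coe_folded_reedSolomon] at hx
  obtain ⟨f, hf, rfl⟩ := hx
  have hdvd : E ∣ f := by
    refine Finset.prod_dvd_of_coprime (fun p _ p' _ hne => ?_) fun p hp => ?_
    · exact pairwise_coprime_X_sub_C (evaluationPoint_injective hγ hN) hne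
    · exact dvd_iff_isRoot.2 (congrFun (hJ p.1 (Finset.mem_product.1 hp).1) p.2)
  obtain ⟨h, rfl⟩ := hdvd
  refine ⟨h, ?_, rfl⟩
  rcases eq_or_ne h 0 with rfl | h0
  · exact Submodule.zero_mem _
  have h1 := mem_degreeLT.1 hf
  rw [hE.degree_mul_comm, hE.degree_mul, degree_eq_natDegree h0,
    degree_eq_natDegree hE.ne_zero, hEdeg] at h1
  refine mem_degreeLT.2 ?_
  rw [degree_eq_natDegree h0]
  norm_cast at h1 ⊢
  omega

/-- A union bound over the set of zero blocks. -/
theorem weightProb_le (hγ : ∀ x : Fˣ, x ∈ Subgroup.zpowers γ)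
    (hN : Fintype.card F = n * m + 1) (hk : k < n * m) {j : ℕ} (hj : j < n) :
    weightProb (folded (reedSolomon (γ : F) (n * m) k) : Set (Fin n → Fin m → F)) (n - j) ≤
      ((n : ℝ) / Nat.card (Fin m → F)) ^ j := by
  classical
  set C := (folded (reedSolomon (γ : F) (n * m) k) : Set (Fin n → Fin m → F)) with hC
  set q := Fintype.card F with hq
  have hq0 : 0 < q := by omega
  have hbound (J : Finset (Fin n)) :
      {x ∈ C | ∀ i ∈ J, x i = 0}.ncard ≤ q ^ (k + 1 - J.card * m) := by
    obtain ⟨E, hE⟩ := vanishing_subset (k := k) hγ hN J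
    refine (Set.ncard_le_ncard hE (Set.toFinite _)).trans ?_
    exact (Set.ncard_image_le (finite_degreeLT _)).trans_eq (ncard_degreeLT _)
  have hzero {x : Fin n → Fin m → F} (hx : hammingNorm x = n - j) :
      (Finset.univ.filter fun i => x i = 0).card = j := by
    have h1 := Finset.card_filter_add_card_filter_not (s := (Finset.univ : Finset (Fin n)))
      (fun i => x i = 0)
    rw [Finset.card_univ, Fintype.card_fin] at h1
    have h2 : hammingNorm x = (Finset.univ.filter fun i => ¬ x i = 0).card := rfl
    omega
  have hcard : Nat.card (Fin m → F) = q ^ m := by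
    rw [Nat.card_fun, Nat.card_fin, Nat.card_eq_fintype_card]
  rw [weightProb, ncard_folded_reedSolomon hγ hN hk, hcard, ← hq]
  rcases le_or_gt (j * m) (k + 1) with hjm | hjm
  · have hsub : {x ∈ C | hammingNorm x = n - j} ⊆
        ⋃ J ∈ Finset.powersetCard j (Finset.univ : Finset (Fin n)), {x ∈ C | ∀ i ∈ J, x i = 0} := by
      intro x hx
      simp only [Set.mem_iUnion]
      refine ⟨Finset.univ.filter fun i => x i = 0, Finset.mem_powersetCard.2
        ⟨Finset.subset_univ _, hzero ?_⟩, hx.1, fun i hi => (Finset.mem_filter.1 hi).2⟩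
      convert hx.2
    have h1 : {x ∈ C | hammingNorm x = n - j}.ncard ≤ n ^ j * q ^ (k + 1 - j * m) := by
      refine (Set.ncard_le_ncard hsub (Set.toFinite _)).trans ?_
      refine (Finset.set_ncard_biUnion_le _ _).trans ?_
      refine (Finset.sum_le_card_nsmul _ _ (q ^ (k + 1 - j * m)) fun J hJ => ?_).trans ?_
      · rw [← (Finset.mem_powersetCard.1 hJ).2]
        exact hbound J
      · rw [Finset.card_powersetCard, Finset.card_univ, Fintype.card_fin, smul_eq_mul]
        exact Nat.mul_le_mul_right _ (Nat.choose_le_pow _ _)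
    have h2 : (0 : ℝ) < q := by exact_mod_cast hq0
    push_cast
    rw [div_pow, ← pow_mul, mul_comm m, div_le_div_iff₀ (by positivity) (by positivity)]
    calc _ ≤ ((n ^ j * q ^ (k + 1 - j * m) : ℕ) : ℝ) * q ^ (j * m) := by
          refine mul_le_mul_of_nonneg_right (Nat.cast_le.2 (le_of_eq_of_le ?_ h1)) (by positivity)
          congr!
      _ = n ^ j * q ^ (k + 1) := by
        push_cast
        rw [mul_assoc, ← pow_add, Nat.sub_add_cancel hjm]
  · have hempty : {x ∈ C | hammingNorm x = n - j} = ∅ := by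
      refine Set.eq_empty_iff_forall_notMem.2 fun x hx => ?_
      have hx2 : hammingNorm x = n - j := hx.2
      obtain ⟨E, hE⟩ := vanishing_subset (k := k) hγ hN (Finset.univ.filter fun i => x i = 0)
      obtain ⟨h, hh, rfl⟩ := hE (show x ∈ _ from
        ⟨hx.1, fun i hi => (Finset.mem_filter.1 hi).2⟩)
      have h0 := mem_degreeLT.1 hh
      rw [hzero hx2, Nat.sub_eq_zero_of_le hjm.le] at h0
      have h1 : h = 0 := by
        by_contra hne
        rw [degree_eq_natDegree hne] at h0
        norm_cast at h0
      have h2 : word (γ : F) n m (E * h) = 0 := by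
        rw [h1, mul_zero]
        funext i j
        simp [word]
      simp only at hx2
      rw [h2, hammingNorm_zero] at hx2
      omega
    have : {x ∈ C | hammingNorm x = n - j}.ncard = 0 := by rw [hempty, Set.ncard_empty]
    refine le_of_eq_of_le (b := (0 : ℝ)) ?_ (by positivity)
    rw [div_eq_zero_iff]
    left
    exact_mod_cast (by convert this)

end Finite

end Code

/-! ### List recovery of folded Reed–Solomon codes -/

namespace Code

open Polynomial Interpolation

variable {F : Type*} [Field F] [Fintype F] {γ : Fˣ} {n m k : ℕ}

/-- The interpolation points `(α, y j, …, y (j + s - 1))`, where `α` is the evaluation point of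
position `j` in block `i`, and `y` is in the input list of that block. -/
theorem exists_points (γ : F) {s w ℓ : ℕ} (hsw : s + w ≤ m + 1) (S : Fin n → Set (Fin m → F))
    (hS : ∀ i, (S i).ncard ≤ ℓ) :
    ∃ P : Finset (Option (Fin s) → F), P.card ≤ n * w * ℓ ∧
      ∀ f : F[X], ∀ i, word γ n m f i ∈ S i → ∀ j : Fin w,
        (fun o => (shifts γ s f o).eval (γ ^ ((i : ℕ) * m + j + 1))) ∈ P := by
  classical
  have hidx (j : Fin w) (a : Fin s) : (j : ℕ) + a < m := by
    have := j.2
    have := a.2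
    omega
  let pt (p : Fin n × Fin w) (y : Fin m → F) : Option (Fin s) → F := fun o =>
    o.elim (γ ^ ((p.1 : ℕ) * m + p.2 + 1)) fun a => y ⟨(p.2 : ℕ) + a, hidx p.2 a⟩
  refine ⟨Finset.univ.biUnion fun p : Fin n × Fin w =>
    (Set.toFinite (S p.1)).toFinset.image (pt p), ?_, fun f i hi j => ?_⟩
  · refine (Finset.card_biUnion_le_card_mul _ _ ℓ fun p _ => ?_).trans_eq (by simp)
    refine Finset.card_image_le.trans ?_
    rw [← Set.ncard_eq_toFinset_card]
    exact hS p.1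
  · refine Finset.mem_biUnion.2 ⟨(i, j), Finset.mem_univ _, Finset.mem_image.2
      ⟨word γ n m f i, by simpa using hi, ?_⟩⟩
    funext o
    cases o with
    | none => simp [pt, shifts]
    | some a =>
      simp only [pt, shifts, word, Option.elim, eval_comp, eval_mul, eval_C, eval_X, ← pow_add]
      congr 2
      ring

/-- List recovery by interpolation: a codeword in the list satisfies a relation with at most `q ^ s`
solutions. -/
theorem ncard_list_le (hγ : ∀ x : Fˣ, x ∈ Subgroup.zpowers γ) (hN : Fintype.card F = n * m + 1)
    (hk : k < n * m) {s w ℓ r t a : ℕ} (hs : 0 < s) (hsw : s + w ≤ m + 1) (ht : t ≤ n * m + 1)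
    (hcount : n * w * ℓ * (lowExponents (Option (Fin s)) r).card <
      k * (lowExponents (Option (Fin s)) t).card)
    (hagree : k * t ≤ a * w * r) (S : Fin n → Set (Fin m → F)) (hS : ∀ i, (S i).ncard ≤ ℓ) :
    {x ∈ (folded (reedSolomon (γ : F) (n * m) k) : Set (Fin n → Fin m → F)) |
      a ≤ {i | x i ∈ S i}.ncard}.ncard ≤ (n * m + 1) ^ s := by
  classical
  obtain ⟨P, hP, hPf⟩ := exists_points (γ : F) hsw S hS
  obtain ⟨A, hA, hAf⟩ := exists_relation (k := k) (r := r) (γ : F) ht P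
    ((Nat.mul_le_mul_right _ hP).trans_lt hcount)
  rw [coe_folded_reedSolomon]
  set B := {x ∈ word (γ : F) n m '' (degreeLT F (k + 1) : Set F[X]) |
    a ≤ {i | x i ∈ S i}.ncard} with hB
  have hmem : ∀ x : Fin n → Fin m → F, x ∈ B →
      ∃ f : F[X], f.natDegree ≤ k ∧ word (γ : F) n m f = x := by
    rintro x ⟨⟨f, hf, rfl⟩, _⟩
    exact ⟨f, natDegree_le_iff_coeff_eq_zero.2
      ((degree_lt_iff_coeff_zero _ _).1 (mem_degreeLT.1 hf)), rfl⟩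
  choose! f hfdeg hfx using hmem
  have hBfin : B.Finite := Set.toFinite _
  rw [Set.ncard_eq_toFinset_card B hBfin]
  have hinj : Set.InjOn f hBfin.toFinset := by
    intro x hx y hy hxy
    rw [← hfx x (hBfin.mem_toFinset.1 hx), ← hfx y (hBfin.mem_toFinset.1 hy), hxy]
  rw [← Finset.card_image_of_injOn hinj]
  refine card_solutions_le hN hγ (k := k) (by omega) hA (fun g hg => ?_) fun g hg => ?_
  · obtain ⟨x, hx, rfl⟩ := Finset.mem_image.1 hg
    exact hfdeg x (hBfin.mem_toFinset.1 hx)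
  · obtain ⟨x, hx, rfl⟩ := Finset.mem_image.1 hg
    have hx := hBfin.mem_toFinset.1 hx
    let I : Finset (Fin n) := Finset.univ.filter fun i => x i ∈ S i
    have hI : a ≤ I.card := by
      have h1 := hx.2
      rw [Set.ncard_eq_toFinset_card'] at h1
      simpa [I] using h1
    let Z : Finset F := (I ×ˢ (Finset.univ : Finset (Fin w))).image fun p =>
      (γ : F) ^ ((p.1 : ℕ) * m + p.2 + 1)
    have hZ : Z.card = I.card * w := by
      rw [Finset.card_image_of_injective, Finset.card_product, Finset.card_univ, Fintype.card_fin]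
      intro p p' h
      have hwm (j : Fin w) : (j : ℕ) < m := by
        have := j.2
        omega
      have h1 := @evaluationPoint_injective F _ _ γ n m hγ hN (p.1, ⟨p.2, hwm p.2⟩)
        (p'.1, ⟨p'.2, hwm p'.2⟩) h
      simp only [Prod.mk.injEq, Fin.mk.injEq] at h1
      exact Prod.ext h1.1 (Fin.ext h1.2)
    refine hAf (f x) (hfdeg x hx) Z (fun α hα => ?_) ?_
    · obtain ⟨p, hp, rfl⟩ := Finset.mem_image.1 hα
      refine hPf (f x) p.1 ?_ p.2
      rw [hfx x hx]
      exact (Finset.mem_filter.1 (Finset.mem_product.1 hp).1).2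
    · rw [hZ]
      exact hagree.trans (Nat.mul_le_mul_right _ (Nat.mul_le_mul_right _ hI))

/-- The ratio of the numbers of monomials of degree below `51 u` and below `50 u` is exponential in
`u`: each of the factors of the quotient of rising factorials is at least `101 / 100`. -/
theorem pow_mul_card_lowExponents_le (u : ℕ) :
    101 ^ (50 * u + 1) * (lowExponents (Option (Fin (50 * u))) (50 * u)).card ≤
      100 ^ (50 * u + 1) * (lowExponents (Option (Fin (50 * u))) (51 * u)).card := by
  have h1 := factorial_mul_card_lowExponents (σ := Option (Fin (50 * u))) (50 * u)
  have h2 := factorial_mul_card_lowExponents (σ := Option (Fin (50 * u))) (51 * u)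
  rw [Fintype.card_option, Fintype.card_fin, Nat.ascFactorial_eq_prod_range] at h1 h2
  refine Nat.le_of_mul_le_mul_left ?_ (Nat.factorial_pos (50 * u + 1))
  rw [mul_left_comm, h1, mul_left_comm, h2]
  have h3 (c : ℕ) : c ^ (50 * u + 1) = ∏ _i ∈ Finset.range (50 * u + 1), c := by simp
  rw [h3, h3, ← Finset.prod_mul_distrib, ← Finset.prod_mul_distrib]
  refine Finset.prod_le_prod' fun i hi => ?_
  have := Finset.mem_range.1 hi
  omega

theorem card_lowExponents_pos (σ : Type*) [Finite σ] {t : ℕ} (ht : 0 < t) :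
    0 < (lowExponents σ t).card :=
  Finset.card_pos.2 ⟨0, mem_lowExponents.2 (by simpa using ht)⟩

/-- The list size for windows of length `50 u` and multiplicity `50 u`, and relations of degree less
than `51 u`.  The agreement suffices as `51 / 50 * (19 / 20) < (99 / 100) ^ 2`: the factors on the
right are the fraction of blocks with agreement and that of positions of a block at which a window
starts. -/
theorem ncard_list_le_pow (hγ : ∀ x : Fˣ, x ∈ Subgroup.zpowers γ)
    (hN : Fintype.card F = n * m + 1) (hk : k < n * m) (hk19 : 20 * k ≤ 19 * (n * m))
    (hk2 : n * m ≤ 2 * k) {u ℓ a : ℕ} (hu : 0 < u) (hum : 5000 * u ≤ m)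
    (hℓ : 2 * ℓ * 100 ^ (50 * u + 1) < 101 ^ (50 * u + 1)) (ha : 99 * n ≤ 100 * a)
    (S : Fin n → Set (Fin m → F)) (hS : ∀ i, (S i).ncard ≤ ℓ) :
    {x ∈ (folded (reedSolomon (γ : F) (n * m) k) : Set (Fin n → Fin m → F)) |
      a ≤ {i | x i ∈ S i}.ncard}.ncard ≤ (n * m + 1) ^ (50 * u) := by
  have hn : 0 < n := Nat.pos_of_mul_pos_right (by omega : 0 < n * m)
  obtain ⟨w, hw⟩ : ∃ w, 50 * u + w = m + 1 := ⟨m + 1 - 50 * u, by omega⟩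
  refine ncard_list_le hγ hN hk (r := 50 * u) (t := 51 * u) (by omega) hw.le ?_ ?_ ?_ S hS
  · nlinarith
  · have h1 := pow_mul_card_lowExponents_le u
    have h2 := card_lowExponents_pos (Option (Fin (50 * u))) (t := 50 * u) (by omega)
    set T := (lowExponents (Option (Fin (50 * u))) (50 * u)).card
    set T' := (lowExponents (Option (Fin (50 * u))) (51 * u)).card
    have h3 : 0 < 100 ^ (50 * u + 1) := by positivity
    have h4 : 0 < k * T := Nat.mul_pos (by omega) h2
    refine Nat.lt_of_mul_lt_mul_left (a := 100 ^ (50 * u + 1)) ?_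
    calc 100 ^ (50 * u + 1) * (n * w * ℓ * T)
        ≤ 100 ^ (50 * u + 1) * (2 * k * ℓ * T) := by
          refine Nat.mul_le_mul_left _ (Nat.mul_le_mul_right _ (Nat.mul_le_mul_right _ ?_))
          exact (Nat.mul_le_mul_left _ (by omega)).trans hk2
      _ = (k * T) * (2 * ℓ * 100 ^ (50 * u + 1)) := by ring
      _ < (k * T) * 101 ^ (50 * u + 1) := Nat.mul_lt_mul_of_pos_left hℓ h4
      _ = k * (101 ^ (50 * u + 1) * T) := by ring
      _ ≤ k * (100 ^ (50 * u + 1) * T') := Nat.mul_le_mul_left _ h1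
      _ = _ := by ring
  · have h1 : 99 * m ≤ 100 * w := by omega
    have h2 : 99 * n * (99 * m) ≤ 100 * a * (100 * w) := Nat.mul_le_mul ha h1
    have h3 : 51 * k ≤ 50 * (a * w) := by nlinarith
    calc k * (51 * u) = 51 * k * u := by ring
      _ ≤ 50 * (a * w) * u := Nat.mul_le_mul_right _ h3
      _ = _ := by ring

/-- List recoverability for input lists of a size `ℓ` that is exponential in `u`; here
`(101 / 100) ^ 50` is replaced by its lower bound `3 / 2`. -/
theorem listRecoverable_pow (hγ : ∀ x : Fˣ, x ∈ Subgroup.zpowers γ)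
    (hN : Fintype.card F = n * m + 1) (hk : k < n * m) (hk19 : 20 * k ≤ 19 * (n * m))
    (hk2 : n * m ≤ 2 * k) {u : ℕ} {ℓ : ℝ} (hℓ0 : 0 ≤ ℓ) (hu : 0 < u) (hum : 5000 * u ≤ m)
    (hℓ : 2 * ℓ < (3 / 2) ^ u) :
    ListRecoverable (folded (reedSolomon (γ : F) (n * m) k) : Set (Fin n → Fin m → F))
      (1 / 100) ℓ ((n * m + 1) ^ (50 * u)) := by
  intro S hS
  have h1 : 2 * ⌊ℓ⌋₊ * 100 ^ (50 * u + 1) < 101 ^ (50 * u + 1) := by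
    have h2 : (2 * ⌊ℓ⌋₊ : ℝ) < (101 / 100) ^ (50 * u + 1) := by
      calc (2 * ⌊ℓ⌋₊ : ℝ) ≤ 2 * ℓ := by have := Nat.floor_le hℓ0; linarith
        _ < (3 / 2) ^ u := hℓ
        _ ≤ ((101 / 100) ^ 50) ^ u := pow_le_pow_left₀ (by norm_num) (by norm_num) _
        _ = (101 / 100) ^ (50 * u) := (pow_mul _ _ _).symm
        _ ≤ _ := pow_le_pow_right₀ (by norm_num) (by omega)
    rw [div_pow, lt_div_iff₀ (by positivity)] at h2
    exact_mod_cast h2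
  have h2 := ncard_list_le_pow hγ hN hk hk19 hk2 hu hum (ℓ := ⌊ℓ⌋₊) (a := (99 * n + 99) / 100) h1
    (by omega) S (fun i => Nat.le_floor (hS i))
  have h3 : {x ∈ (folded (reedSolomon (γ : F) (n * m) k) : Set (Fin n → Fin m → F)) |
      (1 - 1 / 100 : ℝ) * n ≤ ({i | x i ∈ S i}.ncard : ℝ)} ⊆
      {x ∈ (folded (reedSolomon (γ : F) (n * m) k) : Set (Fin n → Fin m → F)) |
      (99 * n + 99) / 100 ≤ {i | x i ∈ S i}.ncard} := by
    intro x hx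
    refine ⟨hx.1, ?_⟩
    have h4 : (99 * n : ℝ) ≤ 100 * {i | x i ∈ S i}.ncard := by have := hx.2; linarith
    have h5 : 99 * n ≤ 100 * {i | x i ∈ S i}.ncard := by exact_mod_cast h4
    omega
  have h6 := (Set.ncard_le_ncard h3 (Set.toFinite _)).trans h2
  exact_mod_cast h6

end Code

/-! ### The parameters of the family -/

namespace Code

/-- Every code is list recoverable with lists as large as the space of all words. -/
theorem listRecoverable_card {F : Type*} [Finite F] {n m q : ℕ} (hq : Nat.card F = q)
    (C : Set (Fin n → Fin m → F)) (ζ ℓ : ℝ) : ListRecoverable C ζ ℓ ((q : ℝ) ^ (n * m)) := by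
  intro S _
  have h1 : Nat.card (Fin n → Fin m → F) = q ^ (n * m) := by
    rw [Nat.card_fun, Nat.card_fun, Nat.card_fin, Nat.card_fin, hq, ← pow_mul, mul_comm m]
  have h2 := Set.ncard_le_card {x ∈ C | (1 - ζ) * n ≤ ({i | x i ∈ S i}.ncard : ℝ)}
  rw [h1] at h2
  exact_mod_cast h2

end Code

namespace FRSFamily

theorem deg_lt (lam : ℕ) : degreeBound lam < (chr lam - 1) * (chr lam + 1) := (code lam).k_lt

theorem length_bounds (lam : ℕ) :
    100 * (chr lam - 1) + 100 * lam ≤ (chr lam - 1) * (chr lam + 1) := by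
  have h := (chr_spec lam).2.1
  obtain ⟨p, hp⟩ : ∃ p, chr lam = p + 1 := ⟨chr lam - 1, by omega⟩
  rw [hp, Nat.add_sub_cancel]
  nlinarith

theorem weightProb_code_le (lam j : ℕ) (hj : j ∈ Finset.Icc 1 ((code lam).n - 1)) :
    Code.weightProb ((code lam).code : Set (code lam).Word) ((code lam).n - j) ≤
      (((code lam).n : ℝ) / Nat.card (code lam).Alphabet) ^ j := by
  have h1 : j ≤ chr lam - 1 - 1 := (Finset.mem_Icc.1 hj).2
  have h2 := (chr_spec lam).2.1
  exact Code.weightProb_le (mem_zpowers_genUnit lam) (card_eq lam) (deg_lt lam)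
    (by omega : j < chr lam - 1)

theorem card_alphabet (lam : ℕ) :
    Nat.card (code lam).Alphabet = (chr lam * chr lam) ^ (chr lam + 1) := by
  change Nat.card (Fin (chr lam + 1) → Fld lam) = _
  rw [Nat.card_fun, Nat.card_fin, Nat.card_eq_fintype_card, card_fld]

theorem two_pow_le_card_code (lam : ℕ) :
    2 ^ ((code lam).n + lam) ≤ Nat.card (code lam).code := by
  have h1 := Code.ncard_folded_reedSolomon (mem_zpowers_genUnit lam) (card_eq lam) (deg_lt lam)
  rw [← Nat.card_coe_set_eq, card_fld] at h1
  refine le_of_le_of_eq ?_ h1.symm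
  have hp := (chr_spec lam).2.1
  have h2 := length_bounds lam
  refine (Nat.pow_le_pow_left (?_ : 2 ≤ chr lam * chr lam) _).trans
    (Nat.pow_le_pow_right (by nlinarith) ?_)
  · nlinarith
  · change chr lam - 1 + lam ≤ degreeBound lam + 1
    simp only [degreeBound]
    omega

theorem length_isTheta :
    (fun lam : ℕ => ((code lam).n : ℝ)) =Θ[atTop] (fun lam : ℕ => (lam : ℝ)) := by
  have hn (lam : ℕ) : (code lam).n = chr lam - 1 := rfl
  constructor
  · refine Asymptotics.IsBigO.of_bound 3 ?_
    filter_upwards [eventually_ge_atTop 200] with lam h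
    have h1 : (code lam).n ≤ 3 * lam := by
      have := (chr_spec lam).1
      rw [hn]
      omega
    rw [Real.norm_natCast, Real.norm_natCast]
    exact_mod_cast h1
  · refine Asymptotics.IsBigO.of_bound 1 (Eventually.of_forall fun lam => ?_)
    have h1 : lam ≤ (code lam).n := by
      have := (chr_spec lam).2.1
      rw [hn]
      omega
    rw [Real.norm_natCast, Real.norm_natCast, one_mul]
    exact_mod_cast h1

theorem card_alphabet_bounds : ∃ a b : ℝ, 0 < a ∧ 0 < b ∧ ∀ᶠ lam : ℕ in atTop,
    (2 : ℝ) ^ ((lam : ℝ) ^ a) ≤ Nat.card (code lam).Alphabet ∧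
    (Nat.card (code lam).Alphabet : ℝ) ≤ (2 : ℝ) ^ ((lam : ℝ) ^ b) := by
  refine ⟨1, 3, one_pos, by norm_num, ?_⟩
  filter_upwards [eventually_ge_atTop 300] with lam h
  obtain ⟨h1, h2, _⟩ := chr_spec lam
  rw [card_alphabet, Real.rpow_one, show (lam : ℝ) ^ (3 : ℝ) = (lam ^ 3 : ℕ) by
    rw [Nat.cast_pow]; exact_mod_cast Real.rpow_natCast (lam : ℝ) 3, Real.rpow_natCast,
    Real.rpow_natCast]
  norm_cast
  constructor
  · exact (Nat.pow_le_pow_left (by nlinarith : 2 ≤ chr lam * chr lam) _).trans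
      (Nat.pow_le_pow_right (by nlinarith) (by omega))
  · have h3 : chr lam ≤ 2 ^ chr lam := Nat.lt_two_pow_self.le
    calc (chr lam * chr lam) ^ (chr lam + 1) ≤ (2 ^ chr lam * 2 ^ chr lam) ^ (chr lam + 1) :=
          Nat.pow_le_pow_left (Nat.mul_le_mul h3 h3) _
      _ = 2 ^ (2 * chr lam * (chr lam + 1)) := by rw [← pow_add, ← pow_mul, ← two_mul]
      _ ≤ 2 ^ lam ^ 3 := by
          refine Nat.pow_le_pow_right (by norm_num) ?_
          have h4 : chr lam + 1 ≤ 3 * lam := by omega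
          calc 2 * chr lam * (chr lam + 1) ≤ 2 * (3 * lam) * (3 * lam) :=
                Nat.mul_le_mul (Nat.mul_le_mul_left _ (by omega)) h4
            _ = 18 * lam ^ 2 := by ring
            _ ≤ lam * lam ^ 2 := Nat.mul_le_mul_right _ (by omega)
            _ = lam ^ 3 := by ring

/-- The window parameter for input lists of size `2 ^ lam ^ c`: a number `u` with
`2 * 2 ^ lam ^ c < (3 / 2) ^ u`. -/
noncomputable def window (c : ℝ) (lam : ℕ) : ℕ := 2 * ⌈(lam : ℝ) ^ c⌉₊ + 4

/-- The binary logarithm of the output list size; for the finitely many small indices this is the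
trivial bound. -/
noncomputable def listExponent (c : ℝ) (lam : ℕ) : ℝ :=
  if 5000 * window c lam ≤ chr lam + 1 then
    (50 * window c lam : ℕ) * Real.logb 2 ((chr lam * chr lam : ℕ) : ℝ)
  else ((chr lam - 1) * (chr lam + 1) : ℕ) * Real.logb 2 ((chr lam * chr lam : ℕ) : ℝ)

theorem two_rpow_mul_logb {q : ℕ} (hq : 0 < q) (N : ℕ) :
    (2 : ℝ) ^ (N * Real.logb 2 (q : ℝ)) = (q : ℝ) ^ N := by
  rw [mul_comm, Real.rpow_mul (by norm_num), Real.rpow_logb (by norm_num) (by norm_num)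
    (by exact_mod_cast hq), Real.rpow_natCast]

theorem listRecoverable_code (c : ℝ) (lam : ℕ) :
    Code.ListRecoverable ((code lam).code : Set (code lam).Word) (1 / 100)
      ((2 : ℝ) ^ ((lam : ℝ) ^ c)) ((2 : ℝ) ^ listExponent c lam) := by
  have hp := (chr_spec lam).2.1
  have hq : 0 < chr lam * chr lam := Nat.mul_pos (by omega) (by omega)
  unfold listExponent
  split_ifs with h
  · rw [two_rpow_mul_logb hq]
    have h1 : (2 : ℝ) * 2 ^ ((lam : ℝ) ^ c) < (3 / 2) ^ window c lam := by
      have h2 : (2 : ℝ) ^ ((lam : ℝ) ^ c) ≤ 2 ^ ⌈(lam : ℝ) ^ c⌉₊ := by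
        rw [← Real.rpow_natCast]
        exact Real.rpow_le_rpow_of_exponent_le (by norm_num) (Nat.le_ceil _)
      have h3 : (2 : ℝ) ^ ⌈(lam : ℝ) ^ c⌉₊ ≤ ((3 / 2) ^ 2) ^ ⌈(lam : ℝ) ^ c⌉₊ :=
        pow_le_pow_left₀ (by norm_num) (by norm_num) _
      have h4 : (0 : ℝ) < 2 ^ ((lam : ℝ) ^ c) := by positivity
      rw [window, pow_add, pow_mul]
      nlinarith
    have h5 := length_bounds lam
    have h6 := Code.listRecoverable_pow (mem_zpowers_genUnit lam) (card_eq lam) (deg_lt lam)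
      (by simp only [degreeBound]; omega) (by simp only [degreeBound]; omega) (by positivity)
      (Nat.succ_pos _ : 0 < window c lam) h h1
    have h7 : ((chr lam * chr lam : ℕ) : ℝ) =
        ((chr lam - 1 : ℕ) : ℝ) * ((chr lam + 1 : ℕ) : ℝ) + 1 := by
      rw [← fieldSize_eq]
      push_cast
      ring
    rw [h7]
    exact h6
  · rw [two_rpow_mul_logb hq]
    exact Code.listRecoverable_card (F := Fld lam)
      (by rw [Nat.card_eq_fintype_card, card_fld]) _ _ _

theorem listExponent_isSoftO {c c' : ℝ} (hc : 0 < c) (hcc' : c < c') (hc' : c' < 1) :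
    IsSoftO (listExponent c) (fun lam : ℕ => (lam : ℝ) ^ c') := by
  have hwin : ∀ lam : ℕ, 1 ≤ lam → (window c lam : ℝ) ≤ 8 * (lam : ℝ) ^ c := by
    intro lam h
    have h0 : (1 : ℝ) ≤ lam := by exact_mod_cast h
    have h1 := Nat.ceil_lt_add_one (Real.rpow_nonneg (Nat.cast_nonneg lam) c)
    have h2 := Real.one_le_rpow h0 hc.le
    rw [window]
    push_cast
    linarith
  refine ⟨1, Asymptotics.IsBigO.of_bound (50 * 8 * 4 / Real.log 2) ?_⟩
  have hlim : ∀ᶠ lam : ℕ in atTop, (40000 : ℝ) * (lam : ℝ) ^ c ≤ lam := by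
    have h1 := (tendsto_rpow_atTop (sub_pos.2 (hcc'.trans hc'))).comp tendsto_natCast_atTop_atTop
    filter_upwards [h1.eventually_ge_atTop 40000, eventually_ge_atTop 1] with lam h h0
    have h0 : (0 : ℝ) < lam := by exact_mod_cast h0
    calc (40000 : ℝ) * (lam : ℝ) ^ c ≤ (lam : ℝ) ^ (1 - c) * (lam : ℝ) ^ c := by
          exact mul_le_mul_of_nonneg_right h (by positivity)
      _ = lam := by rw [← Real.rpow_add h0]; simp
  filter_upwards [hlim, eventually_ge_atTop 300] with lam h h300
  obtain ⟨hp1, hp2, _⟩ := chr_spec lam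
  have h0 : (300 : ℝ) ≤ lam := by exact_mod_cast h300
  have h1 := hwin lam (by omega)
  have h2 : 5000 * window c lam ≤ chr lam + 1 := by
    have h3 : (5000 * window c lam : ℝ) ≤ lam := by linarith
    have h4 : 5000 * window c lam ≤ lam := by exact_mod_cast h3
    omega
  rw [listExponent, if_pos h2, pow_one]
  have hlog2 : 0 < Real.log 2 := Real.log_pos (by norm_num)
  have hlog : 0 ≤ Real.log lam := Real.log_nonneg (by linarith)
  have h5 : Real.log ((chr lam * chr lam : ℕ) : ℝ) ≤ 4 * Real.log lam := by
    have h6 : chr lam ≤ lam ^ 2 := by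
      rw [pow_two]
      exact (by omega : chr lam ≤ 3 * lam).trans (Nat.mul_le_mul_right _ (by omega))
    have h7 : chr lam * chr lam ≤ lam ^ 4 := (Nat.mul_le_mul h6 h6).trans_eq (by ring)
    have h8 : ((chr lam * chr lam : ℕ) : ℝ) ≤ (lam : ℝ) ^ 4 := by exact_mod_cast h7
    have h9 : (0 : ℝ) < ((chr lam * chr lam : ℕ) : ℝ) := by
      exact_mod_cast Nat.mul_pos (by omega) (by omega)
    exact (Real.log_le_log h9 h8).trans_eq (by rw [Real.log_pow]; norm_num)
  have h6 : 0 ≤ Real.log ((chr lam * chr lam : ℕ) : ℝ) := Real.log_natCast_nonneg _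
  have h7 : (lam : ℝ) ^ c ≤ (lam : ℝ) ^ c' :=
    Real.rpow_le_rpow_of_exponent_le (by linarith) hcc'.le
  rw [Real.norm_of_nonneg (by rw [Real.logb]; positivity), Real.norm_of_nonneg (by positivity),
    Real.logb, Nat.cast_mul, Nat.cast_ofNat]
  calc 50 * (window c lam : ℝ) * (Real.log ((chr lam * chr lam : ℕ) : ℝ) / Real.log 2)
      ≤ 50 * (8 * (lam : ℝ) ^ c') * (4 * Real.log lam / Real.log 2) := by
        gcongr
        exact h1.trans (by gcongr)
    _ = _ := by ring

end FRSFamily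

theorem mainTheorem11 (c c' : ℝ) (hc : 0 < c) (hcc' : c < c') (hc' : c' < 1) :
    ∃ C : ℕ → FoldedRS,
      FoldedRS.Explicit C ∧
      (∃ a b : ℝ, 0 < a ∧ 0 < b ∧ ∀ᶠ lam : ℕ in atTop,
        (2 : ℝ) ^ ((lam : ℝ) ^ a) ≤ Nat.card (C lam).Alphabet ∧
        (Nat.card (C lam).Alphabet : ℝ) ≤ (2 : ℝ) ^ ((lam : ℝ) ^ b)) ∧
      (fun lam : ℕ => ((C lam).n : ℝ)) =Θ[atTop] (fun lam : ℕ => (lam : ℝ)) ∧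
      (∀ lam, 2 ^ ((C lam).n + lam) ≤ Nat.card (C lam).code) ∧
      (∃ ζ : ℝ, 0 < ζ ∧ ∃ g : ℕ → ℝ, IsSoftO g (fun lam : ℕ => (lam : ℝ) ^ c') ∧
        ∀ lam : ℕ, Code.ListRecoverable ((C lam).code : Set (C lam).Word) ζ
          ((2 : ℝ) ^ ((lam : ℝ) ^ c)) ((2 : ℝ) ^ g lam)) ∧
      (∃ Dec : ∀ lam, (C lam).Word → (C lam).Word,
        FoldedRS.Efficient C Dec ∧
        ∃ δ : ℝ, 0 < δ ∧ ∀ᶠ lam : ℕ in atTop,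
          1 - (2 : ℝ) ^ (-(δ * lam)) ≤
            Code.noiseProb fun e : (C lam).Word =>
              ∀ x ∈ Code.dual (C lam).code, Dec lam (x + e) = x) ∧
      (∀ lam, ∀ j ∈ Finset.Icc 1 ((C lam).n - 1),
        Code.weightProb ((C lam).code : Set (C lam).Word) ((C lam).n - j) ≤
          (((C lam).n : ℝ) / Nat.card (C lam).Alphabet) ^ j) := by
  refine ⟨FRSFamily.code, FRSFamily.explicit, FRSFamily.card_alphabet_bounds,
    FRSFamily.length_isTheta, FRSFamily.two_pow_le_card_code,
    ⟨1 / 100, by norm_num, FRSFamily.listExponent c,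
      FRSFamily.listExponent_isSoftO hc hcc' hc', FRSFamily.listRecoverable_code c⟩,
    ⟨FRSFamily.decoder, FRSFamily.efficient_decoder, FRSFamily.exists_decoding_bound⟩,
    FRSFamily.weightProb_code_le⟩
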